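/- Let $\varphi:T^2=\mathbb{C}/\Lambda\to\mathbb{CP}^2$ be a superconformal minimal Lagrangian torus (i.e. with non-zero Hopf differential), with horizontal lift $f:\mathbb{C}\to S^5\subset\mathbb{C}^3$, where the conformal coordinate $z$ is scaled so that $\langle f_{zzz},f\rangle=1$ and the phase of $f$ is chosen so that the frame $F=(f,\ f_z/|f_z|,\ -f_{\bar z}/|f_{\bar z}|)$ has determinant $1$. Put $\alpha=F^{-1}dF=\alpha_{\mathfrak k}+\alpha_{\mathfrak p}$, where $\mathfrak k^{\mathbb C}=\{\mathrm{diag}(0,a,-a)\}$ and $\mathfrak p^{\mathbb C}$ is its complement in $\mathfrak{sl}_3(\mathbb{C})$ consisting of the matrices $X$ with $X_{22}=X_{33}$, and let $\alpha_\zeta=\zeta\alpha_{\mathfrak p}^{1,0}+\alpha_{\mathfrak k}+\zeta^{-1}\alpha_{\mathfrak p}^{0,1}$ for $|\zeta|=1$. Let $\epsilon=e^{2\pi i/3}$, $S=\mathrm{diag}(1,\epsilon,\epsilon^2)$, and let $T$ be the permutation matrix exchanging $e_2$ and $e_3$. Let $\mathcal{A}$ be the algebra of complexified polynomial Killing fields: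 the families $\xi_\zeta(z)\in\mathfrak{gl}_3(\mathbb{C})$, $z\in\mathbb{C}$, that are Laurent polynomials in $\zeta$ (of degree bounded independently of $z$) and satisfy $S\xi_\zeta S^{-1}=\xi_{\epsilon\zeta}$ and $d\xi_\zeta=[\xi_\zeta,\alpha_\zeta]$. Then $\mathcal{A}$ is a commutative integral domain, $\mu_*(\xi)_\zeta=T\,\xi_{-\zeta}^{\,t}\,T$ defines an algebra automorphism of $\mathcal{A}$, and with $\mathcal{A}^\mu=\{\xi\in\mathcal{A}:\mu_*\xi=\xi\}$ the following hold. 1. $\zeta^6I\in\mathcal{A}^\mu$ and $\mathcal{A}=\mathcal{A}^\mu[\zeta^3I]\cong\mathcal{A}^\mu[t]/(t^2-\zeta^6I)$, where $t$ corresponds to $\zeta^3I$. 2. Let $X$ and $Y$ be the smooth completions of $\mathrm{Spec}(\mathcal{A})$ and $\mathrm{Spec}(\mathcal{A}^\mu)$, i.e. the smooth complete curves over $\mathbb{C}$ with function fields $\mathrm{Frac}(\mathcal{A})$ and $\mathrm{Frac}(\mathcal{A}^\mu)$. The function $\lambda=\zeta^3I$ on $X$ has exactly one zero $P_0$ and exactly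 one pole $P_\infty$. The inclusion $\mathcal{A}^\mu\subset\mathcal{A}$ is dual to a double cover $\delta:X\to Y$ which is ramified at $P_0$ and $P_\infty$ only. 3. The involution $\mu$ of $X$ induced by $\mu_*$ is the swapping of sheets of $\delta$: the fibre of $\delta$ through $P$ is $\{P,\mu(P)\}$, and $\mu$ fixes only $P_0$ and $P_\infty$. 4. If $p$ is the genus of $Y$, then $X$ has genus $2p$. -/

import Mathlib

open scoped ContDiff IsMulCommutative

noncomputable section

namespace MinLag

/-! ### Wirtinger derivatives -/

/-- `∂g/∂z = (∂g/∂x - i ∂g/∂y) / 2` for a function on `ℝ² = ℂ` with values in a complex space. -/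
def dz {E : Type*} [NormedAddCommGroup E] [NormedSpace ℝ E] [Module ℂ E] (g : ℂ → E) (z : ℂ) : E :=
  (1 / 2 : ℂ) • (fderiv ℝ g z 1 - Complex.I • fderiv ℝ g z Complex.I)

/-- `∂g/∂z̄ = (∂g/∂x + i ∂g/∂y) / 2`. -/
def dzbar {E : Type*} [NormedAddCommGroup E] [NormedSpace ℝ E] [Module ℂ E] (g : ℂ → E) (z : ℂ) :
    E :=
  (1 / 2 : ℂ) • (fderiv ℝ g z 1 + Complex.I • fderiv ℝ g z Complex.I)

/-- Complex `3 × 3` matrices, i.e. `𝔤𝔩₃(ℂ)`. -/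
abbrev Mat := Matrix (Fin 3) (Fin 3) ℂ

/-- Entrywise `∂/∂z` of a matrix valued function. -/
def dzMat (g : ℂ → Mat) (z : ℂ) : Mat := Matrix.of fun i j => dz (fun w => g w i j) z

/-- Entrywise `∂/∂z̄` of a matrix valued function. -/
def dzbarMat (g : ℂ → Mat) (z : ℂ) : Mat := Matrix.of fun i j => dzbar (fun w => g w i j) z

/-! ### Minimal Lagrangian tori in `ℂP²` -/

/-- The frame `(f, f_z / |f_z|, - f_z̄ / |f_z̄|)` (by columns) of a map `f : ℝ² → S⁵ ⊂ ℂ³`. -/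
def frame (f : ℂ → EuclideanSpace ℂ (Fin 3)) (z : ℂ) : Mat :=
  Matrix.of fun i j =>
    (![f z, ((‖dz f z‖⁻¹ : ℝ) : ℂ) • dz f z, -(((‖dzbar f z‖⁻¹ : ℝ) : ℂ) • dzbar f z)] j) i

/-- A superconformal minimal Lagrangian torus `φ : T² = ℂ / Λ → ℂP²`, together with its horizontal
(i.e. Legendrian) lift `f : ℝ² → S⁵ ⊂ ℂ³` to the universal cover. Here `z` is a conformal
coordinate; conformal immersions are minimal exactly when they are harmonic. The Hopf differential
`⟨f_zzz, f⟩ dz³` is a non-zero constant multiple of `dz³`; as usual the coordinate `z` is scaled so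
that the constant is `1`, and the phase of `f` is chosen so that the frame lies in `SU₃`. -/
structure MinimalLagrangianTorus where
  /-- the period lattice of the torus -/
  lattice : Submodule ℤ ℂ
  discrete : DiscreteTopology lattice
  span_eq_top : Submodule.span ℝ (lattice : Set ℂ) = ⊤
  /-- the torus in `ℂP²` -/
  φ : ℂ ⧸ lattice → Projectivization ℂ (EuclideanSpace ℂ (Fin 3))
  /-- its horizontal lift -/
  f : ℂ → EuclideanSpace ℂ (Fin 3)
  smooth : ContDiff ℝ ∞ f
  norm_eq_one : ∀ z, ‖f z‖ = 1
  lift : ∀ z, (φ (Submodule.Quotient.mk z)).submodule = Submodule.span ℂ {f z}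
  /-- `f` is horizontal for the Hopf fibration: `df ⊥ f` for the Hermitian inner product -/
  horizontal : ∀ z v, inner ℂ (f z) (fderiv ℝ f z v) = 0
  immersion : ∀ z, Function.Injective (fderiv ℝ f z)
  conformal_norm : ∀ z, ‖fderiv ℝ f z 1‖ = ‖fderiv ℝ f z Complex.I‖
  conformal_orth : ∀ z, (inner ℂ (fderiv ℝ f z 1) (fderiv ℝ f z Complex.I)).re = 0
  /-- the harmonic map equation `Δf = - |df|² f` for maps into the unit sphere, written with
  `Δ = 4 ∂²/∂z∂z̄` and `|df|² = 2 (|f_z|² + |f_z̄|²)` -/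
  harmonic : ∀ z, dzbar (dz f) z =
    (((-(‖dz f z‖ ^ 2 + ‖dzbar f z‖ ^ 2) / 2 : ℝ)) : ℂ) • f z
  /-- `⟨f_zzz, f⟩ = 1` (Mathlib's inner product is conjugate linear in the first variable) -/
  hopf_eq_one : ∀ z, inner ℂ (f z) (dz (dz (dz f)) z) = 1
  det_frame : ∀ z, (frame f z).det = 1

/-! ### The loop `α_ζ` of connection forms -/

/-- Projection of `𝔰𝔩₃` onto `𝔨^ℂ = {diag(0, a, -a)}` along the sum `𝔭^ℂ` of the other eigenspaces
of the order six automorphism `σ = μν`. -/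
def projK (X : Mat) : Mat :=
  Matrix.diagonal ![0, (X 1 1 - X 2 2) / 2, (X 2 2 - X 1 1) / 2]

/-- Projection of `𝔰𝔩₃` onto `𝔭^ℂ` along `𝔨^ℂ`. -/
def projP (X : Mat) : Mat := X - projK X

/-- `α(∂/∂z)` for `α = F⁻¹ dF`, `F` the frame of the torus. -/
def alphaZ (t : MinimalLagrangianTorus) (z : ℂ) : Mat := (frame t.f z)⁻¹ * dzMat (frame t.f) z

/-- `α(∂/∂z̄)` for `α = F⁻¹ dF`. -/
def alphaZbar (t : MinimalLagrangianTorus) (z : ℂ) : Mat :=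
  (frame t.f z)⁻¹ * dzbarMat (frame t.f) z

/-- `α_ζ(∂/∂z)` where `α_ζ = ζ α_𝔭^{1,0} + α_𝔨 + ζ⁻¹ α_𝔭^{0,1}`. -/
def alphaLoopZ (t : MinimalLagrangianTorus) (ζ : Circle) (z : ℂ) : Mat :=
  (ζ : ℂ) • projP (alphaZ t z) + projK (alphaZ t z)

/-- `α_ζ(∂/∂z̄)` where `α_ζ = ζ α_𝔭^{1,0} + α_𝔨 + ζ⁻¹ α_𝔭^{0,1}`. -/
def alphaLoopZbar (t : MinimalLagrangianTorus) (ζ : Circle) (z : ℂ) : Mat :=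
  projK (alphaZbar t z) + (ζ : ℂ)⁻¹ • projP (alphaZbar t z)

/-! ### Polynomial Killing fields -/

/-- Families `ξ_ζ(z)` of matrices, with `ζ ∈ S¹` and `z ∈ ℝ²`. -/
abbrev Loop := Circle → ℂ → Mat

/-- `ε = exp(2πi/3)`. -/
def eps : Circle := Circle.exp (2 * Real.pi / 3)

/-- `S = diag(1, ε, ε²)`; the Coxeter-Killing automorphism is `ν = Ad S`. -/
def matS : Mat := Matrix.diagonal ![1, (eps : ℂ), (eps : ℂ) ^ 2]

/-- The matrix `T = T⁻¹` which exchanges `e₂` and `e₃`. -/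
def matT : Mat := !![1, 0, 0; 0, 0, 1; 0, 1, 0]

/-- `ξ` is a complexified polynomial Killing field of the torus `t`: it is a Laurent polynomial
in `ζ` (with the same degree bounds for all `z`), `ν(ξ_ζ) = ξ_{εζ}` and `dξ_ζ = [ξ_ζ, α_ζ]`. -/
structure IsKilling (t : MinimalLagrangianTorus) (ξ : Loop) : Prop where
  laurent : ∃ c : ℤ →₀ (ℂ → Mat), ∀ ζ z, ξ ζ z = c.sum fun k X => (ζ : ℂ) ^ k • X z
  twisted : ∀ ζ z, matS * ξ ζ z * matS⁻¹ = ξ (eps * ζ) z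
  differentiable : ∀ ζ i j, Differentiable ℝ fun z => ξ ζ z i j
  eq_dz : ∀ ζ z, dzMat (ξ ζ) z = ξ ζ z * alphaLoopZ t ζ z - alphaLoopZ t ζ z * ξ ζ z
  eq_dzbar : ∀ ζ z, dzbarMat (ξ ζ) z = ξ ζ z * alphaLoopZbar t ζ z - alphaLoopZbar t ζ z * ξ ζ z

lemma dzMat_add {g h : ℂ → Mat} (hg : ∀ i j, Differentiable ℝ fun z => g z i j)
    (hh : ∀ i j, Differentiable ℝ fun z => h z i j) (z : ℂ) :
    dzMat (g + h) z = dzMat g z + dzMat h z := by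
  ext i j
  have := fderiv_fun_add (hg i j z) (hh i j z)
  simp only [dzMat, dz, Matrix.of_apply, Pi.add_apply, Matrix.add_apply, this, add_apply,
    smul_eq_mul]
  ring

lemma dzbarMat_add {g h : ℂ → Mat} (hg : ∀ i j, Differentiable ℝ fun z => g z i j)
    (hh : ∀ i j, Differentiable ℝ fun z => h z i j) (z : ℂ) :
    dzbarMat (g + h) z = dzbarMat g z + dzbarMat h z := by
  ext i j
  have := fderiv_fun_add (hg i j z) (hh i j z)
  simp only [dzbarMat, dzbar, Matrix.of_apply, Pi.add_apply, Matrix.add_apply, this, add_apply,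
    smul_eq_mul]
  ring

lemma fderiv_mul_entry {g h : ℂ → Mat} (hg : ∀ i j, Differentiable ℝ fun z => g z i j)
    (hh : ∀ i j, Differentiable ℝ fun z => h z i j) (z v : ℂ) (i j : Fin 3) :
    fderiv ℝ (fun w => (g w * h w) i j) z v =
      ∑ k, (g z i k * fderiv ℝ (fun w => h w k j) z v
        + fderiv ℝ (fun w => g w i k) z v * h z k j) := by
  simp only [Matrix.mul_apply]
  have h := fderiv_fun_sum (𝕜 := ℝ) (u := Finset.univ) (A := fun k w => g w i k * h w k j)
    (x := z) fun k _ => (hg i k z).fun_mul (hh k j z)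
  rw [h, sum_apply]
  refine Finset.sum_congr rfl fun k _ => ?_
  rw [fderiv_fun_mul (hg i k z) (hh k j z)]
  simp only [add_apply, smul_apply, smul_eq_mul]
  ring

lemma dzMat_mul {g h : ℂ → Mat} (hg : ∀ i j, Differentiable ℝ fun z => g z i j)
    (hh : ∀ i j, Differentiable ℝ fun z => h z i j) (z : ℂ) :
    dzMat (g * h) z = g z * dzMat h z + dzMat g z * h z := by
  ext i j
  simp only [dzMat, dz, Matrix.of_apply, Pi.mul_apply, Matrix.add_apply, Matrix.mul_apply (M := g z),
    Matrix.mul_apply (N := h z), fderiv_mul_entry hg hh, smul_eq_mul, Finset.mul_sum,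
    ← Finset.sum_sub_distrib, ← Finset.sum_add_distrib]
  refine Finset.sum_congr rfl fun k _ => ?_
  ring

lemma dzbarMat_mul {g h : ℂ → Mat} (hg : ∀ i j, Differentiable ℝ fun z => g z i j)
    (hh : ∀ i j, Differentiable ℝ fun z => h z i j) (z : ℂ) :
    dzbarMat (g * h) z = g z * dzbarMat h z + dzbarMat g z * h z := by
  ext i j
  simp only [dzbarMat, dzbar, Matrix.of_apply, Pi.mul_apply, Matrix.add_apply,
    Matrix.mul_apply (M := g z), Matrix.mul_apply (N := h z), fderiv_mul_entry hg hh, smul_eq_mul,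
    Finset.mul_sum, ← Finset.sum_add_distrib]
  refine Finset.sum_congr rfl fun k _ => ?_
  ring

lemma dzMat_const (C : Mat) (z : ℂ) : dzMat (fun _ => C) z = 0 := by
  ext i j
  simp [dzMat, dz]

lemma dzbarMat_const (C : Mat) (z : ℂ) : dzbarMat (fun _ => C) z = 0 := by
  ext i j
  simp [dzbarMat, dzbar]

lemma isUnit_det_matS : IsUnit matS.det := by
  simp [matS, Matrix.det_diagonal, Fin.prod_univ_three]

lemma matS_mul_inv : matS * matS⁻¹ = 1 := Matrix.mul_nonsing_inv _ isUnit_det_matS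

lemma matS_inv_mul : matS⁻¹ * matS = 1 := Matrix.nonsing_inv_mul _ isUnit_det_matS

lemma eps_pow_three : eps ^ 3 = 1 := by
  rw [eps, ← Circle.exp_nsmul, nsmul_eq_mul]
  rw [show ((3 : ℕ) : ℝ) * (2 * Real.pi / 3) = 2 * Real.pi by push_cast; ring]
  exact Circle.exp_two_pi

/-- Scalar loops `ζ^n a I` with `3 ∣ n` are polynomial Killing fields. -/
lemma isKilling_scalar (t : MinimalLagrangianTorus) (m : ℕ) (a : ℂ) :
    IsKilling t fun ζ _ => (((ζ : ℂ) ^ 3) ^ m * a) • (1 : Mat) where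
  laurent := by
    refine ⟨Finsupp.single ((3 * m : ℕ) : ℤ) fun _ => a • (1 : Mat), fun ζ z => ?_⟩
    rw [Finsupp.sum_single_index]
    · rw [zpow_natCast, smul_smul, pow_mul]
    · simp
  twisted := fun ζ z => by
    have h : ((eps * ζ : Circle) : ℂ) ^ 3 = (ζ : ℂ) ^ 3 := by
      rw [← Circle.coe_pow, mul_pow, eps_pow_three, one_mul, Circle.coe_pow]
    simp only [h, mul_smul_comm, mul_one, smul_mul_assoc, matS_mul_inv]
  differentiable := fun ζ i j => differentiable_const _
  eq_dz := fun ζ z => by simp [dzMat_const]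
  eq_dzbar := fun ζ z => by simp [dzbarMat_const]

lemma IsKilling.add {t : MinimalLagrangianTorus} {ξ η : Loop} (hξ : IsKilling t ξ)
    (hη : IsKilling t η) : IsKilling t (ξ + η) where
  laurent := by
    obtain ⟨c, hc⟩ := hξ.laurent
    obtain ⟨d, hd⟩ := hη.laurent
    refine ⟨c + d, fun ζ z => ?_⟩
    rw [Finsupp.sum_add_index' (by simp) (by intros; simp)]
    simp [hc, hd]
  twisted := fun ζ z => by
    simp [mul_add, add_mul, hξ.twisted, hη.twisted]
  differentiable := fun ζ i j => (hξ.differentiable ζ i j).add (hη.differentiable ζ i j)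
  eq_dz := fun ζ z => by
    rw [Pi.add_apply, dzMat_add (hξ.differentiable ζ) (hη.differentiable ζ), hξ.eq_dz, hη.eq_dz,
      Pi.add_apply]
    noncomm_ring
  eq_dzbar := fun ζ z => by
    rw [Pi.add_apply, dzbarMat_add (hξ.differentiable ζ) (hη.differentiable ζ), hξ.eq_dzbar,
      hη.eq_dzbar, Pi.add_apply]
    noncomm_ring

lemma IsKilling.mul {t : MinimalLagrangianTorus} {ξ η : Loop} (hξ : IsKilling t ξ)
    (hη : IsKilling t η) : IsKilling t (ξ * η) where
  laurent := by
    obtain ⟨c, hc⟩ := hξ.laurent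
    obtain ⟨d, hd⟩ := hη.laurent
    refine ⟨c.sum fun k X => d.sum fun l Y => Finsupp.single (k + l) (X * Y), fun ζ z => ?_⟩
    rw [Finsupp.sum_sum_index (by simp) (by intros; simp)]
    simp only [Pi.mul_apply, hc, hd]
    rw [Finsupp.sum, Finset.sum_mul]
    refine Finset.sum_congr rfl fun k _ => ?_
    beta_reduce
    rw [Finsupp.sum_sum_index (by simp) (by intros; simp), Finsupp.sum, Finset.mul_sum]
    refine Finset.sum_congr rfl fun l _ => ?_
    beta_reduce
    rw [Finsupp.sum_single_index (by simp), Pi.mul_apply, zpow_add₀ (Circle.coe_ne_zero ζ),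
      smul_mul_smul_comm]
  twisted := fun ζ z => by
    rw [Pi.mul_apply, Pi.mul_apply, Pi.mul_apply, Pi.mul_apply, ← hξ.twisted, ← hη.twisted]
    calc matS * (ξ ζ z * η ζ z) * matS⁻¹
        = matS * ξ ζ z * 1 * η ζ z * matS⁻¹ := by noncomm_ring
      _ = _ := by rw [← matS_inv_mul]; noncomm_ring
  differentiable := fun ζ i j => by
    simp only [Pi.mul_apply, Matrix.mul_apply]
    exact Differentiable.fun_sum fun k _ => (hξ.differentiable ζ i k).mul (hη.differentiable ζ k j)
  eq_dz := fun ζ z => by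
    rw [Pi.mul_apply, dzMat_mul (hξ.differentiable ζ) (hη.differentiable ζ), hξ.eq_dz, hη.eq_dz,
      Pi.mul_apply]
    noncomm_ring
  eq_dzbar := fun ζ z => by
    rw [Pi.mul_apply, dzbarMat_mul (hξ.differentiable ζ) (hη.differentiable ζ), hξ.eq_dzbar,
      hη.eq_dzbar, Pi.mul_apply]
    noncomm_ring

/-- The algebra `𝒜` of complexified polynomial Killing fields. -/
def killing (t : MinimalLagrangianTorus) : Subalgebra ℂ Loop where
  carrier := {ξ | IsKilling t ξ}
  mul_mem' := IsKilling.mul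
  add_mem' := IsKilling.add
  algebraMap_mem' := fun a => by
    have h := isKilling_scalar t 0 a
    have e : (fun ζ _ => (((ζ : ℂ) ^ 3) ^ 0 * a) • (1 : Mat) : Loop) = algebraMap ℂ Loop a := by
      funext ζ z
      simp [Pi.algebraMap_apply, Algebra.algebraMap_eq_smul_one]
    rw [e] at h
    exact h

/-- The element `λ = ζ³ I` of `𝒜`. -/
def lam (t : MinimalLagrangianTorus) : killing t :=
  ⟨fun ζ _ => (ζ : ℂ) ^ 3 • (1 : Mat), by
    have h := isKilling_scalar t 1 1
    simp only [pow_one, mul_one] at h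
    exact h⟩

/-- The involution `μ_*` of loops: `μ_*(ξ)_ζ = T (ξ_{-ζ})ᵗ T`. It is linear and reverses products,
so it is multiplicative on commuting loops. -/
def muLoop (ξ : Loop) : Loop := fun ζ z => matT * (ξ (-ζ) z).transpose * matT

/-- The subalgebra of elements fixed by an automorphism. -/
def fixedSubalgebra {A : Type} [CommRing A] [Algebra ℂ A] (mu : A ≃ₐ[ℂ] A) : Subalgebra ℂ A where
  carrier := {a | mu a = a}
  mul_mem' := fun {a b} (ha : mu a = a) (hb : mu b = b) => show mu (a * b) = a * b by
    rw [map_mul, ha, hb]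
  add_mem' := fun {a b} (ha : mu a = a) (hb : mu b = b) => show mu (a + b) = a + b by
    rw [map_add, ha, hb]
  algebraMap_mem' := fun c => mu.commutes c

/-- `A = B[l] ≅ B[t] / (t² - l²)`, where `l² ∈ B` and the isomorphism sends `t` to `l`. -/
def IsQuadraticExtension {A : Type} [CommRing A] [Algebra ℂ A] (B : Subalgebra ℂ A) (l : A) :
    Prop :=
  Algebra.adjoin B {l} = ⊤ ∧
  ∃ q : B, (q : A) = l ^ 2 ∧
    ∃ e : AdjoinRoot (Polynomial.X ^ 2 - Polynomial.C q : Polynomial B) ≃ₐ[B] A,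
      e (AdjoinRoot.root _) = l

/-! ### Smooth complete curves over `ℂ`

The smooth complete curve with function field `F` has as its points the valuation rings of `F / ℂ`;
the local ring at a point is the valuation ring itself. -/

/-- The points of the smooth complete curve with function field `F`, given by their local rings:
the valuation rings `ℂ ⊆ 𝒪 ⊊ F` with fraction field `F`. -/
structure CurvePoint (F : Type) [Field F] [Algebra ℂ F] where
  /-- the local ring of the curve at the point -/
  ring : ValuationSubring F
  const_mem : ∀ c : ℂ, algebraMap ℂ F c ∈ ring
  ne_top : ring ≠ ⊤

/-- The (points of the) smooth completion of the affine curve `Spec R`: the smooth complete curve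
whose function field is the fraction field of `R`. -/
abbrev SmoothCompletion (R : Type) [CommRing R] [IsDomain R] [Algebra ℂ R] :=
  CurvePoint (FractionRing R)

/-- The homomorphism of fraction fields induced by an injective ring homomorphism. -/
def fracMap {R S : Type} [CommRing R] [CommRing S] [IsDomain R] [IsDomain S] (φ : R →+* S)
    (hφ : Function.Injective φ) : FractionRing R →+* FractionRing S :=
  IsFractionRing.map hφ

/-- The inclusion of fraction fields induced by the inclusion of a subalgebra. -/
def inclFrac {R : Type} [CommRing R] [IsDomain R] [Algebra ℂ R] (B : Subalgebra ℂ R) :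
    FractionRing B →+* FractionRing R :=
  fracMap B.val.toRingHom Subtype.val_injective

/-- The homomorphism of the fraction field induced by an automorphism of `R`. -/
def autFrac {R : Type} [CommRing R] [IsDomain R] [Algebra ℂ R] (e : R ≃ₐ[ℂ] R) :
    FractionRing R →+* FractionRing R :=
  fracMap e.toRingEquiv.toRingHom e.injective

section Curve

variable {F : Type} [Field F] [Algebra ℂ F]

/-- The function `x` vanishes at `P`. -/
def CurvePoint.IsZero (P : CurvePoint F) (x : F) : Prop := x ∈ P.ring.nonunits

/-- The function `x` has a pole at `P`. -/
def CurvePoint.IsPole (P : CurvePoint F) (x : F) : Prop := x ∉ P.ring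

/-- `π` is a local parameter at `P`: it generates the maximal ideal of the local ring. -/
def CurvePoint.IsUniformizer (P : CurvePoint F) (π : F) : Prop :=
  ∀ x : F, x ∈ P.ring.nonunits ↔ ∃ y ∈ P.ring, x = π * y

/-- The non-zero function `x` has order `n` at `P`: `x` is `πⁿ` times a unit of the local ring. -/
def CurvePoint.HasOrder (P : CurvePoint F) (x : F) (n : ℤ) : Prop :=
  ∃ π u : F, P.IsUniformizer π ∧ u ∈ P.ring ∧ u ∉ P.ring.nonunits ∧ x = u * π ^ n

lemma mul_zpow_mem_add (P : CurvePoint F) {x y π : F} {n : ℤ} (hx : x * π ^ n ∈ P.ring)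
    (hy : y * π ^ n ∈ P.ring) : (x + y) * π ^ n ∈ P.ring := by
  rw [add_mul]
  exact add_mem hx hy

/-- The Riemann-Roch space `L(D)` of functions `x` with `ord_P x ≥ -D(P)` at all points `P`. -/
def riemannRochSpace (D : CurvePoint F →₀ ℤ) : Submodule ℂ F where
  carrier := {x | ∀ (P : CurvePoint F) (π : F), P.IsUniformizer π → x * π ^ D P ∈ P.ring}
  add_mem' := fun hx hy P π hπ => mul_zpow_mem_add P (hx P π hπ) (hy P π hπ)
  zero_mem' := fun P π _ => by
    rw [zero_mul]
    exact zero_mem _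
  smul_mem' := fun c x hx P π hπ => by
    rw [Algebra.smul_def, mul_assoc]
    exact mul_mem (P.const_mem c) (hx P π hπ)

variable (F) in
/-- The smooth complete curve with function field `F` has genus `g`: `g` is the largest value of
`deg D - dim L(D) + 1` for divisors `D`, i.e. the `g` in the Riemann inequality. -/
def HasGenus (g : ℕ) : Prop :=
  IsGreatest {n : ℤ | ∃ D : CurvePoint F →₀ ℤ,
    n = (D.sum fun _ k => k) - (Module.finrank ℂ (riemannRochSpace D) : ℤ) + 1} (g : ℤ)

/-- The map `δ` from the curve with function field `F` to the curve with function field `E` is the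
morphism of curves dual to the field embedding `i : E → F`: the local ring at `δ(P)` consists
of the functions whose pull-back is regular at `P`. -/
def IsDualTo {E : Type} [Field E] [Algebra ℂ E] (δ : CurvePoint F → CurvePoint E) (i : E →+* F) :
    Prop :=
  ∀ P, (δ P).ring = P.ring.comap i

/-- The morphism `δ` dual to `i` has ramification index `e` at `P`: the pull-back of a local
parameter at `δ(P)` vanishes to order `e` at `P`. -/
def HasRamificationIndex {E : Type} [Field E] [Algebra ℂ E] (δ : CurvePoint F → CurvePoint E)
    (i : E →+* F) (P : CurvePoint F) (e : ℕ) : Prop :=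
  ∃ π : E, (δ P).IsUniformizer π ∧ P.HasOrder (i π) e

/-- The map of curves `δ` dual to `i : E → F` is a double cover: it is surjective and the field
extension has degree two. -/
def IsDoubleCover {E : Type} [Field E] [Algebra ℂ E] (δ : CurvePoint F → CurvePoint E)
    (i : E →+* F) : Prop :=
  IsDualTo δ i ∧ Function.Surjective δ ∧ Module.finrank i.fieldRange F = 2

end Curve

end MinLag

end

noncomputable section

namespace MinLag

open IsDedekindDomain IntermediateField WithZero
open scoped IntermediateField.algebraAdjoinAdjoin

/-! The theorem separates into algebra of double covers and analysis of Killing fields at the ends ζ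
= 0 and ζ = ∞.

Algebra. λ = ζ³I is a unit of 𝒜 with μ_*λ = -λ. Since 2 is invertible, even and odd parts give 𝒜 =
𝒜^μ ⊕ 𝒜^μ λ, which is part 1, and the function field of X is that of Y with a square root of q = λ²
adjoined (`IsKummer`). Over a point where q is a unit the residues of λ are ±b with b ≠ 0. They tell
the points of the fibre apart, so δ is unramified there and μ exchanges the two points
(`IsKummer.exists_ord_eq_mul`, `IsKummer.eq_or_eq_swap_of_unit`). If λ has a single zero and a
single pole, μ fixes both, since -λ has the same zero and pole. A fixed point is ramified: otherwise
λ, divided by a power of a parameter from Y, would be a unit whose residue equals its own negative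
(`IsKummer.ord_gen_ne`). For the genus, L(δ*D) splits into the eigenspaces L(D) and L(D + Δ)λ of
μ_*. The order of λ is odd at P₀ and opposite at P_∞, so rounding gives deg Δ = -1, and counting
dimensions for large D gives 2p (`IsTwoPointKummer.finrank_pull`, `IsTwoPointKummer.hasGenus`). That
the genus exists at all is Riemann's inequality (`exists_defect_le`).

Analysis. In the direction ∂/∂z the connection is ζP + K, where P is a weighted cyclic permutation
matrix with P³ = 1. The top coefficient in ζ of a Killing field commutes with P; by the twist it is
an eigenvector of Ad S, hence a multiple of some Pⁿ; the remaining Killing equations make the factor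
constant (`IsKilling.exists_lead_eq`). This has three consequences. Leading coefficients are
invertible, so there are no zero divisors. Their traces force commutators to vanish
(`IsKilling.mul_comm`). The cube of a Killing field is c³λ^d up to terms of lower degree
(`hasLeadingTerms_lamUnit`). By Cayley-Hamilton, fields of degree at most 0 are integral over
ℂ[λ⁻¹], so those lower terms are small at every pole of λ. Hence the order of a function at a pole
of λ is determined by its degree, and there is only one pole (`unique_pole`). The Hermitian
transpose exchanges λ and λ⁻¹ and takes care of the zero. Finally, a dimension count
(`exists_relation`) bounds the rank of 𝒜 over ℂ[λ²], so X and Y really are curves. -/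

/-- A function field in one variable over `ℂ`: a finite extension of `ℂ(x)` for some
transcendental `x`. -/
class IsFunctionField (F : Type) [Field F] [Algebra ℂ F] : Prop where
  exists_transcendental : ∃ x : F, Transcendental ℂ x ∧ FiniteDimensional ℂ⟮x⟯ F

/-! ### Points of the curve as primes of Dedekind charts -/

section Chart

variable {F : Type} [Field F] [Algebra ℂ F]

/-- A quotient of `ℂ[X]`; transcendence of `w` plays no role here. -/
instance (w : F) : IsPrincipalIdealRing (Algebra.adjoin ℂ {w}) := by
  have h : Function.Surjective ((Polynomial.aeval (R := ℂ) w).rangeRestrict) :=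
    AlgHom.rangeRestrict_surjective _
  rw [Algebra.adjoin_singleton_eq_range_aeval]
  exact IsPrincipalIdealRing.of_surjective _ h

instance (w : F) : IsDedekindDomain (Algebra.adjoin ℂ {w}) := inferInstance

/-- The integral closure of `ℂ[w]` in `F`. -/
abbrev Chart (w : F) := integralClosure (Algebra.adjoin ℂ {w}) F

instance (w : F) [FiniteDimensional ℂ⟮w⟯ F] : IsDedekindDomain (Chart w) :=
  integralClosure.isDedekindDomain (Algebra.adjoin ℂ {w}) ℂ⟮w⟯ F

instance (w : F) [FiniteDimensional ℂ⟮w⟯ F] : IsFractionRing (Chart w) F :=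
  integralClosure.isFractionRing_of_finite_extension ℂ⟮w⟯ F

instance (w : F) [FiniteDimensional ℂ⟮w⟯ F] : Module.Finite (Algebra.adjoin ℂ {w}) (Chart w) :=
  IsIntegralClosure.finite (Algebra.adjoin ℂ {w}) ℂ⟮w⟯ F _

lemma CurvePoint.adjoin_le (P : CurvePoint F) {w : F} (hw : w ∈ P.ring) {b : F}
    (hb : b ∈ Algebra.adjoin ℂ {w}) : b ∈ P.ring := by
  induction hb using Algebra.adjoin_induction with
  | mem x hx => rw [Set.mem_singleton_iff] at hx; rwa [hx]
  | algebraMap r => exact P.const_mem r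
  | add _ _ _ _ hx hy => exact add_mem hx hy
  | mul _ _ _ _ hx hy => exact mul_mem hx hy

/-- Valuation rings are integrally closed. Hence a point at which `w` is regular has a centre on
`Chart w`. -/
lemma CurvePoint.mem_of_isIntegral (P : CurvePoint F) {w : F} (hw : w ∈ P.ring) {b : F}
    (hb : IsIntegral (Algebra.adjoin ℂ {w}) b) : b ∈ P.ring := by
  let f : Algebra.adjoin ℂ {w} →+* P.ring :=
    (algebraMap (Algebra.adjoin ℂ {w}) F).codRestrict P.ring fun x => P.adjoin_le hw x.2
  have h : IsIntegral P.ring b := by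
    have := hb.map_of_comp_eq f (RingHom.id F) (by ext; rfl)
    exact this
  obtain ⟨y, hy⟩ := IsIntegrallyClosed.isIntegral_iff.1 h
  rw [← hy]
  exact y.2

/-- The prime of `Chart w` at which a point is centred. -/
def CurvePoint.center (P : CurvePoint F) {w : F} (hw : w ∈ P.ring) : Ideal (Chart w) :=
  (IsLocalRing.maximalIdeal P.ring).comap
    ((algebraMap (Chart w) F).codRestrict P.ring fun x => P.mem_of_isIntegral hw x.2)

instance (P : CurvePoint F) {w : F} (hw : w ∈ P.ring) : (P.center hw).IsPrime :=
  Ideal.comap_isPrime _ _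

lemma CurvePoint.mem_center (P : CurvePoint F) {w : F} (hw : w ∈ P.ring) (b : Chart w) :
    b ∈ P.center hw ↔ (b : F) ∈ P.ring.nonunits := by
  rw [CurvePoint.center, Ideal.mem_comap, ← ValuationSubring.coe_mem_nonunits_iff]
  rfl

lemma CurvePoint.not_mem_nonunits (P : CurvePoint F) {x : F} (hx0 : x ≠ 0) :
    x ∉ P.ring.nonunits ↔ x⁻¹ ∈ P.ring := by
  rw [ValuationSubring.mem_nonunits_iff_or]
  tauto

/-- If the centre were zero, every non-zero element of the chart would be a unit at `P`, and the
local ring would be all of `F`. -/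
lemma CurvePoint.center_ne_bot (P : CurvePoint F) {w : F} (hw : w ∈ P.ring)
    [FiniteDimensional ℂ⟮w⟯ F] : P.center hw ≠ ⊥ := by
  intro h
  apply P.ne_top
  rw [eq_top_iff]
  intro x _
  obtain ⟨a, b, hb, rfl⟩ := IsFractionRing.div_surjective (A := Chart w) x
  have hb0 : b ≠ 0 := nonZeroDivisors.ne_zero hb
  have hb0' : (b : F) ≠ 0 := by simpa using hb0
  have : (b : F) ∉ P.ring.nonunits := by rwa [← P.mem_center hw, h, Ideal.mem_bot]
  rw [P.not_mem_nonunits hb0'] at this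
  rw [div_eq_mul_inv]
  exact mul_mem (P.mem_of_isIntegral hw a.2) this

/-- The height one prime of `Chart w` at which a point is centred. -/
def CurvePoint.spec (P : CurvePoint F) {w : F} (hw : w ∈ P.ring) [FiniteDimensional ℂ⟮w⟯ F] :
    HeightOneSpectrum (Chart w) := ⟨P.center hw, inferInstance, P.center_ne_bot hw⟩

/-- The localisation of the chart at the centre is a discrete valuation ring contained in `P.ring`,
and its only proper overring is `F`. This is why arbitrary valuation rings over `ℂ` turn out to be
discrete. -/
lemma CurvePoint.valuationSubring_spec (P : CurvePoint F) {w : F} (hw : w ∈ P.ring)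
    [FiniteDimensional ℂ⟮w⟯ F] : ((P.spec hw).valuation F).valuationSubring = P.ring := by
  rw [← HeightOneSpectrum.valuationSubringAtPrime_eq_valuationSubring]
  refine ValuationSubring.eq_of_le_of_ne_top _ (fun x hx => ?_) P.ne_top
  rw [HeightOneSpectrum.valuationSubringAtPrime_eq_valuationSubring,
    Valuation.mem_valuationSubring_iff] at hx
  obtain ⟨n, d, h⟩ := HeightOneSpectrum.exists_primeCompl_mul_eq_of_integer _ x hx
  have hd : ((d : Chart w) : F) ∉ P.ring.nonunits := by
    rw [← P.mem_center hw]; exact d.2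
  have hd0 : ((d : Chart w) : F) ≠ 0 := fun h0 => hd (by rw [h0]; exact zero_mem _)
  rw [P.not_mem_nonunits hd0] at hd
  have : x = n * ((d : Chart w) : F)⁻¹ := by
    rw [eq_mul_inv_iff_mul_eq₀ hd0]; exact h
  rw [this]
  exact mul_mem (P.mem_of_isIntegral hw n.2) hd

end Chart

/-! ### The order of a function at a point -/

section Ord

variable {F : Type} [Field F] [Algebra ℂ F]

lemma CurvePoint.ext_ring {P Q : CurvePoint F} (h : P.ring = Q.ring) : P = Q := by
  cases P; cases Q; congr

lemma transcendental_inv {x : F} (hx : Transcendental ℂ x) : Transcendental ℂ x⁻¹ := by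
  intro h
  exact hx (by simpa using h.inv)

lemma finiteDimensional_inv {x : F} [FiniteDimensional ℂ⟮x⟯ F] : FiniteDimensional ℂ⟮x⁻¹⟯ F := by
  have : ℂ⟮x⁻¹⟯ = ℂ⟮x⟯ := by
    apply le_antisymm <;> rw [adjoin_simple_le_iff]
    · exact inv_mem (mem_adjoin_simple_self ℂ x)
    · simpa using inv_mem (mem_adjoin_simple_self ℂ x⁻¹)
  rwa [this]

/-- One of `x` and `x⁻¹` is regular at `P`, and both generate the same subfield. -/
lemma CurvePoint.exists_chart [IsFunctionField F] (P : CurvePoint F) :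
    ∃ w : F, ∃ _ : w ∈ P.ring, Transcendental ℂ w ∧ FiniteDimensional ℂ⟮w⟯ F := by
  obtain ⟨x, hx, hfin⟩ := IsFunctionField.exists_transcendental (F := F)
  rcases P.ring.mem_or_inv_mem x with h | h
  · exact ⟨x, h, hx, hfin⟩
  · exact ⟨x⁻¹, h, transcendental_inv hx, finiteDimensional_inv⟩

lemma CurvePoint.exists_valuation [IsFunctionField F] (P : CurvePoint F) :
    ∃ v : Valuation F ℤᵐ⁰, Function.Surjective v ∧ v.valuationSubring = P.ring := by
  obtain ⟨w, hw, -, hfin⟩ := P.exists_chart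
  exact ⟨(P.spec hw).valuation F, HeightOneSpectrum.valuation_surjective _ _,
    P.valuationSubring_spec hw⟩

/-- The normalised valuation at a point. -/
def CurvePoint.val [IsFunctionField F] (P : CurvePoint F) : Valuation F ℤᵐ⁰ :=
  P.exists_valuation.choose

lemma CurvePoint.val_surjective [IsFunctionField F] (P : CurvePoint F) :
    Function.Surjective P.val := P.exists_valuation.choose_spec.1

lemma CurvePoint.val_le_one [IsFunctionField F] (P : CurvePoint F) {x : F} :
    P.val x ≤ 1 ↔ x ∈ P.ring := by
  rw [← P.exists_valuation.choose_spec.2]; rfl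

/-- The order of a function at a point (with the junk value `0` for the zero function). -/
def CurvePoint.ord [IsFunctionField F] (P : CurvePoint F) (x : F) : ℤ := -log (P.val x)

variable [IsFunctionField F] (P : CurvePoint F)

namespace CurvePoint

lemma ord_mul {x y : F} (hx : x ≠ 0) (hy : y ≠ 0) : P.ord (x * y) = P.ord x + P.ord y := by
  rw [ord, map_mul, log_mul (by simpa using hx) (by simpa using hy), ord, ord]
  ring

@[simp] lemma ord_one : P.ord 1 = 0 := by simp [ord]

lemma ord_inv (x : F) : P.ord x⁻¹ = -P.ord x := by
  simp [ord]

lemma ord_zpow {x : F} (n : ℤ) : P.ord (x ^ n) = n * P.ord x := by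
  simp [ord]

lemma ord_pow {x : F} (n : ℕ) : P.ord (x ^ n) = n * P.ord x := by
  simp [ord]

lemma ord_neg (x : F) : P.ord (-x) = P.ord x := by
  simp [ord, Valuation.map_neg]

lemma mem_ring_iff {x : F} (hx : x ≠ 0) : x ∈ P.ring ↔ 0 ≤ P.ord x := by
  rw [← val_le_one, ord]
  have : P.val x ≠ 0 := by simpa using hx
  rw [Left.nonneg_neg_iff, log_le_iff_le_exp this, exp_zero]

lemma mem_nonunits_iff {x : F} (hx : x ≠ 0) : x ∈ P.ring.nonunits ↔ 0 < P.ord x := by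
  rw [ValuationSubring.mem_nonunits_iff_or]
  have := P.mem_ring_iff (inv_ne_zero hx)
  rw [ord_inv] at this
  rw [this]
  constructor
  · rintro (h | h)
    · exact absurd h hx
    · omega
  · intro h
    right; omega

lemma ord_algebraMap (c : ℂ) : P.ord (algebraMap ℂ F c) = 0 := by
  by_cases hc : c = 0
  · simp [hc, ord]
  have h1 := (P.mem_ring_iff (by simpa using hc)).1 (P.const_mem c)
  have h2 := (P.mem_ring_iff (by simpa using hc)).1 (P.const_mem c⁻¹)
  rw [map_inv₀, ord_inv] at h2
  omega

/-- The ultrametric inequality. The alternatives for zero summands are needed because `ord 0` is `0`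
rather than `∞`. -/
lemma lt_ord_add {x y : F} {n : ℤ} (h : x + y ≠ 0) (hx : x = 0 ∨ n ≤ P.ord x)
    (hy : y = 0 ∨ n ≤ P.ord y) : n ≤ P.ord (x + y) := by
  have key : ∀ {z : F}, z = 0 ∨ n ≤ P.ord z → P.val z ≤ exp (-n) := by
    intro z hz
    rcases eq_or_ne z 0 with rfl | hz0
    · simp
    · rw [← log_le_iff_le_exp (by simpa using hz0)]
      have := hz.resolve_left hz0
      rw [ord] at this
      omega
  have := (P.val.map_add x y).trans (max_le (key hx) (key hy))
  rw [← log_le_iff_le_exp (by simpa using h)] at this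
  rw [ord]
  omega

lemma exists_ord_eq_one : ∃ π : F, π ≠ 0 ∧ P.ord π = 1 := by
  obtain ⟨π, h⟩ := P.val_surjective (exp (-1))
  refine ⟨π, ?_, ?_⟩
  · rintro rfl
    exact exp_ne_zero (by rw [← h, map_zero])
  · rw [ord, h, log_exp]; norm_num

lemma isUniformizer_iff {π : F} : P.IsUniformizer π ↔ π ≠ 0 ∧ P.ord π = 1 := by
  constructor
  · intro h
    obtain ⟨t, ht0, ht⟩ := P.exists_ord_eq_one
    obtain ⟨y, hy, hty⟩ := (h t).1 ((P.mem_nonunits_iff ht0).2 (by omega))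
    have hπ0 : π ≠ 0 := by rintro rfl; simp [hty] at ht0
    have hy0 : y ≠ 0 := by rintro rfl; simp [hty] at ht0
    refine ⟨hπ0, ?_⟩
    have h1 : π ∈ P.ring.nonunits := (h π).2 ⟨1, one_mem _, by simp⟩
    rw [P.mem_nonunits_iff hπ0] at h1
    rw [P.mem_ring_iff hy0] at hy
    rw [hty, P.ord_mul hπ0 hy0] at ht
    omega
  · rintro ⟨hπ0, hπ⟩ x
    rcases eq_or_ne x 0 with rfl | hx
    · simp only [zero_mem, true_iff]
      exact ⟨0, zero_mem _, by simp⟩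
    rw [P.mem_nonunits_iff hx]
    constructor
    · intro h
      refine ⟨π⁻¹ * x, ?_, by field_simp⟩
      rw [P.mem_ring_iff (by simp [hπ0, hx]), P.ord_mul (inv_ne_zero hπ0) hx, ord_inv]
      omega
    · rintro ⟨y, hy, rfl⟩
      have hy0 : y ≠ 0 := by rintro rfl; simp at hx
      rw [P.mem_ring_iff hy0] at hy
      rw [P.ord_mul hπ0 hy0]
      omega

lemma hasOrder_iff {x : F} {n : ℤ} : P.HasOrder x n ↔ x ≠ 0 ∧ P.ord x = n := by
  constructor
  · rintro ⟨π, u, hπ, hu, hu', rfl⟩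
    rw [isUniformizer_iff] at hπ
    have hu0 : u ≠ 0 := by rintro rfl; exact hu' (zero_mem _)
    rw [P.mem_ring_iff hu0] at hu
    rw [P.mem_nonunits_iff hu0] at hu'
    refine ⟨mul_ne_zero hu0 (zpow_ne_zero _ hπ.1), ?_⟩
    rw [P.ord_mul hu0 (zpow_ne_zero _ hπ.1), ord_zpow, hπ.2]
    omega
  · rintro ⟨hx, rfl⟩
    obtain ⟨π, hπ0, hπ⟩ := P.exists_ord_eq_one
    have hu0 : x * π ^ (-P.ord x) ≠ 0 := mul_ne_zero hx (zpow_ne_zero _ hπ0)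
    have hord : P.ord (x * π ^ (-P.ord x)) = 0 := by
      rw [P.ord_mul hx (zpow_ne_zero _ hπ0), ord_zpow, hπ]; ring
    refine ⟨π, x * π ^ (-P.ord x), P.isUniformizer_iff.2 ⟨hπ0, hπ⟩, ?_, ?_, ?_⟩
    · rw [P.mem_ring_iff hu0]; omega
    · rw [P.mem_nonunits_iff hu0]; omega
    · rw [mul_assoc, ← zpow_add₀ hπ0]; simp

lemma mem_riemannRochSpace {D : CurvePoint F →₀ ℤ} {x : F} (hx : x ≠ 0) :
    x ∈ riemannRochSpace D ↔ ∀ P : CurvePoint F, -D P ≤ P.ord x := by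
  change (∀ (P : CurvePoint F) (π : F), P.IsUniformizer π → x * π ^ D P ∈ P.ring) ↔ _
  refine forall_congr' fun P => ?_
  have key : ∀ π : F, P.IsUniformizer π → (x * π ^ D P ∈ P.ring ↔ -D P ≤ P.ord x) := by
    intro π hπ
    rw [isUniformizer_iff] at hπ
    rw [P.mem_ring_iff (mul_ne_zero hx (zpow_ne_zero _ hπ.1)),
      P.ord_mul hx (zpow_ne_zero _ hπ.1), ord_zpow, hπ.2]
    omega
  constructor
  · intro h
    obtain ⟨π, h0, h1⟩ := P.exists_ord_eq_one
    have := P.isUniformizer_iff.2 ⟨h0, h1⟩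
    exact (key π this).1 (h π this)
  · exact fun h π hπ => (key π hπ).2 h

end CurvePoint

end Ord

/-! ### Residues, and the degree of a divisor of zeros -/

section Residue

variable {F : Type} [Field F] [Algebra ℂ F]

instance (w : F) : Algebra.FiniteType ℂ (Algebra.adjoin ℂ {w}) :=
  (Subalgebra.fg_iff_finiteType _).1 ⟨{w}, by simp⟩

/-- Zariski's lemma: the residue field is a finitely generated `ℂ`-algebra, hence finite over `ℂ`,
hence equal to `ℂ`. -/
lemma CurvePoint.exists_sub_mem_center (P : CurvePoint F) {w : F} (hw : w ∈ P.ring)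
    [FiniteDimensional ℂ⟮w⟯ F] (b : Chart w) :
    ∃ c : ℂ, b - algebraMap ℂ (Chart w) c ∈ P.center hw := by
  have hmax : (P.center hw).IsMaximal :=
    Ring.DimensionLEOne.maximalOfPrime (P.center_ne_bot hw) inferInstance
  let := Ideal.Quotient.field (P.center hw)
  have h1 : Algebra.FiniteType ℂ (Chart w) :=
    Algebra.FiniteType.trans (S := Algebra.adjoin ℂ {w}) inferInstance inferInstance
  have h2 : Algebra.FiniteType ℂ (Chart w ⧸ P.center hw) := inferInstance
  have h3 : Module.Finite ℂ (Chart w ⧸ P.center hw) :=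
    finite_of_finite_type_of_isJacobsonRing ℂ (Chart w ⧸ P.center hw)
  have h4 : Algebra.IsIntegral ℂ (Chart w ⧸ P.center hw) := Algebra.IsIntegral.of_finite ℂ _
  obtain ⟨c, hc⟩ := (IsAlgClosed.algebraMap_bijective_of_isIntegral
    (k := ℂ) (K := Chart w ⧸ P.center hw)).2 (Ideal.Quotient.mk _ b)
  refine ⟨c, ?_⟩
  rw [← Ideal.Quotient.eq, ← hc]
  rfl

/-- The residue field of a point is `ℂ`. -/
lemma CurvePoint.exists_residue [IsFunctionField F] (P : CurvePoint F) {u : F} (hu : u ∈ P.ring) :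
    ∃ c : ℂ, u - algebraMap ℂ F c ∈ P.ring.nonunits := by
  obtain ⟨w, hw, -, hfin⟩ := P.exists_chart
  have hu' : (P.spec hw).valuation F u ≤ 1 := by
    rw [← Valuation.mem_valuationSubring_iff, P.valuationSubring_spec hw]; exact hu
  obtain ⟨n, d, h⟩ := HeightOneSpectrum.exists_primeCompl_mul_eq_of_integer _ u hu'
  obtain ⟨a, ha⟩ := P.exists_sub_mem_center hw n
  obtain ⟨b, hb⟩ := P.exists_sub_mem_center hw d
  have hd : (d : Chart w) ∉ P.center hw := d.2
  have hd' : ((d : Chart w) : F) ∉ P.ring.nonunits := by rw [← P.mem_center hw]; exact d.2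
  have hd0 : ((d : Chart w) : F) ≠ 0 := fun h0 => hd' (by rw [h0]; exact zero_mem _)
  rw [P.not_mem_nonunits hd0] at hd'
  have hb0 : b ≠ 0 := by
    rintro rfl
    exact hd (by simpa using hb)
  -- Here `u = n / d` with `d` a unit at `P`, and `a`, `b` are the residues of `n` and `d`.
  refine ⟨a / b, ?_⟩
  have key : u - algebraMap ℂ F (a / b) = ((n - algebraMap ℂ (Chart w) a -
      algebraMap ℂ (Chart w) (a / b) * (d - algebraMap ℂ (Chart w) b) : Chart w) : F) *
        ((d : Chart w) : F)⁻¹ := by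
    rw [eq_mul_inv_iff_mul_eq₀ hd0]
    have h' : u * ((d : Chart w) : F) = (n : F) := h
    have hab : algebraMap ℂ F (a / b) * algebraMap ℂ F b = algebraMap ℂ F a := by
      rw [← map_mul]; congr 1; field_simp
    change (u - algebraMap ℂ F (a / b)) * ((d : Chart w) : F) = (n : F) - algebraMap ℂ F a -
      algebraMap ℂ F (a / b) * (((d : Chart w) : F) - algebraMap ℂ F b)
    linear_combination h' - hab
  rw [key]
  have h1 := sub_mem ha (Ideal.mul_mem_left _ (algebraMap ℂ (Chart w) (a / b)) hb)
  rw [P.mem_center hw] at h1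
  rw [ValuationSubring.mem_nonunits_iff] at h1 ⊢
  rw [map_mul]
  exact mul_lt_one_of_lt_of_le h1 ((ValuationSubring.valuation_le_one_iff _ _).2 hd')

lemma CurvePoint.exists_residue_ord [IsFunctionField F] (P : CurvePoint F) {u : F}
    (hu : 0 ≤ P.ord u) : ∃ c : ℂ, u - algebraMap ℂ F c = 0 ∨ 0 < P.ord (u - algebraMap ℂ F c) := by
  rcases eq_or_ne u 0 with rfl | hu0
  · exact ⟨0, by simp⟩
  obtain ⟨c, hc⟩ := P.exists_residue ((P.mem_ring_iff hu0).2 hu)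
  refine ⟨c, (em _).imp_right fun h => (P.mem_nonunits_iff h).1 hc⟩

/-- A surjective valuation is determined by its ring: units go to `1`, and surjectivity fixes the
value of a uniformizer. So the chosen `P.val` may be compared with the valuation of a chart or with
one transported by an automorphism. -/
lemma CurvePoint.eq_val [IsFunctionField F] (P : CurvePoint F) {v : Valuation F ℤᵐ⁰}
    (hv : Function.Surjective v) (h : v.valuationSubring = P.ring) (x : F) : v x = P.val x := by
  have hunit : ∀ u : F, u ≠ 0 → P.ord u = 0 → v u = 1 := by
    intro u hu h0
    have h1 : v u ≤ 1 := by
      rw [← Valuation.mem_valuationSubring_iff, h, P.mem_ring_iff hu, h0]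
    have h2 : v u⁻¹ ≤ 1 := by
      rw [← Valuation.mem_valuationSubring_iff, h, P.mem_ring_iff (inv_ne_zero hu), P.ord_inv, h0,
        neg_zero]
    rw [map_inv₀] at h2
    have h3 : v u ≠ 0 := by simpa using hu
    exact le_antisymm h1 ((inv_le_one₀ (zero_lt_iff.2 h3)).1 h2)
  obtain ⟨π, hπ0, hπ⟩ := P.exists_ord_eq_one
  have key : ∀ y : F, y ≠ 0 → v y = v π ^ P.ord y := by
    intro y hy
    have h0 : y * π ^ (-P.ord y) ≠ 0 := mul_ne_zero hy (zpow_ne_zero _ hπ0)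
    have h1 := hunit _ h0 (by rw [P.ord_mul hy (zpow_ne_zero _ hπ0), P.ord_zpow, hπ]; ring)
    rw [map_mul, map_zpow₀, zpow_neg, mul_inv_eq_one₀] at h1
    · exact h1
    · exact zpow_ne_zero _ (by simpa using hπ0)
  have hvπ0 : v π ≠ 0 := by simpa using hπ0
  have hvπ : v π = exp (-1) := by
    obtain ⟨t, ht⟩ := hv (exp (-1))
    have ht0 : t ≠ 0 := by rintro rfl; exact exp_ne_zero (by rw [← ht, map_zero])
    have h1 := key t ht0
    rw [ht] at h1
    have h2 := congrArg log h1
    rw [log_exp, log_zpow, smul_eq_mul] at h2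
    have h3 : log (v π) ≤ 0 := by
      rw [log_le_iff_le_exp hvπ0, exp_zero, ← Valuation.mem_valuationSubring_iff, h,
        P.mem_ring_iff hπ0, hπ]
      norm_num
    -- By surjectivity `log (v π)` divides `1`; its sign is known from `h3`.
    have h4 : log (v π) = -1 := by
      rcases Int.isUnit_iff.1 (IsUnit.of_mul_eq_one (-P.ord t) (a := log (v π))
        (by linarith)) with h5 | h5 <;> omega
    rw [← h4, exp_log hvπ0]
  rcases eq_or_ne x 0 with rfl | hx
  · simp
  rw [key x hx, hvπ, ← exp_zsmul, CurvePoint.ord, smul_eq_mul, neg_mul_neg, mul_one, exp_log]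
  simpa using hx

/-- The divisor of zeros of a transcendental function `y` is finite, of degree at most the degree of
the extension `F / ℂ(y)`. -/
lemma exists_zeroDivisor [IsFunctionField F] {y : F} (hy : Transcendental ℂ y)
    [FiniteDimensional ℂ⟮y⟯ F] : ∃ Z : CurvePoint F →₀ ℤ, (∀ P, Z P = max 0 (P.ord y)) ∧
      (Z.sum fun _ k => k) ≤ Module.finrank ℂ⟮y⟯ F := by
  classical
  have hy0 : y ≠ 0 := by rintro rfl; exact hy isAlgebraic_zero
  let A := Algebra.adjoin ℂ {y}
  let Y : A := ⟨y, Algebra.self_mem_adjoin_singleton ℂ y⟩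
  have hY0 : Y ≠ 0 := fun h => hy0 (congrArg Subtype.val h)
  let p : Ideal A := Ideal.span {Y}
  by_cases hex : ∃ P : CurvePoint F, 0 < P.ord y
  swap
  -- Without zeros the divisor is `0`. From here on a zero exists, which is what shows that `p` is a
  -- proper ideal.
  · refine ⟨0, fun P => ?_, by simp⟩
    have := not_exists.1 hex P
    simp only [Finsupp.coe_zero, Pi.zero_apply]
    omega
  have hwP : ∀ {P : CurvePoint F}, 0 < P.ord y → y ∈ P.ring := fun {P} h =>
    (P.mem_ring_iff hy0).2 h.le
  have hmem : ∀ {P : CurvePoint F} (h : 0 < P.ord y),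
      p ≤ (P.center (hwP h)).comap (algebraMap A (Chart y)) := by
    intro P h
    rw [Ideal.span_le, Set.singleton_subset_iff, SetLike.mem_coe, Ideal.mem_comap, P.mem_center]
    exact (P.mem_nonunits_iff hy0).2 h
  have hp0 : p ≠ ⊥ := by simpa [p, Ideal.span_singleton_eq_bot] using hY0
  -- A polynomial in `y` is its constant term plus a multiple of `y`; this makes `p` maximal once it
  -- is proper.
  have hdecomp : ∀ a : A, ∃ c : ℂ, ∃ a' : A, a = algebraMap ℂ A c + Y * a' := by
    rintro ⟨a, ha⟩
    induction ha using Algebra.adjoin_induction with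
    | mem x hx =>
      rw [Set.mem_singleton_iff] at hx; subst hx
      exact ⟨0, 1, by simp [Y]⟩
    | algebraMap r => exact ⟨r, 0, by simp; rfl⟩
    | add u v hu hv h1 h2 =>
      obtain ⟨c, a, h1⟩ := h1
      obtain ⟨d, b, h2⟩ := h2
      refine ⟨c + d, a + b, ?_⟩
      have : (⟨u + v, add_mem hu hv⟩ : A) = ⟨u, hu⟩ + ⟨v, hv⟩ := rfl
      rw [this, h1, h2, map_add]; ring
    | mul u v hu hv h1 h2 =>
      obtain ⟨c, a, h1⟩ := h1
      obtain ⟨d, b, h2⟩ := h2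
      refine ⟨c * d, algebraMap ℂ A c * b + algebraMap ℂ A d * a + Y * a * b, ?_⟩
      have : (⟨u * v, mul_mem hu hv⟩ : A) = ⟨u, hu⟩ * ⟨v, hv⟩ := rfl
      rw [this, h1, h2, map_mul]; ring
  have hpmax : p.IsMaximal := by
    rw [Ideal.isMaximal_iff]
    obtain ⟨P, hP⟩ := hex
    refine ⟨fun h1 => (inferInstance : (P.center (hwP hP)).IsPrime).ne_top ?_, ?_⟩
    · rw [Ideal.eq_top_iff_one]
      simpa using hmem hP h1
    · intro J a hpJ hap haJ
      obtain ⟨c, a', rfl⟩ := hdecomp a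
      have h1 : Y * a' ∈ p := Ideal.mul_mem_right _ _ (Ideal.mem_span_singleton_self Y)
      have hc : c ≠ 0 := by
        rintro rfl
        exact hap (by simpa using h1)
      have h2 : algebraMap ℂ A c ∈ J := by
        have := sub_mem haJ (hpJ h1)
        simpa using this
      have h3 := Ideal.mul_mem_left J (algebraMap ℂ A c⁻¹) h2
      rwa [← map_mul, inv_mul_cancel₀ hc, map_one] at h3
  let ctr : CurvePoint F → Ideal (Chart y) := fun P =>
    if h : 0 < P.ord y then P.center (hwP h) else ⊥
  have hctr : ∀ {P : CurvePoint F} (h : 0 < P.ord y), ctr P = P.center (hwP h) := fun h => dif_pos h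
  have hinj : Set.InjOn ctr {P | 0 < P.ord y} := by
    intro P hP Q hQ hPQ
    rw [hctr hP, hctr hQ] at hPQ
    apply CurvePoint.ext_ring
    rw [← P.valuationSubring_spec (hwP hP), ← Q.valuationSubring_spec (hwP hQ)]
    have : P.spec (hwP hP) = Q.spec (hwP hQ) := HeightOneSpectrum.ext hPQ
    rw [this]
  have hover : ∀ {P : CurvePoint F}, 0 < P.ord y →
      ctr P ∈ IsDedekindDomain.primesOverFinset p (Chart y) := by
    intro P h
    rw [hctr h, IsDedekindDomain.mem_primesOverFinset_iff hp0]
    exact ⟨inferInstance, ⟨hpmax.eq_of_le (Ideal.comap_ne_top _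
      (inferInstance : (P.center (hwP h)).IsPrime).ne_top) (hmem h)⟩⟩
  -- Both sides are the multiplicity of the centre of `P` in the ideal of the chart generated by
  -- `y`.
  have hram : ∀ {P : CurvePoint F}, 0 < P.ord y →
      P.ord y = Ideal.ramificationIdx' p (ctr P) := by
    intro P h
    have hmap : p.map (algebraMap A (Chart y)) = Ideal.span {algebraMap A (Chart y) Y} := by
      rw [Ideal.map_span, Set.image_singleton]
    have hY0' : algebraMap A (Chart y) Y ≠ 0 := by
      intro h0
      exact hy0 (congrArg Subtype.val h0)
    rw [hctr h, Ideal.IsDedekindDomain.ramificationIdx'_eq_multiplicity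
      (by rw [hmap]; exact mt Ideal.span_singleton_eq_bot.1 hY0') inferInstance, hmap]
    have h1 := P.eq_val (HeightOneSpectrum.valuation_surjective F (P.spec (hwP h)))
      (P.valuationSubring_spec (hwP h)) y
    have h2 := HeightOneSpectrum.valuation_of_algebraMap (K := F) (P.spec (hwP h))
      (algebraMap A (Chart y) Y)
    rw [HeightOneSpectrum.intValuation_eq_exp_neg_multiplicity _ hY0'] at h2
    rw [CurvePoint.ord, ← h1]
    replace h2 : (P.spec (hwP h)).valuation F y = _ := h2
    rw [h2, log_exp, neg_neg]
    rfl
  have hfin : {P : CurvePoint F | 0 < P.ord y}.Finite := by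
    refine Set.Finite.of_finite_image (f := ctr) ?_ hinj
    refine (IsDedekindDomain.primesOverFinset p (Chart y)).finite_toSet.subset ?_
    rintro _ ⟨P, hP, rfl⟩
    exact hover hP
  let Z : CurvePoint F →₀ ℤ := Finsupp.onFinset hfin.toFinset (fun P => max 0 (P.ord y)) (by
    intro P hP
    rw [Set.Finite.mem_toFinset, Set.mem_ofPred_eq]
    by_contra h
    exact hP (max_eq_left (by omega)))
  refine ⟨Z, fun P => rfl, ?_⟩
  have hsum : (Z.sum fun _ k => k) = ∑ P ∈ hfin.toFinset, P.ord y := by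
    rw [Finsupp.onFinset_sum _ (by simp)]
    refine Finset.sum_congr rfl fun P hP => ?_
    rw [Set.Finite.mem_toFinset, Set.mem_ofPred_eq] at hP
    exact max_eq_right hP.le
  -- The degree of the extension becomes the sum of `e f` over the primes above `(y)`. The bound
  -- follows from `f ≥ 1` and from discarding primes that are not known to be centres.
  rw [hsum, ← Ideal.sum_ramification_inertia (Chart y) ℂ⟮y⟯ F hp0]
  push_cast
  calc ∑ P ∈ hfin.toFinset, P.ord y
      = ∑ P ∈ hfin.toFinset, (Ideal.ramificationIdx' p (ctr P) : ℤ) := by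
        refine Finset.sum_congr rfl fun P hP => ?_
        rw [Set.Finite.mem_toFinset, Set.mem_ofPred_eq] at hP
        exact hram hP
    _ = ∑ I ∈ hfin.toFinset.image ctr, (Ideal.ramificationIdx' p I : ℤ) := by
        rw [Finset.sum_image]
        intro P hP Q hQ
        exact hinj (by simpa using hP) (by simpa using hQ)
    _ ≤ ∑ I ∈ hfin.toFinset.image ctr,
          (Ideal.ramificationIdx' p I * Ideal.inertiaDeg' p I : ℤ) := by
        refine Finset.sum_le_sum fun I hI => ?_
        obtain ⟨P, hP, rfl⟩ := Finset.mem_image.1 hI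
        rw [Set.Finite.mem_toFinset, Set.mem_ofPred_eq] at hP
        have h1 := (IsDedekindDomain.mem_primesOverFinset_iff hp0 _).1 (hover hP)
        have := h1.2
        have h2 : 0 < Ideal.inertiaDeg' p (ctr P) := Ideal.inertiaDeg'_pos p (ctr P)
        have h3 : (1 : ℤ) ≤ Ideal.inertiaDeg' p (ctr P) := by exact_mod_cast h2
        exact le_mul_of_one_le_right (by positivity) h3
    _ ≤ _ := by
        refine Finset.sum_le_sum_of_subset_of_nonneg ?_ fun I _ _ => by positivity
        intro I hI
        obtain ⟨P, hP, rfl⟩ := Finset.mem_image.1 hI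
        rw [Set.Finite.mem_toFinset, Set.mem_ofPred_eq] at hP
        exact hover hP

end Residue

/-! ### Riemann-Roch spaces and Riemann's inequality -/

section Genus

variable {F : Type} [Field F] [Algebra ℂ F]

/-- The degree of a divisor. -/
def degree (D : CurvePoint F →₀ ℤ) : ℤ := D.sum fun _ k => k

@[simp] lemma degree_zero : degree (0 : CurvePoint F →₀ ℤ) = 0 := by simp [degree]

lemma degree_add (D E : CurvePoint F →₀ ℤ) : degree (D + E) = degree D + degree E :=
  Finsupp.sum_add_index' (by simp) (by simp)

@[simp] lemma degree_single (P : CurvePoint F) (k : ℤ) : degree (Finsupp.single P k) = k := by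
  simp [degree]

lemma degree_smul (n : ℤ) (D : CurvePoint F →₀ ℤ) : degree (n • D) = n * degree D := by
  rw [degree, Finsupp.sum_smul_index' (by simp), degree, Finsupp.sum, Finsupp.sum, Finset.mul_sum]
  simp

lemma degree_neg (D : CurvePoint F →₀ ℤ) : degree (-D) = -degree D := by
  have := degree_smul (-1) D
  simpa using this

/-- Functions without poles are constant. -/
lemma exists_eq_algebraMap {x : F} (h : ∀ P : CurvePoint F, x ∈ P.ring) :
    ∃ c : ℂ, x = algebraMap ℂ F c := by
  -- The intersection of all valuation rings over `ℂ` is the integral closure of `ℂ` in `F`. The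
  -- trivial ring `⊤` takes part in it without being a point.
  have h1 : x ∈ (⨅ V : {V : ValuationSubring F // Set.range (algebraMap ℂ F) ⊆ V.toSubring},
      V.1.toSubring) := by
    rw [Subring.mem_iInf]
    rintro ⟨V, hV⟩
    by_cases hT : V = ⊤
    · subst hT
      exact ValuationSubring.mem_top x
    · exact h ⟨V, fun c => hV ⟨c, rfl⟩, hT⟩
  rw [iInf_valuationSubring_superset] at h1
  have h2 : IsIntegral (Subring.closure (Set.range (algebraMap ℂ F))) x := h1
  have h3 : Subring.closure (Set.range (algebraMap ℂ F)) = (algebraMap ℂ F).range := by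
    rw [← RingHom.coe_range, Subring.closure_eq]
  rw [h3] at h2
  have h4 : IsIntegral ℂ x := by
    obtain ⟨p, hp, hp0⟩ := h2
    obtain ⟨q, hq, hqm⟩ := Polynomial.lifts_and_degree_eq_and_monic
      (f := (algebraMap ℂ F).rangeRestrict) (p := p) (Polynomial.mem_lifts _ |>.2 <|
        Polynomial.map_surjective _ (algebraMap ℂ F).rangeRestrict_surjective p) hp
    refine ⟨q, hqm.2, ?_⟩
    rw [← hq, Polynomial.eval₂_map] at hp0
    exact hp0
  obtain ⟨c, hc⟩ := minpoly.mem_range_of_degree_eq_one ℂ x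
    (IsAlgClosed.degree_eq_one_of_irreducible ℂ (minpoly.irreducible h4))
  exact ⟨c, hc.symm⟩

lemma exists_pole {x : F} (hx : Transcendental ℂ x) : ∃ P : CurvePoint F, x ∉ P.ring := by
  by_contra! h
  obtain ⟨c, rfl⟩ := exists_eq_algebraMap h
  exact hx (isAlgebraic_algebraMap c)

lemma mapRange_toNat_cast {D : CurvePoint F →₀ ℤ} (h : 0 ≤ D) :
    (D.mapRange Int.toNat rfl).mapRange (Nat.cast : ℕ → ℤ) Nat.cast_zero = D := by
  ext P
  have := h P
  simpa using this

lemma adjoin_sub_algebraMap (x : F) (c : ℂ) : ℂ⟮x - algebraMap ℂ F c⟯ = ℂ⟮x⟯ := by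
  apply le_antisymm <;> rw [adjoin_simple_le_iff]
  · exact sub_mem (mem_adjoin_simple_self ℂ x) (IntermediateField.algebraMap_mem _ c)
  · have := add_mem (mem_adjoin_simple_self ℂ (x - algebraMap ℂ F c)) (IntermediateField.algebraMap_mem _ c)
    simpa using this

lemma adjoin_inv (x : F) : ℂ⟮x⁻¹⟯ = ℂ⟮x⟯ := by
  apply le_antisymm <;> rw [adjoin_simple_le_iff]
  · exact inv_mem (mem_adjoin_simple_self ℂ x)
  · simpa using inv_mem (mem_adjoin_simple_self ℂ x⁻¹)

lemma transcendental_sub {x : F} (hx : Transcendental ℂ x) (c : ℂ) :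
    Transcendental ℂ (x - algebraMap ℂ F c) := by
  intro h
  have := h.add (isAlgebraic_algebraMap c)
  rw [sub_add_cancel] at this
  exact hx this

variable [IsFunctionField F]

lemma riemannRochSpace_mono {D E : CurvePoint F →₀ ℤ} (h : D ≤ E) :
    riemannRochSpace D ≤ riemannRochSpace E := by
  intro x hx
  rcases eq_or_ne x 0 with rfl | hx0
  · exact zero_mem _
  rw [CurvePoint.mem_riemannRochSpace hx0] at hx ⊢
  intro P
  have := hx P
  have := h P
  omega

lemma riemannRochSpace_zero :
    riemannRochSpace (0 : CurvePoint F →₀ ℤ) = Submodule.span ℂ {1} := by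
  ext x
  rw [Submodule.mem_span_singleton]
  constructor
  · intro hx
    rcases eq_or_ne x 0 with rfl | hx0
    · exact ⟨0, by simp⟩
    rw [CurvePoint.mem_riemannRochSpace hx0] at hx
    obtain ⟨c, hc⟩ := exists_eq_algebraMap (x := x) fun P => by
      rw [P.mem_ring_iff hx0]; simpa using hx P
    exact ⟨c, by rw [hc, Algebra.algebraMap_eq_smul_one]⟩
  · rintro ⟨c, rfl⟩
    rw [← Algebra.algebraMap_eq_smul_one]
    rcases eq_or_ne c 0 with rfl | hc
    · rw [map_zero]; exact zero_mem _
    rw [CurvePoint.mem_riemannRochSpace (by simpa using hc)]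
    intro P
    simp [P.ord_algebraMap]

lemma finrank_riemannRochSpace_zero :
    Module.finrank ℂ (riemannRochSpace (0 : CurvePoint F →₀ ℤ)) = 1 := by
  rw [riemannRochSpace_zero, finrank_span_singleton one_ne_zero]

/-- Allowing one more pole at `P` costs at most one dimension: if `y` is a function that uses the
new pole, then `x / y` is regular at `P`, and subtracting its residue times `y` from `x` removes the
pole. -/
lemma riemannRochSpace_add_single_le (D : CurvePoint F →₀ ℤ) (P : CurvePoint F) :
    ∃ y : F, riemannRochSpace (D + Finsupp.single P 1) ≤
      riemannRochSpace D ⊔ Submodule.span ℂ {y} := by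
  classical
  by_cases h : riemannRochSpace (D + Finsupp.single P 1) ≤ riemannRochSpace D
  · exact ⟨0, h.trans le_sup_left⟩
  obtain ⟨y, hy, hyD⟩ := SetLike.not_le_iff_exists.1 h
  refine ⟨y, fun x hx => ?_⟩
  have hy0 : y ≠ 0 := by rintro rfl; exact hyD (zero_mem _)
  rcases eq_or_ne x 0 with rfl | hx0
  · exact zero_mem _
  have hy' := (CurvePoint.mem_riemannRochSpace hy0).1 hy
  have hx' := (CurvePoint.mem_riemannRochSpace hx0).1 hx
  have hne : ∀ Q, Q ≠ P → (D + Finsupp.single P (1 : ℤ)) Q = D Q := fun Q hQ => by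
    simp [hQ.symm]
  have heq : (D + Finsupp.single P (1 : ℤ)) P = D P + 1 := by simp
  have hyP : P.ord y = -(D P + 1) := by
    rw [CurvePoint.mem_riemannRochSpace hy0, not_forall] at hyD
    obtain ⟨Q, hQ⟩ := hyD
    have h1 := hy' Q
    rcases eq_or_ne Q P with rfl | hQP
    · omega
    · rw [hne Q hQP] at h1; omega
  have hxP := hx' P
  have hord : P.ord (x * y⁻¹) = P.ord x - P.ord y := by
    rw [P.ord_mul hx0 (inv_ne_zero hy0), P.ord_inv]; ring
  obtain ⟨c, hc⟩ := P.exists_residue_ord (u := x * y⁻¹) (by omega)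
  have hdec : x = (x - c • y) + c • y := by ring
  rw [hdec]
  refine Submodule.add_mem_sup ?_ (Submodule.smul_mem _ _ (Submodule.mem_span_singleton_self y))
  rcases eq_or_ne (x - c • y) 0 with h0 | h0
  · rw [h0]; exact zero_mem _
  have hprod : x - c • y = (x * y⁻¹ - algebraMap ℂ F c) * y := by
    rw [Algebra.smul_def]; field_simp
  rw [CurvePoint.mem_riemannRochSpace h0]
  intro Q
  rcases eq_or_ne Q P with rfl | hQP
  · have hc0 : x * y⁻¹ - algebraMap ℂ F c ≠ 0 := fun h1 => h0 (by rw [hprod, h1, zero_mul])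
    rw [hprod, Q.ord_mul hc0 hy0]
    have := hc.resolve_left hc0
    omega
  · have h1 : x - c • y ∈ riemannRochSpace (D + Finsupp.single P 1) :=
      sub_mem hx (Submodule.smul_mem _ _ hy)
    rw [CurvePoint.mem_riemannRochSpace h0] at h1
    rw [← hne Q hQP]
    exact h1 Q

/-- Effective divisors are written with coefficients in `ℕ` so that they can be built up one point
at a time. -/
lemma finite_riemannRochSpace_add (E : CurvePoint F →₀ ℕ) (D : CurvePoint F →₀ ℤ)
    [Module.Finite ℂ (riemannRochSpace D)] :
    Module.Finite ℂ (riemannRochSpace (D + E.mapRange (↑) Nat.cast_zero)) ∧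
      (Module.finrank ℂ (riemannRochSpace (D + E.mapRange (↑) Nat.cast_zero)) : ℤ) ≤
        Module.finrank ℂ (riemannRochSpace D) + degree (E.mapRange (↑) Nat.cast_zero) := by
  rename_i hD
  induction E using Finsupp.induction_linear generalizing D with
  | zero =>
    rw [Finsupp.mapRange_zero, add_zero]
    exact ⟨hD, by simp⟩
  | add E₁ E₂ h₁ h₂ =>
    have hadd : (E₁ + E₂).mapRange (Nat.cast : ℕ → ℤ) Nat.cast_zero =
        E₁.mapRange (↑) Nat.cast_zero + E₂.mapRange (↑) Nat.cast_zero :=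
      Finsupp.mapRange_add (by simp) _ _
    rw [hadd, ← add_assoc, degree_add]
    obtain ⟨h3, h4⟩ := h₁ D
    obtain ⟨h5, h6⟩ := h₂ (D + E₁.mapRange (↑) Nat.cast_zero)
    exact ⟨h5, by omega⟩
  | single P n =>
    rw [Finsupp.mapRange_single]
    induction n with
    | zero =>
      rw [Nat.cast_zero, Finsupp.single_zero, add_zero]
      exact ⟨hD, by simp⟩
    | succ n ih =>
      obtain ⟨h3, h4⟩ := ih
      have hs : D + Finsupp.single P ((n + 1 : ℕ) : ℤ) =
          D + Finsupp.single P (n : ℤ) + Finsupp.single P 1 := by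
        rw [add_assoc, ← Finsupp.single_add]; simp
      obtain ⟨y, hy⟩ := riemannRochSpace_add_single_le (D + Finsupp.single P (n : ℤ)) P
      rw [← hs] at hy
      have hf : Module.Finite ℂ
          (riemannRochSpace (D + Finsupp.single P ((n + 1 : ℕ) : ℤ))) :=
        Submodule.finiteDimensional_of_le hy
      refine ⟨hf, ?_⟩
      have h5 := (Submodule.finrank_mono hy).trans (Submodule.finrank_add_le_finrank_add_finrank _ _)
      have h6 : Module.finrank ℂ (Submodule.span ℂ {y}) ≤ 1 := by
        simpa using finrank_span_le_card (R := ℂ) {y}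
      rw [degree_single] at h4 ⊢
      rw [Nat.cast_succ n]
      rw [Nat.cast_succ n] at h5
      omega

instance finite_riemannRochSpace (D : CurvePoint F →₀ ℤ) :
    Module.Finite ℂ (riemannRochSpace D) := by
  have h0 : Module.Finite ℂ (riemannRochSpace (0 : CurvePoint F →₀ ℤ)) := by
    rw [riemannRochSpace_zero]; infer_instance
  have h := (finite_riemannRochSpace_add ((D ⊔ 0).mapRange Int.toNat rfl) 0).1
  rw [mapRange_toNat_cast le_sup_right, zero_add] at h
  exact Submodule.finiteDimensional_of_le (riemannRochSpace_mono (le_sup_left : D ≤ D ⊔ 0))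

/-- `deg D - dim L(D) + 1`. -/
def defect (D : CurvePoint F →₀ ℤ) : ℤ :=
  degree D - (Module.finrank ℂ (riemannRochSpace D) : ℤ) + 1

/-- Each added point raises the degree by one and the dimension by at most one. -/
lemma defect_mono {D E : CurvePoint F →₀ ℤ} (h : D ≤ E) : defect D ≤ defect E := by
  have h0 : 0 ≤ E - D := fun P => by simpa using h P
  have h1 := (finite_riemannRochSpace_add ((E - D).mapRange Int.toNat rfl) D).2
  rw [mapRange_toNat_cast h0, add_sub_cancel] at h1
  have h2 := degree_add D (E - D)
  rw [add_sub_cancel] at h2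
  unfold defect
  omega

/-- Multiplication by `h` embeds one space into the other. -/
lemma finrank_riemannRochSpace_le {D E : CurvePoint F →₀ ℤ} {h : F} (h0 : h ≠ 0)
    (hE : ∀ P : CurvePoint F, D P - E P ≤ P.ord h) :
    Module.finrank ℂ (riemannRochSpace D) ≤ Module.finrank ℂ (riemannRochSpace E) := by
  let φ : riemannRochSpace D →ₗ[ℂ] riemannRochSpace E :=
    (LinearMap.mulLeft ℂ h).restrict (by
      intro x hx
      rcases eq_or_ne x 0 with rfl | hx0
      · rw [map_zero]; exact zero_mem _
      rw [CurvePoint.mem_riemannRochSpace hx0] at hx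
      rw [LinearMap.mulLeft_apply, CurvePoint.mem_riemannRochSpace (mul_ne_zero h0 hx0)]
      intro P
      rw [P.ord_mul h0 hx0]
      have := hx P
      have := hE P
      omega)
  refine LinearMap.finrank_le_finrank_of_injective (f := φ) fun x y hxy => ?_
  have := congrArg Subtype.val hxy
  exact Subtype.ext (mul_left_cancel₀ h0 this)

lemma CurvePoint.ord_sub_algebraMap {x : F} (P : CurvePoint F) (c : ℂ)
    (h : P.ord x < 0) (hx : x - algebraMap ℂ F c ≠ 0) : P.ord (x - algebraMap ℂ F c) = P.ord x := by
  have hx0 : x ≠ 0 := by rintro rfl; simp [ord] at h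
  have hc : P.ord (-algebraMap ℂ F c) = 0 := by rw [P.ord_neg, P.ord_algebraMap]
  apply le_antisymm
  · by_contra! h1
    have h2 := P.lt_ord_add (x := x - algebraMap ℂ F c) (y := algebraMap ℂ F c)
      (n := P.ord x + 1) (by simpa using hx0) (Or.inr (by omega))
      (Or.inr (by rw [P.ord_algebraMap]; omega))
    rw [sub_add_cancel] at h2
    omega
  · rw [sub_eq_add_neg] at hx ⊢
    exact P.lt_ord_add hx (Or.inr le_rfl) (Or.inr (by omega))

/-- Every divisor is bounded by a divisor linearly equivalent to a multiple of the polar divisor of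
`x`. -/
lemma exists_le_divisor {x : F} (hx : Transcendental ℂ x) [FiniteDimensional ℂ⟮x⟯ F]
    {B : CurvePoint F →₀ ℤ} (hB : ∀ P, B P = max 0 (-P.ord x))
    (hBdeg : degree B ≤ Module.finrank ℂ⟮x⟯ F) (D : CurvePoint F →₀ ℤ) :
    ∃ (E : CurvePoint F →₀ ℤ) (M : ℕ) (h : F), D ≤ E ∧ h ≠ 0 ∧
      (∀ P : CurvePoint F, P.ord h = M * B P - E P) ∧
        degree E ≤ Module.finrank ℂ⟮x⟯ F * M := by
  have hx0 : x ≠ 0 := by rintro rfl; exact hx isAlgebraic_zero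
  -- Every point lies on an effective divisor `Z` equivalent to `B`: the zeros of `x - c` if `x`
  -- takes the value `c` at `P`, and `B` itself if `P` is a pole of `x`.
  have hpt : ∀ P : CurvePoint F, ∃ (Z : CurvePoint F →₀ ℤ) (h : F), 0 ≤ Z ∧ 1 ≤ Z P ∧ h ≠ 0 ∧
      (∀ Q : CurvePoint F, Q.ord h = B Q - Z Q) ∧ degree Z ≤ Module.finrank ℂ⟮x⟯ F := by
    intro P
    by_cases hP : 0 ≤ P.ord x
    · obtain ⟨c, hc⟩ := P.exists_residue_ord hP
      have hxc := transcendental_sub hx c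
      have hxc0 : x - algebraMap ℂ F c ≠ 0 := fun h0 => hxc (by rw [h0]; exact isAlgebraic_zero)
      have hfin : FiniteDimensional ℂ⟮x - algebraMap ℂ F c⟯ F := by
        rw [adjoin_sub_algebraMap]; infer_instance
      obtain ⟨Z, hZ, hZdeg⟩ := exists_zeroDivisor hxc
      have := hc.resolve_left hxc0
      refine ⟨Z, (x - algebraMap ℂ F c)⁻¹, fun Q => ?_, ?_, inv_ne_zero hxc0, fun Q => ?_, ?_⟩
      · rw [hZ]; exact le_max_left _ _
      · rw [hZ]; omega
      · rw [Q.ord_inv, hZ, hB]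
        rcases lt_or_ge (Q.ord x) 0 with h1 | h1
        · rw [Q.ord_sub_algebraMap c h1 hxc0]; omega
        · have h2 : 0 ≤ Q.ord (x - algebraMap ℂ F c) := by
            rw [← Q.mem_ring_iff hxc0]
            exact sub_mem ((Q.mem_ring_iff hx0).2 h1) (Q.const_mem c)
          omega
      · rwa [adjoin_sub_algebraMap] at hZdeg
    · refine ⟨B, 1, fun Q => ?_, ?_, one_ne_zero, fun Q => by simp, hBdeg⟩
      · rw [hB]; exact le_max_left _ _
      · rw [hB]; omega
  induction D using Finsupp.induction_linear with
  | zero => exact ⟨0, 0, 1, le_rfl, one_ne_zero, by simp, by simp⟩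
  | add D₁ D₂ h₁ h₂ =>
    obtain ⟨E₁, M₁, f₁, h1, h2, h3, h4⟩ := h₁
    obtain ⟨E₂, M₂, f₂, h1', h2', h3', h4'⟩ := h₂
    refine ⟨E₁ + E₂, M₁ + M₂, f₁ * f₂, add_le_add h1 h1', mul_ne_zero h2 h2', fun P => ?_, ?_⟩
    · rw [P.ord_mul h2 h2', h3, h3', Finsupp.add_apply]; push_cast; ring
    · rw [degree_add]; push_cast; linarith
  | single P k =>
    obtain ⟨Z, f, hZ0, hZP, hf0, hf, hZdeg⟩ := hpt P
    refine ⟨(k.natAbs : ℤ) • Z, k.natAbs, f ^ k.natAbs, fun Q => ?_, pow_ne_zero _ hf0, fun Q => ?_,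
      ?_⟩
    · rw [Finsupp.smul_apply, smul_eq_mul]
      rcases eq_or_ne P Q with rfl | hPQ
      · rw [Finsupp.single_eq_same]
        nlinarith [Int.le_natAbs (a := k)]
      · rw [Finsupp.single_eq_of_ne' hPQ]
        exact mul_nonneg (by positivity) (hZ0 Q)
    · rw [Q.ord_pow, hf, Finsupp.smul_apply, smul_eq_mul]; ring
    · rw [degree_smul, mul_comm]
      exact mul_le_mul_of_nonneg_right hZdeg (by positivity)

/-- Take a basis of `F` over `ℂ(x)` that is integral over `ℂ[x]`. Its elements have poles only at
the poles of `x`, of order at most `m`, so the products of basis elements with `x ^ j`, `j < M - m`,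
lie in `L(M B)`. They are independent over `ℂ`. -/
lemma exists_le_finrank_smul {x : F} (hx : Transcendental ℂ x) [FiniteDimensional ℂ⟮x⟯ F]
    {B : CurvePoint F →₀ ℤ} (hB : ∀ P, B P = max 0 (-P.ord x)) :
    ∃ m : ℕ, ∀ M : ℕ, (Module.finrank ℂ⟮x⟯ F : ℤ) * (M - m) ≤
      Module.finrank ℂ (riemannRochSpace ((M : ℤ) • B)) := by
  have hx0 : x ≠ 0 := by rintro rfl; exact hx isAlgebraic_zero
  obtain ⟨s, b, hb⟩ := FiniteDimensional.exists_is_basis_integral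
    (Algebra.adjoin ℂ {x}) ℂ⟮x⟯ F
  have hb0 : ∀ i, b i ≠ 0 := fun i => b.ne_zero i
  obtain ⟨m, hm⟩ : ∃ m : ℕ, ∀ P ∈ B.support, ∀ i, -P.ord (b i) ≤ m := by
    refine ⟨∑ P ∈ B.support, ∑ i, (P.ord (b i)).natAbs, fun P hP i => ?_⟩
    have h1 : (P.ord (b i)).natAbs ≤ ∑ i, (P.ord (b i)).natAbs :=
      Finset.single_le_sum (f := fun i => (P.ord (b i)).natAbs) (fun _ _ => Nat.zero_le _)
        (Finset.mem_univ i)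
    have h2 := Finset.single_le_sum (f := fun P : CurvePoint F => ∑ i, (P.ord (b i)).natAbs)
      (fun _ _ => Nat.zero_le _) hP
    have h3 := h1.trans h2
    omega
  refine ⟨m, fun M => ?_⟩
  rcases lt_or_ge M m with hlt | hle
  · have h1 : ((M : ℤ) - m) ≤ 0 := by omega
    have h2 : (0 : ℤ) ≤ Module.finrank ℂ⟮x⟯ F := by positivity
    exact (mul_nonpos_of_nonneg_of_nonpos h2 h1).trans (by positivity)
  let g := AdjoinSimple.gen ℂ x
  have hg : LinearIndependent ℂ fun j : Fin (M - m) => g ^ (j : ℕ) := by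
    rw [Fintype.linearIndependent_iff]
    intro c hc j
    have h1 : ∑ j : Fin (M - m), Polynomial.monomial (j : ℕ) (c j) = 0 := by
      apply (transcendental_iff.1 hx)
      have h2 := congrArg (algebraMap ℂ⟮x⟯ F) hc
      rw [map_sum, map_zero] at h2
      rw [map_sum, ← h2]
      refine Finset.sum_congr rfl fun j _ => ?_
      rw [Polynomial.aeval_monomial, Algebra.smul_def, map_mul, map_pow,
        ← IsScalarTower.algebraMap_apply]
      rfl
    have h2 := congrArg (fun p => Polynomial.coeff p (j : ℕ)) h1
    simpa [Polynomial.finsetSum_coeff, Polynomial.coeff_monomial, Fin.val_inj] using h2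
  have hli := linearIndependent_smul hg b.linearIndependent
  let v : Fin (M - m) × s → riemannRochSpace ((M : ℤ) • B) := fun q =>
    ⟨g ^ (q.1 : ℕ) • b q.2, by
      have e : g ^ (q.1 : ℕ) • b q.2 = x ^ (q.1 : ℕ) * b q.2 := by
        rw [Algebra.smul_def, map_pow]; rfl
      rw [e, CurvePoint.mem_riemannRochSpace (mul_ne_zero (pow_ne_zero _ hx0) (hb0 _))]
      intro P
      rw [P.ord_mul (pow_ne_zero _ hx0) (hb0 _), P.ord_pow, Finsupp.smul_apply, smul_eq_mul]
      have hq := q.1.2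
      by_cases hP : P ∈ B.support
      · have h1 := hm P hP q.2
        have h2 := Finsupp.mem_support_iff.1 hP
        have h3 := hB P
        have h4 : B P = -P.ord x := by omega
        have h5 : 1 ≤ B P := by omega
        have h6 : P.ord x = -B P := by omega
        rw [h6]
        have h7 : ((q.1 : ℕ) : ℤ) + m ≤ M := by omega
        nlinarith
      · rw [Finsupp.notMem_support_iff] at hP
        have h3 := hB P
        have h4 : 0 ≤ P.ord x := by omega
        have h5 := P.mem_of_isIntegral ((P.mem_ring_iff hx0).2 h4) (hb q.2)
        rw [P.mem_ring_iff (hb0 _)] at h5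
        rw [hP]
        have : 0 ≤ ((q.1 : ℕ) : ℤ) * P.ord x := mul_nonneg (by positivity) h4
        omega⟩
  have hv : LinearIndependent ℂ v :=
    LinearIndependent.of_comp (riemannRochSpace ((M : ℤ) • B)).subtype hli
  have h1 := hv.fintype_card_le_finrank
  rw [Fintype.card_prod, Fintype.card_fin, ← Module.finrank_eq_card_basis b] at h1
  have h2 : ((M - m : ℕ) : ℤ) = M - m := by omega
  rw [← h2, mul_comm]
  exact_mod_cast h1

/-- Riemann's inequality. -/
lemma exists_defect_le : ∃ C : ℤ, ∀ D : CurvePoint F →₀ ℤ, defect D ≤ C := by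
  obtain ⟨x, hx, hfin⟩ := IsFunctionField.exists_transcendental (F := F)
  have hfin' : FiniteDimensional ℂ⟮x⁻¹⟯ F := by rw [adjoin_inv]; exact hfin
  obtain ⟨B, hB, hBdeg⟩ := exists_zeroDivisor (transcendental_inv hx)
  replace hB : ∀ P, B P = max 0 (-P.ord x) := fun P => by rw [hB, P.ord_inv]
  rw [adjoin_inv] at hBdeg
  obtain ⟨m, hm⟩ := exists_le_finrank_smul hx hB
  -- With `n` the degree of the extension, `deg E ≤ n M` and `dim L(E) ≥ dim L(M B) ≥ n (M - m)`, so
  -- the defect is at most `n m + 1`.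
  refine ⟨Module.finrank ℂ⟮x⟯ F * m + 1, fun D => ?_⟩
  obtain ⟨E, M, h, hDE, h0, hE, hEdeg⟩ := exists_le_divisor hx hB hBdeg D
  refine (defect_mono hDE).trans ?_
  have h1 := hm M
  have h2 : Module.finrank ℂ (riemannRochSpace ((M : ℤ) • B)) ≤
      Module.finrank ℂ (riemannRochSpace E) := finrank_riemannRochSpace_le h0 fun P => by
    rw [hE, Finsupp.smul_apply, smul_eq_mul]
  have h3 : (Module.finrank ℂ (riemannRochSpace ((M : ℤ) • B)) : ℤ) ≤
      Module.finrank ℂ (riemannRochSpace E) := by exact_mod_cast h2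
  unfold defect
  rw [mul_sub] at h1
  linarith

-- The defects are bounded above and the zero divisor has defect `0`, so a greatest defect exists
-- and is a natural number.
variable (F) in
lemma exists_hasGenus : ∃ g : ℕ, HasGenus F g := by
  obtain ⟨C, hC⟩ := exists_defect_le (F := F)
  obtain ⟨g, ⟨D, hD⟩, hg⟩ := Int.exists_greatest_of_bdd
    (P := fun n => ∃ D : CurvePoint F →₀ ℤ, n = defect D)
    ⟨C, by rintro _ ⟨D, rfl⟩; exact hC D⟩ ⟨_, 0, rfl⟩
  have h0 : 0 ≤ g := by
    refine le_trans ?_ (hg _ ⟨0, rfl⟩)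
    rw [defect, finrank_riemannRochSpace_zero, degree_zero]
    norm_num
  refine ⟨g.toNat, ⟨D, ?_⟩, ?_⟩
  · rw [Int.toNat_of_nonneg h0]; exact hD
  · rintro _ ⟨D', rfl⟩
    rw [Int.toNat_of_nonneg h0]
    exact hg _ ⟨D', rfl⟩

end Genus

/-! ### Quadratic extensions: the covering map and the involution -/

section DoubleCover

set_option linter.unusedSectionVars false

variable {E F : Type} [Field E] [Field F] [Algebra ℂ E] [Algebra ℂ F] [Algebra E F]
  [IsScalarTower ℂ E F]

/-- `F = E ⊕ E l` with `l² = q ∈ E`, and `σ` is the non-trivial automorphism of `F / E`. -/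
structure IsKummer (l : F) (q : E) (σ : F →+* F) : Prop where
  ne_zero : l ≠ 0
  sq : l ^ 2 = algebraMap E F q
  map_base : ∀ a : E, σ (algebraMap E F a) = algebraMap E F a
  map_gen : σ l = -l
  exists_decomp : ∀ x : F, ∃ a b : E, x = algebraMap E F a + algebraMap E F b * l

namespace IsKummer

variable {l : F} {q : E} {σ : F →+* F} (h : IsKummer l q σ)

include h

lemma map_const (c : ℂ) : σ (algebraMap ℂ F c) = algebraMap ℂ F c := by
  rw [IsScalarTower.algebraMap_apply ℂ E F, h.map_base]

lemma map_map (x : F) : σ (σ x) = x := by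
  obtain ⟨a, b, rfl⟩ := h.exists_decomp x
  simp [h.map_base, h.map_gen]

lemma decomp_unique {a b : E} (h0 : algebraMap E F a + algebraMap E F b * l = 0) :
    a = 0 ∧ b = 0 := by
  have h1 := congrArg σ h0
  simp only [map_add, map_mul, h.map_base, h.map_gen, map_zero] at h1
  have : CharZero F := charZero_of_injective_algebraMap (algebraMap ℂ F).injective
  have ha : algebraMap E F a = 0 := by linear_combination (h0 + h1) / 2
  have hb : algebraMap E F b * l = 0 := by rw [ha] at h0; simpa using h0
  refine ⟨by simpa using ha, ?_⟩
  simpa [h.ne_zero] using hb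

lemma exists_norm (x : F) : ∃ n : E, x * σ x = algebraMap E F n := by
  obtain ⟨a, b, rfl⟩ := h.exists_decomp x
  refine ⟨a ^ 2 - b ^ 2 * q, ?_⟩
  simp only [map_add, map_mul, h.map_base, h.map_gen, map_sub, map_pow]
  rw [← h.sq]
  ring

lemma finrank_eq_two : Module.finrank (algebraMap E F).fieldRange F = 2 := by
  have hl : LinearIndependent (algebraMap E F).fieldRange ![1, l] := by
    rw [LinearIndependent.pair_iff]
    rintro ⟨_, a, rfl⟩ ⟨_, b, rfl⟩ hab
    have h1 : algebraMap E F a + algebraMap E F b * l = 0 := by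
      have : algebraMap E F a * 1 + algebraMap E F b * l = 0 := hab
      rwa [mul_one] at this
    obtain ⟨rfl, rfl⟩ := h.decomp_unique h1
    constructor <;> exact Subtype.ext (map_zero _)
  have hs : ⊤ ≤ Submodule.span (algebraMap E F).fieldRange (Set.range ![1, l]) := by
    intro x _
    obtain ⟨a, b, rfl⟩ := h.exists_decomp x
    rw [Matrix.range_cons, Matrix.range_cons, Matrix.range_empty, Set.union_empty,
      Set.singleton_union, Submodule.mem_span_pair]
    refine ⟨⟨_, a, rfl⟩, ⟨_, b, rfl⟩, ?_⟩
    change algebraMap E F a * 1 + algebraMap E F b * l = _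
    rw [mul_one]
  rw [Module.finrank_eq_card_basis (Module.Basis.mk hl hs)]
  simp

/-- The morphism of curves dual to the inclusion `E → F`. -/
def cover (P : CurvePoint F) : CurvePoint E where
  ring := P.ring.comap (algebraMap E F)
  const_mem c := by
    rw [ValuationSubring.mem_comap, ← IsScalarTower.algebraMap_apply]
    exact P.const_mem c
  ne_top := by
    intro htop
    apply P.ne_top
    rw [eq_top_iff]
    intro x _
    have hE : ∀ a : E, algebraMap E F a ∈ P.ring := fun a => by
      rw [← ValuationSubring.mem_comap, htop]; trivial
    -- Since `l = q * l⁻¹`, a ring that contains `E` and `l⁻¹` contains `l` as well.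
    have hl : l ∈ P.ring := by
      rcases P.ring.mem_or_inv_mem l with h1 | h1
      · exact h1
      · have : l = algebraMap E F q * l⁻¹ := by rw [← h.sq]; field_simp [h.ne_zero]
        rw [this]
        exact mul_mem (hE q) h1
    obtain ⟨a, b, rfl⟩ := h.exists_decomp x
    exact add_mem (hE a) (mul_mem (hE b) hl)

/-- The involution of the curve dual to `σ`. -/
def swap (P : CurvePoint F) : CurvePoint F where
  ring := P.ring.comap σ
  const_mem c := by
    rw [ValuationSubring.mem_comap, h.map_const]
    exact P.const_mem c
  ne_top := by
    intro htop
    apply P.ne_top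
    rw [eq_top_iff]
    intro x _
    have : σ x ∈ P.ring.comap σ := by rw [htop]; trivial
    rwa [ValuationSubring.mem_comap, h.map_map] at this

lemma swap_swap (P : CurvePoint F) : h.swap (h.swap P) = P := by
  apply CurvePoint.ext_ring
  ext x
  change σ (σ x) ∈ P.ring ↔ _
  rw [h.map_map]

lemma cover_swap (P : CurvePoint F) : h.cover (h.swap P) = h.cover P := by
  apply CurvePoint.ext_ring
  ext x
  change σ (algebraMap E F x) ∈ P.ring ↔ algebraMap E F x ∈ P.ring
  rw [h.map_base]

/-- Extension of valuations: some valuation ring `A` of `F` dominates the image of `Q.ring`, and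
domination forces `A` to meet `E` exactly in `Q.ring`. -/
lemma cover_surjective : Function.Surjective h.cover := by
  intro Q
  obtain ⟨A, hA, hloc⟩ := IsLocalRing.exists_factor_valuationRing
    ((algebraMap E F).comp Q.ring.subtype)
  have hmem : ∀ {x : E}, x ∈ Q.ring → algebraMap E F x ∈ A := fun {x} hx => hA ⟨x, hx⟩
  -- The homomorphism into `A` is local, so units of `A` coming from `Q.ring` are already units
  -- there.
  have hnon : ∀ {x : E}, x ∈ Q.ring → x ≠ 0 → (algebraMap E F x)⁻¹ ∈ A → x⁻¹ ∈ Q.ring := by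
    intro x hx hx0 hxA
    have hu : IsUnit ((((algebraMap E F).comp Q.ring.subtype).codRestrict A.toSubring hA) ⟨x, hx⟩) :=
      .of_mul_eq_one ⟨_, hxA⟩ (Subtype.ext (mul_inv_cancel₀ (by simpa using hx0)))
    obtain ⟨y, hy⟩ := (isUnit_of_map_unit _ _ hu).exists_right_inv
    have : x * (y : E) = 1 := congrArg Subtype.val hy
    rw [← eq_inv_of_mul_eq_one_right this]
    exact y.2
  have htop : A ≠ ⊤ := by
    rintro rfl
    apply Q.ne_top
    rw [eq_top_iff]
    intro x _
    rcases eq_or_ne x 0 with rfl | hx0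
    · exact zero_mem _
    rcases Q.ring.mem_or_inv_mem x with h1 | h1
    · exact h1
    · have := hnon h1 (inv_ne_zero hx0) trivial
      rwa [inv_inv] at this
  refine ⟨⟨A, fun c => ?_, htop⟩, ?_⟩
  · rw [IsScalarTower.algebraMap_apply ℂ E F]
    exact hmem (Q.const_mem c)
  · apply CurvePoint.ext_ring
    ext x
    change algebraMap E F x ∈ A ↔ _
    refine ⟨fun hx => ?_, hmem⟩
    rcases eq_or_ne x 0 with rfl | hx0
    · exact zero_mem _
    rcases Q.ring.mem_or_inv_mem x with h1 | h1
    · exact h1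
    · have := hnon h1 (inv_ne_zero hx0) (by rwa [map_inv₀, inv_inv])
      rwa [inv_inv] at this

variable [IsFunctionField F]

/-- The valuation at `P` composed with `σ` is still surjective and has the ring of `h.swap P`, so
`eq_val` applies. -/
lemma ord_swap (P : CurvePoint F) (x : F) : (h.swap P).ord x = P.ord (σ x) := by
  have hs : Function.Surjective (P.val.comap σ) := by
    intro y
    obtain ⟨x, hx⟩ := P.val_surjective y
    exact ⟨σ x, by rw [Valuation.comap_apply, h.map_map, hx]⟩
  have := (h.swap P).eq_val hs (by
    ext x
    rw [Valuation.mem_valuationSubring_iff, Valuation.comap_apply, P.val_le_one]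
    rfl) x
  rw [CurvePoint.ord, ← this]
  rfl

variable [IsFunctionField E]

/-- Units below remain units above, so only the order of a local parameter of the base matters. -/
lemma exists_ramification (P : CurvePoint F) : ∃ e : ℤ, 0 < e ∧
    ∀ y : E, y ≠ 0 → P.ord (algebraMap E F y) = e * (h.cover P).ord y := by
  obtain ⟨π, hπ0, hπ⟩ := (h.cover P).exists_ord_eq_one
  have hmem : ∀ {y : E}, y ≠ 0 → (0 ≤ (h.cover P).ord y ↔ 0 ≤ P.ord (algebraMap E F y)) := by
    intro y hy
    rw [← CurvePoint.mem_ring_iff _ hy, ← CurvePoint.mem_ring_iff _ (by simpa using hy)]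
    rfl
  refine ⟨P.ord (algebraMap E F π), ?_, fun y hy => ?_⟩
  · have := hmem (inv_ne_zero hπ0)
    rw [map_inv₀, CurvePoint.ord_inv, CurvePoint.ord_inv, hπ] at this
    omega
  · set n := (h.cover P).ord y
    have hz : y * π ^ (-n) ≠ 0 := mul_ne_zero hy (zpow_ne_zero _ hπ0)
    have hzn : (h.cover P).ord (y * π ^ (-n)) = 0 := by
      rw [CurvePoint.ord_mul _ hy (zpow_ne_zero _ hπ0), CurvePoint.ord_zpow, hπ]
      change n + _ = 0
      ring
    have h1 := (hmem hz).1 (by omega)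
    have h2 := (hmem (inv_ne_zero hz)).1 (by rw [CurvePoint.ord_inv]; omega)
    rw [map_inv₀, CurvePoint.ord_inv] at h2
    have h3 : P.ord (algebraMap E F (y * π ^ (-n))) =
        P.ord (algebraMap E F y) - n * P.ord (algebraMap E F π) := by
      rw [map_mul, map_zpow₀, P.ord_mul (by simpa using hy) (zpow_ne_zero _ (by simpa using hπ0)),
        P.ord_zpow]
      ring
    rw [mul_comm]
    omega

/-- The ramification index of the cover at a point. -/
def ram (P : CurvePoint F) : ℤ := (h.exists_ramification P).choose

lemma ram_pos (P : CurvePoint F) : 0 < h.ram P := (h.exists_ramification P).choose_spec.1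

lemma ord_algebraMap (P : CurvePoint F) {y : E} (hy : y ≠ 0) :
    P.ord (algebraMap E F y) = h.ram P * (h.cover P).ord y :=
  (h.exists_ramification P).choose_spec.2 y hy

lemma hasRamificationIndex {P : CurvePoint F} {e : ℕ} (he : h.ram P = e) :
    HasRamificationIndex h.cover (algebraMap E F) P e := by
  obtain ⟨π, hπ0, hπ⟩ := (h.cover P).exists_ord_eq_one
  refine ⟨π, (CurvePoint.isUniformizer_iff _).2 ⟨hπ0, hπ⟩, (P.hasOrder_iff).2
    ⟨by simpa using hπ0, ?_⟩⟩
  rw [h.ord_algebraMap P hπ0, hπ, he, mul_one]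

end IsKummer

end DoubleCover

/-! ### Residues of the generator, fibres and ramification indices -/

section Ramification

variable {F : Type} [Field F] [Algebra ℂ F]

namespace CurvePoint

lemma mul_mem_nonunits (P : CurvePoint F) {x y : F} (hx : x ∈ P.ring.nonunits) (hy : y ∈ P.ring) :
    x * y ∈ P.ring.nonunits := by
  rw [ValuationSubring.mem_nonunits_iff] at hx ⊢
  rw [map_mul]
  exact mul_lt_one_of_lt_of_le hx ((ValuationSubring.valuation_le_one_iff _ _).2 hy)

lemma algebraMap_mem_nonunits (P : CurvePoint F) {c : ℂ} :
    algebraMap ℂ F c ∈ P.ring.nonunits ↔ c = 0 := by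
  refine ⟨fun hc => ?_, by rintro rfl; rw [map_zero]; exact zero_mem _⟩
  by_contra hc0
  rw [ValuationSubring.mem_nonunits_iff_or] at hc
  rcases hc with h | h
  · exact hc0 (by simpa using h)
  · exact h (by rw [← map_inv₀]; exact P.const_mem _)

variable [IsFunctionField F] (P : CurvePoint F)

lemma ord_eq_zero {u : F} {c : ℂ} (hc : c ≠ 0) (hu : u - algebraMap ℂ F c ∈ P.ring.nonunits) :
    u ≠ 0 ∧ P.ord u = 0 := by
  have hu1 : u ∈ P.ring := by
    have := add_mem (ValuationSubring.nonunits_subset hu) (P.const_mem c)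
    rwa [sub_add_cancel] at this
  have hu2 : u ∉ P.ring.nonunits := by
    intro h
    have := sub_mem h hu
    rw [sub_sub_cancel, P.algebraMap_mem_nonunits] at this
    exact hc this
  have hu0 : u ≠ 0 := by rintro rfl; exact hu2 (zero_mem _)
  rw [P.mem_ring_iff hu0] at hu1
  rw [P.mem_nonunits_iff hu0] at hu2
  exact ⟨hu0, by omega⟩

lemma exists_residue_ne_zero {u : F} (hu0 : u ≠ 0) (hu : P.ord u = 0) :
    ∃ c : ℂ, c ≠ 0 ∧ u - algebraMap ℂ F c ∈ P.ring.nonunits := by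
  obtain ⟨c, hc⟩ := P.exists_residue ((P.mem_ring_iff hu0).2 hu.ge)
  refine ⟨c, ?_, hc⟩
  rintro rfl
  rw [map_zero, sub_zero, P.mem_nonunits_iff hu0] at hc
  omega

end CurvePoint

end Ramification

section DoubleCover

set_option linter.unusedSectionVars false

variable {E F : Type} [Field E] [Field F] [Algebra ℂ E] [Algebra ℂ F] [Algebra E F]
  [IsScalarTower ℂ E F] [IsFunctionField E] [IsFunctionField F]

namespace IsKummer

variable {l : F} {q : E} {σ : F →+* F} (h : IsKummer l q σ)

include h

/-- Up to a factor from `E`, a function is `f' + g' l` with `f'`, `g'` regular below and not both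
vanishing. If its residue `α + β b` is non-zero, it is a unit at both points. Otherwise its
conjugate has residue `α - β b ≠ 0` and is a unit, so its order is that of its norm, which comes
from `E`. The case `P = Q` yields unramifiedness, the general case injectivity. -/
lemma exists_ord_eq_mul {P Q : CurvePoint F} (hPQ : h.cover P = h.cover Q) {b : ℂ} (hb : b ≠ 0)
    (hP : l - algebraMap ℂ F b ∈ P.ring.nonunits) (hQ : l - algebraMap ℂ F b ∈ Q.ring.nonunits)
    {x : F} (hx : x ≠ 0) : ∃ n : ℤ, P.ord x = h.ram P * n ∧ Q.ord x = h.ram Q * n := by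
  set R := h.cover P with hR
  obtain ⟨f, g, rfl⟩ := h.exists_decomp x
  -- Divide by whichever of `f`, `g` has the smaller order at `R`, so that one coefficient becomes
  -- `1`.
  obtain ⟨k, f', g', hk, hf', hg', rfl, rfl, hfg⟩ : ∃ k f' g' : E, k ≠ 0 ∧ f' ∈ R.ring ∧
      g' ∈ R.ring ∧ f = k * f' ∧ g = k * g' ∧ (f' = 1 ∨ g' = 1) := by
    rcases eq_or_ne g 0 with rfl | hg
    · have hf : f ≠ 0 := by rintro rfl; simp at hx
      exact ⟨f, 1, 0, hf, one_mem _, zero_mem _, by simp, by simp, Or.inl rfl⟩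
    rcases R.ring.mem_or_inv_mem (f / g) with h1 | h1
    · exact ⟨g, f / g, 1, hg, h1, one_mem _, by field_simp, by simp, Or.inr rfl⟩
    · rcases ne_or_eq f 0 with hf | rfl
      · exact ⟨f, 1, g / f, hf, one_mem _, by rwa [inv_div] at h1, by simp, by field_simp,
          Or.inl rfl⟩
      · exact ⟨g, 0, 1, hg, zero_mem _, one_mem _, by simp, by simp, Or.inr rfl⟩
  obtain ⟨α, hα⟩ := R.exists_residue hf'
  obtain ⟨β, hβ⟩ := R.exists_residue hg'
  have hαβ : ¬ (α = 0 ∧ β = 0) := by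
    rintro ⟨rfl, rfl⟩
    rw [map_zero, sub_zero] at hα hβ
    have h1 : (1 : E) ∉ R.ring.nonunits := by
      rw [← map_one (algebraMap ℂ E), R.algebraMap_mem_nonunits]; exact one_ne_zero
    rcases hfg with rfl | rfl
    · exact h1 hα
    · exact h1 hβ
  have hlift : ∀ {S : CurvePoint F}, h.cover S = R → ∀ {y : E} {c : ℂ},
      y - algebraMap ℂ E c ∈ R.ring.nonunits →
      algebraMap E F y - algebraMap ℂ F c ∈ S.ring.nonunits := by
    intro S hS y c hy
    rcases eq_or_ne (y - algebraMap ℂ E c) 0 with h0 | h0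
    · rw [IsScalarTower.algebraMap_apply ℂ E F, ← map_sub, h0, map_zero]; exact zero_mem _
    rw [R.mem_nonunits_iff h0] at hy
    rw [IsScalarTower.algebraMap_apply ℂ E F, ← map_sub,
      S.mem_nonunits_iff ((map_ne_zero _).2 h0), h.ord_algebraMap S h0, hS]
    exact mul_pos (h.ram_pos S) hy
  have hres : ∀ {S : CurvePoint F}, h.cover S = R → l - algebraMap ℂ F b ∈ S.ring.nonunits →
      ∀ s : ℂ, (algebraMap E F f' + algebraMap ℂ F s * algebraMap E F g' * l) -
        algebraMap ℂ F (α + s * β * b) ∈ S.ring.nonunits := by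
    intro S hS hSl s
    have h1 := hlift hS hα
    have h2 := hlift hS hβ
    have hl : l ∈ S.ring := by
      have := add_mem (ValuationSubring.nonunits_subset hSl) (S.const_mem b)
      rwa [sub_add_cancel] at this
    have h3 := S.mul_mem_nonunits h2 (mul_mem (S.const_mem s) hl)
    have h4 := S.mul_mem_nonunits hSl (S.const_mem (s * β))
    have h5 := add_mem h1 (add_mem h3 h4)
    convert h5 using 1
    simp only [map_add, map_mul]
    ring
  have hunit : ∀ {S : CurvePoint F}, h.cover S = R → l - algebraMap ℂ F b ∈ S.ring.nonunits →
      ∀ {s : ℂ}, α + s * β * b ≠ 0 →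
      (algebraMap E F f' + algebraMap ℂ F s * algebraMap E F g' * l) ≠ 0 ∧
      S.ord (algebraMap E F f' + algebraMap ℂ F s * algebraMap E F g' * l) = 0 := by
    intro S hS hSl s hs
    exact S.ord_eq_zero hs (hres hS hSl s)
  have hu0 : algebraMap E F f' + algebraMap E F g' * l ≠ 0 := by
    intro h0
    apply hx
    rw [map_mul, map_mul, mul_assoc, ← mul_add, h0, mul_zero]
  obtain ⟨n, hn⟩ : ∃ n : ℤ, ∀ {S : CurvePoint F}, h.cover S = R →
      l - algebraMap ℂ F b ∈ S.ring.nonunits →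
      S.ord (algebraMap E F f' + algebraMap E F g' * l) = h.ram S * n := by
    by_cases hs : α + 1 * β * b = 0
    · have hs' : α + (-1) * β * b ≠ 0 := by
        intro hs'
        have h1 : α = 0 := by linear_combination (hs + hs') / 2
        have h2 : β * b = 0 := by linear_combination (hs - hs') / 2
        exact hαβ ⟨h1, (mul_eq_zero.1 h2).resolve_right hb⟩
      have hN : (algebraMap E F f' + algebraMap E F g' * l) *
          (algebraMap E F f' + algebraMap ℂ F (-1) * algebraMap E F g' * l) =
            algebraMap E F (f' ^ 2 - g' ^ 2 * q) := by
        simp only [map_sub, map_mul, map_pow, ← h.sq, map_neg, map_one]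
        ring
      refine ⟨R.ord (f' ^ 2 - g' ^ 2 * q), fun {S} hS hSl => ?_⟩
      obtain ⟨h1, h2⟩ := hunit hS hSl hs'
      have hN0 : f' ^ 2 - g' ^ 2 * q ≠ 0 := by
        intro h0
        rw [h0, map_zero] at hN
        exact mul_ne_zero hu0 h1 hN
      have h3 := congrArg S.ord hN
      rw [S.ord_mul hu0 h1, h2, add_zero, h.ord_algebraMap S hN0, hS] at h3
      exact h3
    · refine ⟨0, fun {S} hS hSl => ?_⟩
      have := (hunit hS hSl hs).2
      rw [map_one, one_mul] at this
      rw [this, mul_zero]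
  refine ⟨R.ord k + n, ?_, ?_⟩
  · rw [map_mul, map_mul, mul_assoc, ← mul_add, P.ord_mul (by simpa using hk) hu0,
      h.ord_algebraMap P hk, hn hR.symm hP, mul_add]
  · rw [map_mul, map_mul, mul_assoc, ← mul_add, Q.ord_mul (by simpa using hk) hu0,
      h.ord_algebraMap Q hk, hn hPQ.symm hQ, mul_add, ← hPQ]

/-- All orders at `P` are multiples of the ramification index, and a uniformizer has order one. -/
lemma ram_eq_one {P : CurvePoint F} (hl : P.ord l = 0) : h.ram P = 1 := by
  obtain ⟨b, hb, hP⟩ := P.exists_residue_ne_zero h.ne_zero hl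
  obtain ⟨π, hπ0, hπ⟩ := P.exists_ord_eq_one
  obtain ⟨n, hn, -⟩ := h.exists_ord_eq_mul rfl hb hP hP hπ0
  rw [hπ] at hn
  exact (Int.eq_one_or_neg_one_of_mul_eq_one hn.symm).resolve_right
    (by have := h.ram_pos P; omega)

lemma eq_of_residue_eq {P Q : CurvePoint F} (hPQ : h.cover P = h.cover Q) {b : ℂ} (hb : b ≠ 0)
    (hP : l - algebraMap ℂ F b ∈ P.ring.nonunits) (hQ : l - algebraMap ℂ F b ∈ Q.ring.nonunits) :
    P = Q := by
  apply CurvePoint.ext_ring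
  ext x
  rcases eq_or_ne x 0 with rfl | hx
  · simp only [zero_mem]
  obtain ⟨n, h1, h2⟩ := h.exists_ord_eq_mul hPQ hb hP hQ hx
  rw [h.ram_eq_one (P.ord_eq_zero hb hP).2] at h1
  rw [h.ram_eq_one (Q.ord_eq_zero hb hQ).2] at h2
  rw [P.mem_ring_iff hx, Q.mem_ring_iff hx, h1, h2]

lemma gen_sq_ne_zero : q ≠ 0 := by
  rintro rfl
  have := h.sq
  rw [map_zero] at this
  exact h.ne_zero (pow_eq_zero_iff (two_ne_zero) |>.1 this)

lemma two_mul_ord_gen (P : CurvePoint F) : 2 * P.ord l = h.ram P * (h.cover P).ord q := by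
  rw [← h.ord_algebraMap P h.gen_sq_ne_zero, ← h.sq, P.ord_pow]
  norm_num

lemma mem_nonunits_swap {P : CurvePoint F} {x : F} :
    x ∈ (h.swap P).ring.nonunits ↔ σ x ∈ P.ring.nonunits := by
  rw [ValuationSubring.mem_nonunits_iff_or, ValuationSubring.mem_nonunits_iff_or, map_eq_zero,
    ← map_inv₀]
  rfl

lemma swap_residue {P : CurvePoint F} {b : ℂ} (hP : l - algebraMap ℂ F b ∈ P.ring.nonunits) :
    l - algebraMap ℂ F (-b) ∈ (h.swap P).ring.nonunits := by
  rw [h.mem_nonunits_swap, map_sub, h.map_gen, h.map_const]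
  have := neg_mem hP
  convert this using 1
  rw [map_neg]; ring

/-- The residue of `l` changes from `b` to `-b`, and `b ≠ 0`. -/
lemma swap_ne {P : CurvePoint F} (hl : P.ord l = 0) : h.swap P ≠ P := by
  intro hs
  obtain ⟨b, hb, hP⟩ := P.exists_residue_ne_zero h.ne_zero hl
  have h1 := h.swap_residue hP
  rw [hs] at h1
  have h2 := sub_mem hP h1
  rw [sub_sub_sub_cancel_left, ← map_sub, P.algebraMap_mem_nonunits] at h2
  apply hb
  linear_combination -h2 / 2

/-- The square of the residue of `l` is the residue of `q` below, so on a fibre the residue of `l`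
is determined up to sign; by `eq_of_residue_eq` the residue determines the point. -/
lemma eq_or_eq_swap_of_unit {P Q : CurvePoint F} (hl : P.ord l = 0)
    (hPQ : h.cover P = h.cover Q) : Q = P ∨ Q = h.swap P := by
  have hlQ : Q.ord l = 0 := by
    have h1 := h.two_mul_ord_gen P
    have h2 := h.two_mul_ord_gen Q
    rw [hl, mul_zero, eq_comm, mul_eq_zero] at h1
    rw [← hPQ, h1.resolve_left (h.ram_pos P).ne', mul_zero] at h2
    omega
  obtain ⟨b, hb, hP⟩ := P.exists_residue_ne_zero h.ne_zero hl
  obtain ⟨c, hc, hQ⟩ := Q.exists_residue_ne_zero h.ne_zero hlQ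
  have key : ∀ {S : CurvePoint F} {c : ℂ}, l - algebraMap ℂ F c ∈ S.ring.nonunits →
      q - algebraMap ℂ E (c ^ 2) ∈ (h.cover S).ring.nonunits := by
    intro S c hc
    have hl : l ∈ S.ring := by
      have := add_mem (ValuationSubring.nonunits_subset hc) (S.const_mem c)
      rwa [sub_add_cancel] at this
    have h1 := S.mul_mem_nonunits hc (add_mem hl (S.const_mem c))
    have h2 : (l - algebraMap ℂ F c) * (l + algebraMap ℂ F c) =
        algebraMap E F (q - algebraMap ℂ E (c ^ 2)) := by
      rw [map_sub, ← h.sq, ← IsScalarTower.algebraMap_apply, map_pow]; ring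
    rw [h2] at h1
    rw [ValuationSubring.mem_nonunits_iff_or] at h1 ⊢
    rw [map_eq_zero, ← map_inv₀] at h1
    exact h1
  have h1 := key hP
  have h2 := key hQ
  rw [hPQ] at h1
  have h3 := sub_mem h1 h2
  rw [sub_sub_sub_cancel_left, ← map_sub, CurvePoint.algebraMap_mem_nonunits, sub_eq_zero] at h3
  rcases sq_eq_sq_iff_eq_or_eq_neg.1 h3 with rfl | rfl
  · exact Or.inl (h.eq_of_residue_eq hPQ hb hP hQ).symm
  · right
    exact (h.eq_of_residue_eq ((h.cover_swap P).trans hPQ) (neg_ne_zero.2 hb) (h.swap_residue hP)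
      hQ).symm

/-- Otherwise `l` divided by the `j`-th power of a base parameter is a unit at `P`. As `σ` fixes `P`
it preserves residues, but it negates this unit, so the residue would vanish. -/
lemma ord_gen_ne {P : CurvePoint F} (hs : h.swap P = P) (j : ℤ) : P.ord l ≠ h.ram P * j := by
  intro hj
  obtain ⟨π, hπ0, hπ⟩ := (h.cover P).exists_ord_eq_one
  have hπ0' : algebraMap E F π ≠ 0 := by simpa using hπ0
  have hu0 : l * algebraMap E F π ^ (-j) ≠ 0 := mul_ne_zero h.ne_zero (zpow_ne_zero _ hπ0')
  obtain ⟨c, hc, hP⟩ := P.exists_residue_ne_zero hu0 (by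
    rw [P.ord_mul h.ne_zero (zpow_ne_zero _ hπ0'), P.ord_zpow, h.ord_algebraMap P hπ0, hπ, hj]
    ring)
  have h1 := hP
  rw [← hs, h.mem_nonunits_swap, map_sub, map_mul, map_zpow₀, h.map_base, h.map_gen,
    h.map_const] at h1
  have h2 := add_mem hP h1
  have h3 : l * algebraMap E F π ^ (-j) - algebraMap ℂ F c + (-l * algebraMap E F π ^ (-j) -
      algebraMap ℂ F c) = algebraMap ℂ F (-2 * c) := by
    rw [map_mul, map_neg, map_ofNat]; ring
  rw [h3, P.algebraMap_mem_nonunits] at h2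
  exact hc (by linear_combination -h2 / 2)

/-- The norm of a uniformizer has order `2` at the fixed point and comes from `E`, so the index
divides `2`; index `1` is excluded by `ord_gen_ne`. -/
lemma ram_eq_two {P : CurvePoint F} (hs : h.swap P = P) : h.ram P = 2 := by
  obtain ⟨t, ht0, ht⟩ := P.exists_ord_eq_one
  obtain ⟨n, hn⟩ := h.exists_norm t
  have hσ0 : σ t ≠ 0 := by simpa using ht0
  have hn0 : n ≠ 0 := by
    rintro rfl
    rw [map_zero] at hn
    exact mul_ne_zero ht0 hσ0 hn
  have h1 := congrArg P.ord hn
  rw [P.ord_mul ht0 hσ0, ← h.ord_swap, hs, ht, h.ord_algebraMap P hn0] at h1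
  have h2 := Int.le_of_dvd (by norm_num) (Dvd.intro _ h1.symm)
  have h3 := h.ram_pos P
  have h4 : h.ram P ≠ 1 := fun h4 => h.ord_gen_ne hs (P.ord l) (by rw [h4, one_mul])
  omega

lemma odd_ord_gen {P : CurvePoint F} (hs : h.swap P = P) : Odd (P.ord l) := by
  rw [← Int.not_even_iff_odd]
  rintro ⟨j, hj⟩
  exact h.ord_gen_ne hs j (by rw [h.ram_eq_two hs, hj]; ring)

end IsKummer

end DoubleCover

/-! ### Covers branched at two points, and their genus -/

section DoubleCover

set_option linter.unusedSectionVars false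

variable {E F : Type} [Field E] [Field F] [Algebra ℂ E] [Algebra ℂ F] [Algebra E F]
  [IsScalarTower ℂ E F] [IsFunctionField E] [IsFunctionField F]

/-- `F = E(l)` with `l² ∈ E`, and `l` has the single zero `P₀` and the single pole `P₁`. -/
structure IsTwoPointKummer (l : F) (q : E) (σ : F →+* F) (P₀ P₁ : CurvePoint F) : Prop
    extends IsKummer l q σ where
  zero_iff : ∀ P : CurvePoint F, P.IsZero l ↔ P = P₀
  pole_iff : ∀ P : CurvePoint F, P.IsPole l ↔ P = P₁

namespace IsTwoPointKummer

variable {l : F} {q : E} {σ : F →+* F} {P₀ P₁ : CurvePoint F} (h : IsTwoPointKummer l q σ P₀ P₁)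

include h

lemma ord_pos_iff (P : CurvePoint F) : 0 < P.ord l ↔ P = P₀ := by
  rw [← h.zero_iff, CurvePoint.IsZero, P.mem_nonunits_iff h.ne_zero]

lemma ord_neg_iff (P : CurvePoint F) : P.ord l < 0 ↔ P = P₁ := by
  rw [← h.pole_iff, CurvePoint.IsPole, P.mem_ring_iff h.ne_zero, not_le]

lemma ord_eq_zero {P : CurvePoint F} (h₀ : P ≠ P₀) (h₁ : P ≠ P₁) : P.ord l = 0 := by
  rw [ne_eq, ← h.ord_pos_iff] at h₀
  rw [ne_eq, ← h.ord_neg_iff] at h₁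
  omega

lemma ne : P₀ ≠ P₁ := by
  rintro rfl
  have h1 := (h.ord_pos_iff P₀).2 rfl
  have h2 := (h.ord_neg_iff P₀).2 rfl
  omega

/-- The involution sends `l` to `-l`, so it maps the only zero of `l` to a zero of `l`. -/
lemma swap_zero : h.swap P₀ = P₀ := by
  rw [← h.ord_pos_iff, h.ord_swap, h.map_gen, CurvePoint.ord_neg, h.ord_pos_iff]

lemma swap_pole : h.swap P₁ = P₁ := by
  rw [← h.ord_neg_iff, h.ord_swap, h.map_gen, CurvePoint.ord_neg, h.ord_neg_iff]

lemma swap_eq_iff (P : CurvePoint F) : h.swap P = P ↔ P = P₀ ∨ P = P₁ := by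
  constructor
  · intro hs
    by_contra! hP
    exact h.swap_ne (h.ord_eq_zero hP.1 hP.2) hs
  · rintro (rfl | rfl)
    exacts [h.swap_zero, h.swap_pole]

/-- If `l` is not a unit at `P`, the sign of the order of `q` below makes every point of the fibre a
zero, or every point a pole, of `l`; each is unique. -/
lemma cover_eq_iff (P Q : CurvePoint F) : h.cover P = h.cover Q ↔ Q = P ∨ Q = h.swap P := by
  constructor
  · intro hPQ
    rcases eq_or_ne (P.ord l) 0 with hl | hl
    · exact h.eq_or_eq_swap_of_unit hl hPQ
    left
    have h1 := h.two_mul_ord_gen P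
    have h2 := h.two_mul_ord_gen Q
    rw [← hPQ] at h2
    have hP := h.ram_pos P
    have hQ := h.ram_pos Q
    rcases lt_or_gt_of_ne hl with hl | hl
    · have h3 : (h.cover P).ord q < 0 := by nlinarith
      have h4 : Q.ord l < 0 := by nlinarith
      rw [(h.ord_neg_iff P).1 hl, (h.ord_neg_iff Q).1 h4]
    · have h3 : 0 < (h.cover P).ord q := by nlinarith
      have h4 : 0 < Q.ord l := by nlinarith
      rw [(h.ord_pos_iff P).1 hl, (h.ord_pos_iff Q).1 h4]
  · rintro (rfl | rfl)
    · rfl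
    · rw [h.cover_swap]

/-- The divisor `D` of `l` has degree zero because all its multiples are equivalent to `0`: then
`dim L(m D) ≤ 1`, so Riemann's inequality bounds `m * deg D` from above for every integer `m`. -/
lemma ord_zero_add_ord_pole : P₀.ord l + P₁.ord l = 0 := by
  classical
  obtain ⟨C, hC⟩ := exists_defect_le (F := F)
  set D : CurvePoint F →₀ ℤ := Finsupp.single P₀ (P₀.ord l) + Finsupp.single P₁ (P₁.ord l) with hD
  have hDP : ∀ P, D P = P.ord l := by
    intro P
    rw [hD, Finsupp.add_apply]
    rcases eq_or_ne P P₀ with rfl | h0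
    · rw [Finsupp.single_eq_same, Finsupp.single_eq_of_ne h.ne, add_zero]
    rcases eq_or_ne P P₁ with rfl | h1
    · rw [Finsupp.single_eq_same, Finsupp.single_eq_of_ne h.ne.symm, zero_add]
    rw [Finsupp.single_eq_of_ne h0, Finsupp.single_eq_of_ne h1, h.ord_eq_zero h0 h1, add_zero]
  have hdeg : degree D = P₀.ord l + P₁.ord l := by
    rw [hD, degree_add, degree_single, degree_single]
  have key : ∀ m : ℤ, m * degree D ≤ C := by
    intro m
    have h1 : Module.finrank ℂ (riemannRochSpace (m • D)) ≤
        Module.finrank ℂ (riemannRochSpace (0 : CurvePoint F →₀ ℤ)) :=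
      finrank_riemannRochSpace_le (zpow_ne_zero m h.ne_zero) fun P => by
        rw [P.ord_zpow, Finsupp.smul_apply, hDP]; simp
    rw [finrank_riemannRochSpace_zero] at h1
    have h2 := hC (m • D)
    rw [defect, degree_smul] at h2
    omega
  rw [← hdeg]
  by_contra hne
  have hC0 : 0 ≤ C := by simpa using key 0
  -- This multiple gives `(C + 1) (deg D)² ≤ C`, impossible when `deg D ≠ 0` and `C ≥ 0`.
  have := key ((C + 1) * degree D)
  have h2 : 1 ≤ degree D * degree D := by
    have := mul_self_pos.2 hne
    omega
  nlinarith

/-- The pull-back of a divisor under the double cover. -/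
def pull (D : CurvePoint E →₀ ℤ) : CurvePoint F →₀ ℤ :=
  D.mapDomain (Function.surjInv h.cover_surjective) +
    D.mapDomain (h.swap ∘ Function.surjInv h.cover_surjective)

lemma degree_mapDomain {X Y : Type} [Field X] [Algebra ℂ X] [Field Y] [Algebra ℂ Y]
    (s : CurvePoint X → CurvePoint Y) (D : CurvePoint X →₀ ℤ) :
    degree (D.mapDomain s) = degree D :=
  Finsupp.sum_mapDomain_index (by simp) (by simp)

lemma degree_pull (D : CurvePoint E →₀ ℤ) : degree (h.pull D) = 2 * degree D := by
  rw [pull, degree_add, h.degree_mapDomain, h.degree_mapDomain]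
  ring

lemma ram_zero : h.ram P₀ = 2 := h.ram_eq_two h.swap_zero

lemma ram_pole : h.ram P₁ = 2 := h.ram_eq_two h.swap_pole

/-- The two summands of `pull` sit at the two points of a fibre, or twice at the same point over a
branch point. Either way the multiplicity is the ramification index. -/
lemma pull_apply (D : CurvePoint E →₀ ℤ) (P : CurvePoint F) :
    h.pull D P = h.ram P * D (h.cover P) := by
  set s := Function.surjInv h.cover_surjective with hs
  have hsec : ∀ Q, h.cover (s Q) = Q := Function.surjInv_eq h.cover_surjective
  have hinj : Function.Injective s := Function.injective_surjInv _
  have hswap : Function.Injective h.swap := fun P Q hPQ => by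
    rw [← h.swap_swap P, hPQ, h.swap_swap]
  have hinj' : Function.Injective (h.swap ∘ s) := hswap.comp hinj
  have e1 : ∀ Q, D.mapDomain s (s Q) = D Q := Finsupp.mapDomain_apply hinj D
  have e2 : ∀ Q, D.mapDomain (h.swap ∘ s) (h.swap (s Q)) = D Q := Finsupp.mapDomain_apply hinj' D
  have hrange : ∀ P, P ∈ Set.range s → P = s (h.cover P) := by
    rintro _ ⟨Q, rfl⟩; rw [hsec]
  rw [pull, Finsupp.add_apply, ← hs]
  have hcase := (h.cover_eq_iff (s (h.cover P)) P).1 (hsec _)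
  by_cases hfix : h.swap P = P
  · rw [h.ram_eq_two hfix]
    have hP : P = s (h.cover P) := by
      rcases hcase with h1 | h1
      · exact h1
      · apply hswap
        rw [hfix, ← h1]
    have h1 := e1 (h.cover P)
    have h2 := e2 (h.cover P)
    rw [← hP] at h1 h2
    rw [hfix] at h2
    rw [h1, h2]; ring
  · have hl : P.ord l = 0 := by
      rw [h.swap_eq_iff, not_or] at hfix
      exact h.ord_eq_zero hfix.1 hfix.2
    rw [h.ram_eq_one hl, one_mul]
    rcases hcase with hP | hP
    · have h1 := e1 (h.cover P)
      rw [← hP] at h1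
      have h2 : D.mapDomain (h.swap ∘ s) P = 0 := by
        apply Finsupp.mapDomain_of_notMem_range
        rintro ⟨Q, hQ⟩
        have h3 : h.cover P = Q := by rw [← hQ, Function.comp_apply, h.cover_swap, hsec]
        rw [← h3, Function.comp_apply, ← hP] at hQ
        exact hfix hQ
      rw [h1, h2, add_zero]
    · have h1 := e2 (h.cover P)
      rw [← hP] at h1
      have h2 : D.mapDomain s P = 0 := by
        apply Finsupp.mapDomain_of_notMem_range
        intro h3
        rw [← hrange P h3] at hP
        exact hfix hP.symm
      rw [h1, h2, zero_add]

lemma algebraMap_mem_pull {D : CurvePoint E →₀ ℤ} {f : E} :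
    algebraMap E F f ∈ riemannRochSpace (h.pull D) ↔ f ∈ riemannRochSpace D := by
  rcases eq_or_ne f 0 with rfl | hf
  · rw [map_zero]; simp only [zero_mem]
  rw [CurvePoint.mem_riemannRochSpace hf, CurvePoint.mem_riemannRochSpace ((map_ne_zero _).2 hf),
    h.cover_surjective.forall]
  refine forall_congr' fun P => ?_
  rw [h.pull_apply, h.ord_algebraMap P hf, ← mul_neg]
  exact mul_le_mul_iff_of_pos_left (h.ram_pos P)

/-- Over the branch points the conditions on `g` are inequalities with half-integers, from the
orders `2 j + 1` and `-(2 j + 1)` of `l`. Rounding gives `j` and `-(j + 1)`, whose sum is `-1`. -/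
lemma algebraMap_mul_mem_pull {D : CurvePoint E →₀ ℤ} {g : E} {j : ℤ}
    (hj : P₀.ord l = 2 * j + 1) :
    algebraMap E F g * l ∈ riemannRochSpace (h.pull D) ↔
      g ∈ riemannRochSpace (D + (Finsupp.single (h.cover P₀) j -
        Finsupp.single (h.cover P₁) (j + 1))) := by
  classical
  have hj' := h.ord_zero_add_ord_pole
  have hcov : ∀ {P Q : CurvePoint F}, h.swap P = P → (h.cover P = h.cover Q ↔ Q = P) := by
    intro P Q hP
    rw [h.cover_eq_iff, hP, or_self]
  rcases eq_or_ne g 0 with rfl | hg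
  · rw [map_zero, zero_mul]; simp only [zero_mem]
  have hg' : algebraMap E F g ≠ 0 := (map_ne_zero _).2 hg
  rw [CurvePoint.mem_riemannRochSpace hg, CurvePoint.mem_riemannRochSpace
    (mul_ne_zero hg' h.ne_zero), h.cover_surjective.forall]
  refine forall_congr' fun P => ?_
  rw [h.pull_apply, P.ord_mul hg' h.ne_zero, h.ord_algebraMap P hg, Finsupp.add_apply,
    Finsupp.sub_apply, Finsupp.single_apply, Finsupp.single_apply, hcov h.swap_zero,
    hcov h.swap_pole]
  rcases eq_or_ne P P₀ with rfl | h0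
  · rw [if_pos rfl, if_neg h.ne, h.ram_zero]
    omega
  rcases eq_or_ne P P₁ with rfl | h1
  · rw [if_pos rfl, if_neg h.ne.symm, h.ram_pole]
    omega
  · rw [if_neg h0, if_neg h1, h.ram_eq_one (h.ord_eq_zero h0 h1), h.ord_eq_zero h0 h1]
    omega

lemma map_mem_pull {D : CurvePoint E →₀ ℤ} {x : F} (hx : x ∈ riemannRochSpace (h.pull D)) :
    σ x ∈ riemannRochSpace (h.pull D) := by
  rcases eq_or_ne x 0 with rfl | hx0
  · rw [map_zero]; exact zero_mem _
  rw [CurvePoint.mem_riemannRochSpace ((map_ne_zero σ).2 hx0)]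
  rw [CurvePoint.mem_riemannRochSpace hx0] at hx
  intro P
  have h1 := hx (h.swap P)
  rw [h.ord_swap, h.pull_apply, h.cover_swap] at h1
  have h2 : h.ram (h.swap P) = h.ram P := by
    by_cases hP : h.swap P = P
    · rw [hP]
    · have hl : P.ord l = 0 := by
        rw [h.swap_eq_iff, not_or] at hP
        exact h.ord_eq_zero hP.1 hP.2
      rw [h.ram_eq_one hl, h.ram_eq_one (by rw [h.ord_swap, h.map_gen, P.ord_neg, hl])]
  rwa [h2, ← h.pull_apply] at h1

/-- The space of the pulled back divisor is invariant under `σ` and splits into even and odd parts,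
which are spaces of functions on the base. -/
lemma finrank_pull (D : CurvePoint E →₀ ℤ) {j : ℤ} (hj : P₀.ord l = 2 * j + 1) :
    Module.finrank ℂ (riemannRochSpace (h.pull D)) = Module.finrank ℂ (riemannRochSpace D) +
      Module.finrank ℂ (riemannRochSpace (D + (Finsupp.single (h.cover P₀) j -
        Finsupp.single (h.cover P₁) (j + 1)))) := by
  set D' := D + (Finsupp.single (h.cover P₀) j - Finsupp.single (h.cover P₁) (j + 1))
  let φ : E × E →ₗ[ℂ] F :=
    { toFun := fun p => algebraMap E F p.1 + algebraMap E F p.2 * l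
      map_add' := fun p p' => by simp only [Prod.fst_add, Prod.snd_add, map_add]; ring
      map_smul' := fun c p => by
        simp only [Prod.smul_fst, Prod.smul_snd, RingHom.id_apply]
        rw [Algebra.smul_def c p.1, Algebra.smul_def c p.2, Algebra.smul_def c, map_mul, map_mul,
          ← IsScalarTower.algebraMap_apply]
        ring }
  have hφ : Function.Injective φ := by
    rw [← LinearMap.ker_eq_bot, LinearMap.ker_eq_bot']
    intro p hp
    obtain ⟨h1, h2⟩ := h.decomp_unique hp
    exact Prod.ext h1 h2
  have hmap : ((riemannRochSpace D).prod (riemannRochSpace D')).map φ =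
      riemannRochSpace (h.pull D) := by
    ext x
    rw [Submodule.mem_map]
    constructor
    · rintro ⟨⟨f, g⟩, ⟨hf, hg⟩, rfl⟩
      exact add_mem (h.algebraMap_mem_pull.2 hf) ((h.algebraMap_mul_mem_pull hj).2 hg)
    · intro hx
      obtain ⟨f, g, rfl⟩ := h.exists_decomp x
      have hσ := h.map_mem_pull hx
      rw [map_add, map_mul, h.map_base, h.map_base, h.map_gen] at hσ
      have hf := Submodule.smul_mem _ (1 / 2 : ℂ) (add_mem hx hσ)
      have hg := Submodule.smul_mem _ (1 / 2 : ℂ) (sub_mem hx hσ)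
      have h2 : algebraMap ℂ F (1 / 2) * 2 = 1 := by
        rw [← map_ofNat (algebraMap ℂ F) 2, ← map_mul]; norm_num
      rw [Algebra.smul_def] at hf hg
      have ef : algebraMap ℂ F (1 / 2) * (algebraMap E F f + algebraMap E F g * l +
          (algebraMap E F f + algebraMap E F g * -l)) = algebraMap E F f := by
        linear_combination algebraMap E F f * h2
      have eg : algebraMap ℂ F (1 / 2) * (algebraMap E F f + algebraMap E F g * l -
          (algebraMap E F f + algebraMap E F g * -l)) = algebraMap E F g * l := by
        linear_combination algebraMap E F g * l * h2
      rw [ef] at hf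
      rw [eg] at hg
      exact ⟨(f, g), ⟨h.algebraMap_mem_pull.1 hf, (h.algebraMap_mul_mem_pull hj).1 hg⟩, rfl⟩
  let ψ : riemannRochSpace D × riemannRochSpace D' →ₗ[ℂ] F :=
    φ.comp ((riemannRochSpace D).subtype.prodMap (riemannRochSpace D').subtype)
  have hψ : Function.Injective ψ :=
    hφ.comp (Prod.map_injective.2 ⟨Subtype.val_injective, Subtype.val_injective⟩)
  have hrange : LinearMap.range ψ = riemannRochSpace (h.pull D) := by
    rw [LinearMap.range_comp, LinearMap.range_prodMap, Submodule.range_subtype,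
      Submodule.range_subtype, hmap]
  rw [← hrange, LinearMap.finrank_range_of_inj hψ, Module.finrank_prod]

lemma exists_le_pull (G : CurvePoint F →₀ ℤ) : ∃ D : CurvePoint E →₀ ℤ, 0 ≤ D ∧
    ∀ P, G P ≤ D (h.cover P) := by
  classical
  induction G using Finsupp.induction_linear with
  | zero => exact ⟨0, le_rfl, by simp⟩
  | add G₁ G₂ h₁ h₂ =>
    obtain ⟨D₁, h1, h2⟩ := h₁
    obtain ⟨D₂, h3, h4⟩ := h₂
    exact ⟨D₁ + D₂, add_nonneg h1 h3, fun P => add_le_add (h2 P) (h4 P)⟩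
  | single P k =>
    refine ⟨Finsupp.single (h.cover P) |k|, ?_, fun Q => ?_⟩
    · rw [Finsupp.single_nonneg]; positivity
    · rcases eq_or_ne P Q with rfl | hPQ
      · rw [Finsupp.single_eq_same, Finsupp.single_eq_same]; exact le_abs_self k
      · rw [Finsupp.single_eq_of_ne' hPQ, Finsupp.single_apply]
        split_ifs <;> positivity

/-- For large `D` both `D` and `D + Δ` have defect `p`, so `h.pull D` has defect `2 deg D - (deg D +
1 - p) - (deg D - p) + 1 = 2 p`. Every divisor lies below such a pull-back, and the defect is
monotone. -/
lemma hasGenus {p : ℕ} (hp : HasGenus E p) : HasGenus F (2 * p) := by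
  obtain ⟨j, hj⟩ := h.odd_ord_gen h.swap_zero
  set Δ := Finsupp.single (h.cover P₀) j - Finsupp.single (h.cover P₁) (j + 1) with hΔ
  have hΔdeg : degree Δ = -1 := by
    rw [hΔ, sub_eq_add_neg, degree_add, degree_neg, degree_single, degree_single]; ring
  obtain ⟨⟨D₀, hD₀⟩, hmax⟩ := hp
  replace hD₀ : defect D₀ = p := hD₀.symm
  have heq : ∀ {D : CurvePoint E →₀ ℤ}, D₀ ≤ D → defect D = p := fun {D} hD =>
    le_antisymm (hmax ⟨D, rfl⟩) (hD₀ ▸ defect_mono hD)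
  have hdef : ∀ {D : CurvePoint E →₀ ℤ}, D₀ ⊔ (D₀ - Δ) ≤ D → defect (h.pull D) = 2 * p := by
    intro D hD
    have h1 := heq (le_sup_left.trans hD)
    have h2 := heq (D := D + Δ) (by
      have := le_sup_right.trans hD
      rwa [sub_le_iff_le_add] at this)
    have h3 := h.finrank_pull D hj
    rw [defect] at h1 h2 ⊢
    rw [degree_add, hΔdeg] at h2
    rw [h.degree_pull, h3]
    push_cast
    linarith
  constructor
  · refine ⟨h.pull (D₀ ⊔ (D₀ - Δ)), ?_⟩
    push_cast
    exact (hdef le_rfl).symm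
  · rintro _ ⟨G, rfl⟩
    obtain ⟨D, hD0, hGD⟩ := h.exists_le_pull G
    -- The supremum with `0` ensures `D ≤ D'`, so that `D'` still bounds `G`.
    obtain ⟨D', hD'⟩ : ∃ D', D' = D + ((D₀ ⊔ (D₀ - Δ)) ⊔ 0) := ⟨_, rfl⟩
    have h1 : D₀ ⊔ (D₀ - Δ) ≤ D' := by
      rw [hD']
      exact le_sup_left.trans (le_add_of_nonneg_left hD0)
    have h2 : G ≤ h.pull D' := by
      intro P
      have h3 : D ≤ D' := by rw [hD']; exact le_add_of_nonneg_right le_sup_right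
      have h4 := hGD P
      have h5 := h3 (h.cover P)
      have h6 := hD0 (h.cover P)
      have h7 := h.ram_pos P
      rw [h.pull_apply]
      rw [Finsupp.coe_zero, Pi.zero_apply] at h6
      nlinarith
    push_cast
    rw [← hdef h1]
    exact defect_mono h2

/-- The geometry of the double cover dual to `E ⊂ E(l)`. -/
theorem exists_cover : ∃ (δ : CurvePoint F → CurvePoint E) (μ : CurvePoint F → CurvePoint F),
    IsDoubleCover δ (algebraMap E F) ∧
    (∀ P, P = P₀ ∨ P = P₁ → HasRamificationIndex δ (algebraMap E F) P 2) ∧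
    (∀ P, P ≠ P₀ → P ≠ P₁ → HasRamificationIndex δ (algebraMap E F) P 1) ∧
    IsDualTo μ σ ∧ (∀ P, μ (μ P) = P) ∧ (∀ P Q, δ P = δ Q ↔ Q = P ∨ Q = μ P) ∧
    (∀ P, μ P = P ↔ P = P₀ ∨ P = P₁) ∧
    ∃ p : ℕ, HasGenus E p ∧ HasGenus F (2 * p) := by
  refine ⟨h.cover, h.swap, ⟨fun _ => rfl, h.cover_surjective, h.finrank_eq_two⟩, ?_, ?_,
    fun _ => rfl, h.swap_swap, h.cover_eq_iff, h.swap_eq_iff, ?_⟩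
  · rintro P (rfl | rfl)
    exacts [h.hasRamificationIndex h.ram_zero, h.hasRamificationIndex h.ram_pole]
  · exact fun P h0 h1 => h.hasRamificationIndex (h.ram_eq_one (h.ord_eq_zero h0 h1))
  · obtain ⟨p, hp⟩ := exists_hasGenus E
    exact ⟨p, hp, h.hasGenus hp⟩

end IsTwoPointKummer

end DoubleCover

open Polynomial

/-! ### Fraction fields, and uniqueness of a pole -/

section Fraction

variable {A : Type} [CommRing A] [IsDomain A] [Algebra ℂ A]

/-- A common denominator turns elements of the fraction field into elements of `A`, so the relations
in `A` bound the degree over `ℂ(x)`. -/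
lemma isFunctionField_fractionRing {x : A} (hx : Transcendental ℂ x) {N : ℕ}
    (hN : ∀ a : Fin N → A, ∃ p : Fin N → ℂ[X], p ≠ 0 ∧ ∑ i, aeval x (p i) * a i = 0) :
    IsFunctionField (FractionRing A) := by
  set F := FractionRing A
  set y : F := algebraMap A F x
  have hinj : Function.Injective (algebraMap A F) := IsFractionRing.injective A F
  have hy : Transcendental ℂ y := by
    intro h
    exact hx ((isAlgebraic_algebraMap_iff hinj).1 h)
  refine ⟨y, hy, ?_⟩
  have hrank : Module.rank ℂ⟮y⟯ F ≤ N := by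
    refine rank_le fun s hs => ?_
    by_contra! hcard
    obtain ⟨e⟩ : Nonempty (Fin N ↪ s) := by
      rw [Function.Embedding.nonempty_iff_card_le]
      simpa using hcard.le
    have hf := hs.comp e e.injective
    set f : Fin N → F := fun i => (e i : F) with hfdef
    obtain ⟨b, hb⟩ := IsLocalization.exist_integer_multiples (nonZeroDivisors A) Finset.univ f
    choose a ha using fun i => hb i (Finset.mem_univ i)
    obtain ⟨p, hp0, hp⟩ := hN a
    have hb0 : algebraMap A F b ≠ 0 := by
      simp
    let g : ℂ⟮y⟯ := AdjoinSimple.gen ℂ y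
    have hg : ∀ q : ℂ[X], ((aeval g q : ℂ⟮y⟯) : F) = algebraMap A F (aeval x q) := by
      intro q
      have h1 : algebraMap ℂ⟮y⟯ F (aeval g q) = aeval y q := by
        rw [← aeval_algebraMap_apply]; rfl
      have h2 : algebraMap A F (aeval x q) = aeval y q := by
        rw [← aeval_algebraMap_apply]
      rw [h2]; exact h1
    have hsum : ∑ i, (aeval g (p i) : ℂ⟮y⟯) • f i = 0 := by
      apply mul_left_cancel₀ hb0
      rw [mul_zero, Finset.mul_sum]
      have h1 := congrArg (algebraMap A F) hp
      rw [map_sum, map_zero] at h1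
      rw [← h1]
      refine Finset.sum_congr rfl fun i _ => ?_
      have h2 : algebraMap A F (a i) = algebraMap A F b * f i := (ha i).trans (Algebra.smul_def _ _)
      rw [map_mul, h2, ← hg, Algebra.smul_def]
      exact mul_left_comm _ _ _
    have h0 := (Fintype.linearIndependent_iff.1 hf) _ hsum
    apply hp0
    funext i
    have h1 : aeval y (p i) = 0 := by
      have h2 : algebraMap A F (aeval x (p i)) = 0 := by rw [← hg, h0 i]; rfl
      rwa [← aeval_algebraMap_apply] at h2
    exact transcendental_iff.1 hy _ h1
  exact Module.rank_lt_aleph0_iff.1 (hrank.trans_lt Cardinal.natCast_lt_aleph0)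

/-- Up to elements which are small where the unit `u` has a pole, cubes of elements are constant
multiples of powers of `u`. -/
def HasLeadingTerms (u : Aˣ) : Prop :=
  ∀ a : A, a ≠ 0 → ∃ (d : ℤ) (c : ℂ) (h : A), c ≠ 0 ∧
    a ^ 3 = ((u ^ d : Aˣ) : A) * (algebraMap ℂ A c + h) ∧
    IsIntegral (Algebra.adjoin ℂ {((u⁻¹ : Aˣ) : A)}) (h ^ 3 * u)

/-- At a pole of `u` the remainder `h` has value less than `1` and the constant `c` has value `1`.
So the cube of the value of `a` is the `d`-th power of the value of `u`, with `d` independent of the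
pole. Whether a quotient is regular at a pole of `u` is then decided by a sign common to all these
poles. -/
lemma unique_pole {u : Aˣ} (hu : HasLeadingTerms u) {P Q : CurvePoint (FractionRing A)}
    (hP : P.IsPole (algebraMap A _ (u : A))) (hQ : Q.IsPole (algebraMap A _ (u : A))) : P = Q := by
  set F := FractionRing A
  have hinj : Function.Injective (algebraMap A F) := IsFractionRing.injective A F
  set y : F := algebraMap A F u
  have hyinv : y⁻¹ = algebraMap A F ((u⁻¹ : Aˣ) : A) := by
    apply inv_eq_of_mul_eq_one_right
    rw [← map_mul, Units.mul_inv, map_one]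
  have hzpow : ∀ d : ℤ, algebraMap A F ((u ^ d : Aˣ) : A) = y ^ d := by
    intro d
    have := map_zpow (Units.map (algebraMap A F : A →* F)) u d
    have h2 := congrArg Units.val this
    rw [Units.val_zpow_eq_zpow_val] at h2
    exact h2
  have key : ∀ a : A, a ≠ 0 → ∃ d : ℤ, ∀ R : CurvePoint F, R.IsPole y →
      R.ring.valuation (algebraMap A F a) ^ 3 = R.ring.valuation y ^ d := by
    intro a ha
    obtain ⟨d, c, h, hc, hah, hint⟩ := hu a ha
    refine ⟨d, fun R hR => ?_⟩
    have hy1 : R.ring.valuation y⁻¹ < 1 := by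
      rw [← ValuationSubring.mem_nonunits_iff, ValuationSubring.inv_mem_nonunits_iff]
      exact Or.inr hR
    have hyR : y⁻¹ ∈ R.ring := (ValuationSubring.valuation_le_one_iff _ _).1 hy1.le
    have hint' : algebraMap A F (h ^ 3 * u) ∈ R.ring := by
      apply R.mem_of_isIntegral hyR
      let f : Algebra.adjoin ℂ {((u⁻¹ : Aˣ) : A)} →+* Algebra.adjoin ℂ {y⁻¹} :=
        ((algebraMap A F).comp (algebraMap _ A)).codRestrict (Algebra.adjoin ℂ {y⁻¹}) (by
          rintro ⟨b, hb⟩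
          have h1 : IsScalarTower.toAlgHom ℂ A F b ∈
            (Algebra.adjoin ℂ {((u⁻¹ : Aˣ) : A)}).map (IsScalarTower.toAlgHom ℂ A F) :=
            ⟨b, hb, rfl⟩
          rw [AlgHom.map_adjoin, Set.image_singleton] at h1
          rw [hyinv]
          exact h1)
      exact hint.map_of_comp_eq f (algebraMap A F) (by ext; rfl)
    -- `h ^ 3` is the product of the regular function `h ^ 3 * u` and `u⁻¹`, which vanishes at `R`.
    have hh : R.ring.valuation (algebraMap A F h) < 1 := by
      have h1 : (algebraMap A F h) ^ 3 = algebraMap A F (h ^ 3 * u) * y⁻¹ := by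
        rw [map_mul, map_pow, mul_assoc, mul_inv_cancel₀, mul_one]
        simp
      have h2 : R.ring.valuation (algebraMap A F h) ^ 3 < 1 := by
        rw [← map_pow, h1, map_mul]
        rw [mul_comm]
        exact mul_lt_one_of_lt_of_le hy1 ((ValuationSubring.valuation_le_one_iff _ _).2 hint')
      exact (pow_lt_one_iff (by norm_num)).1 h2
    have hc1 : R.ring.valuation (algebraMap ℂ F c) = 1 := by
      have h1 := (ValuationSubring.valuation_le_one_iff R.ring _).2 (R.const_mem c)
      refine le_antisymm h1 (not_lt.1 fun h2 => ?_)
      rw [← ValuationSubring.mem_nonunits_iff, R.algebraMap_mem_nonunits] at h2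
      exact hc h2
    rw [← map_pow, ← map_pow, hah, map_mul, map_mul, hzpow, map_zpow₀, map_add,
      ← IsScalarTower.algebraMap_apply, Valuation.map_add_eq_of_lt_left _ (by rwa [hc1]), hc1,
      mul_one]
  have hmem : ∀ x : F, x ≠ 0 → ∃ d : ℤ, ∀ R : CurvePoint F, R.IsPole y → (x ∈ R.ring ↔ d ≤ 0) := by
    intro x hx
    obtain ⟨a, b, hb, rfl⟩ := IsFractionRing.div_surjective (A := A) x
    have hb0 : b ≠ 0 := nonZeroDivisors.ne_zero hb
    have ha0 : a ≠ 0 := by rintro rfl; simp at hx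
    obtain ⟨d, hd⟩ := key a ha0
    obtain ⟨e, he⟩ := key b hb0
    refine ⟨d - e, fun R hR => ?_⟩
    have hy0 : y ≠ 0 := by simp [y]
    have hy1 : 1 < R.ring.valuation y := by
      rw [← not_le, ValuationSubring.valuation_le_one_iff]; exact hR
    rw [← ValuationSubring.valuation_le_one_iff, ← pow_le_one_iff (n := 3) (by norm_num), map_div₀,
      div_pow, hd R hR, he R hR, ← zpow_sub₀ (by simpa using hy0), ← zpow_zero (R.ring.valuation y),
      zpow_le_zpow_iff_right₀ hy1]
  apply CurvePoint.ext_ring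
  ext x
  rcases eq_or_ne x 0 with rfl | hx
  · simp only [zero_mem]
  obtain ⟨d, hd⟩ := hmem x hx
  rw [hd P hP, hd Q hQ]

end Fraction

/-! ### A domain with an involution that negates a unit -/

section Involution

variable {A : Type} [CommRing A] [Algebra ℂ A] {mu : A ≃ₐ[ℂ] A} {u : Aˣ}

lemma mem_fixedSubalgebra {a : A} : a ∈ fixedSubalgebra mu ↔ mu a = a := Iff.rfl

/-- The even part and the odd part of `x`; the odd part divided by `u` is even again. -/
lemma exists_eq_add_mul (hmu : mu u = -u) (hinv : ∀ a, mu (mu a) = a) (x : A) :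
    ∃ a b : fixedSubalgebra mu, x = a + b * u := by
  have hu' : mu ((u⁻¹ : Aˣ) : A) = -((u⁻¹ : Aˣ) : A) := by
    have h1 : mu (u : A) * mu ((u⁻¹ : Aˣ) : A) = 1 := by rw [← map_mul, Units.mul_inv, map_one]
    rw [hmu] at h1
    have h2 := congrArg (((u⁻¹ : Aˣ) : A) * ·) h1
    simp only [neg_mul, mul_neg, Units.inv_mul_cancel_left, mul_one] at h2
    exact neg_eq_iff_eq_neg.1 h2
  refine ⟨⟨(1 / 2 : ℂ) • (x + mu x), ?_⟩,
    ⟨(1 / 2 : ℂ) • (((u⁻¹ : Aˣ) : A) * (x - mu x)), ?_⟩, ?_⟩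
  · rw [mem_fixedSubalgebra, map_smul, map_add, hinv, add_comm]
  · rw [mem_fixedSubalgebra, map_smul, map_mul, map_sub, hinv, hu']
    congr 1
    ring
  · change x = (1 / 2 : ℂ) • (x + mu x) + (1 / 2 : ℂ) • (((u⁻¹ : Aˣ) : A) * (x - mu x)) * u
    have h1 : ((u⁻¹ : Aˣ) : A) * (x - mu x) * u = x - mu x := by
      rw [mul_right_comm, Units.inv_mul, one_mul]
    rw [smul_mul_assoc, h1, ← smul_add, add_add_sub_cancel, ← two_smul ℂ x, smul_smul]
    norm_num

lemma eq_zero_of_add_mul_eq_zero (hmu : mu u = -u) {a b : fixedSubalgebra mu}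
    (h : (a : A) + b * u = 0) : a = 0 ∧ b = 0 := by
  have h1 := congrArg mu h
  rw [map_add, map_mul, hmu, a.2, b.2, map_zero] at h1
  have ha : (a : A) = 0 := by
    have h2 : (2 : ℂ) • (a : A) = 0 := by rw [two_smul]; linear_combination h + h1
    exact (smul_eq_zero.1 h2).resolve_left two_ne_zero
  rw [ha, zero_add] at h
  have hb : (b : A) = 0 := by simpa using h
  exact ⟨Subtype.ext ha, Subtype.ext hb⟩

lemma isQuadraticExtension [IsDomain A] (hmu : mu u = -u) (hinv : ∀ a, mu (mu a) = a) :
    IsQuadraticExtension (fixedSubalgebra mu) (u : A) := by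
  set B := fixedSubalgebra mu
  have hq : mu ((u : A) ^ 2) = (u : A) ^ 2 := by rw [map_pow, hmu, neg_sq]
  let q : B := ⟨(u : A) ^ 2, hq⟩
  refine ⟨?_, q, rfl, ?_⟩
  · rw [eq_top_iff]
    intro x _
    obtain ⟨a, b, rfl⟩ := exists_eq_add_mul hmu hinv x
    exact add_mem (Subalgebra.algebraMap_mem _ a)
      (mul_mem (Subalgebra.algebraMap_mem _ b) (Algebra.self_mem_adjoin_singleton B (u : A)))
  have hroot : (X ^ 2 - C q : B[X]).eval₂ (algebraMap B A) (u : A) = 0 := by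
    rw [eval₂_sub, eval₂_pow, eval₂_X, eval₂_C]
    exact sub_self _
  let φ : AdjoinRoot (X ^ 2 - C q : B[X]) →ₐ[B] A :=
    AdjoinRoot.liftAlgHom _ (Algebra.ofId B A) (u : A) hroot
  have hφ : ∀ p : B[X], φ (AdjoinRoot.mk _ p) = aeval (u : A) p := fun p =>
    AdjoinRoot.liftAlgHom_mk _ _ _ hroot p
  have hmonic : (X ^ 2 - C q : B[X]).Monic := monic_X_pow_sub_C q two_ne_zero
  have hbij : Function.Bijective φ := by
    constructor
    · rw [injective_iff_map_eq_zero]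
      intro y hy
      obtain ⟨p, rfl⟩ := AdjoinRoot.mk_surjective y
      have h1 : AdjoinRoot.mk (X ^ 2 - C q : B[X]) p = AdjoinRoot.mk _ (p %ₘ (X ^ 2 - C q)) := by
        rw [← sub_eq_zero, ← map_sub, AdjoinRoot.mk_eq_zero]
        exact ⟨p /ₘ (X ^ 2 - C q), by
          linear_combination -(modByMonic_add_div p (X ^ 2 - C q))⟩
      rw [h1, hφ] at hy
      -- The remainder is linear, so its value at `u` is an even part plus an odd part, and both
      -- coefficients vanish.
      have hdeg : (p %ₘ (X ^ 2 - C q)).degree ≤ 1 := by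
        have h2 := degree_modByMonic_lt p hmonic
        rw [degree_X_pow_sub_C (by norm_num) q] at h2
        exact Order.le_of_lt_succ h2
      rw [eq_X_add_C_of_degree_le_one hdeg] at hy
      rw [map_add, map_mul, aeval_C, aeval_X, aeval_C, add_comm] at hy
      obtain ⟨h2, h3⟩ := eq_zero_of_add_mul_eq_zero hmu hy
      rw [h1, eq_X_add_C_of_degree_le_one hdeg, h2, h3]
      simp
    · intro x
      obtain ⟨a, b, rfl⟩ := exists_eq_add_mul hmu hinv x
      refine ⟨AdjoinRoot.mk _ (C a + C b * X), ?_⟩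
      rw [hφ, map_add, map_mul, aeval_C, aeval_C, aeval_X]
      rfl
  refine ⟨AlgEquiv.ofBijective φ hbij, ?_⟩
  change φ (AdjoinRoot.root _) = u
  rw [← AdjoinRoot.mk_X, hφ, aeval_X]

lemma fracMap_algebraMap {R S : Type} [CommRing R] [CommRing S] [IsDomain R] [IsDomain S]
    (φ : R →+* S) (hφ : Function.Injective φ) (r : R) :
    fracMap φ hφ (algebraMap R _ r) = algebraMap S _ (φ r) :=
  IsLocalization.map_eq (M := nonZeroDivisors R) (S := FractionRing R)
    (T := nonZeroDivisors S) (Q := FractionRing S) (g := φ)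
    (nonZeroDivisors_le_comap_nonZeroDivisors_of_injective φ hφ) r

/-- The curves of a domain with an involution `mu` and a unit `u` with `mu u = -u`, which has leading
terms both at its zeros and at its poles. -/
theorem exists_double_cover [IsDomain A] (hmu : mu u = -u) (hinv : ∀ a, mu (mu a) = a)
    (hu : HasLeadingTerms u) (hu' : HasLeadingTerms u⁻¹) (ht : Transcendental ℂ (u : A))
    {N : ℕ} (hN : ∀ a : Fin N → A, ∃ p : Fin N → ℂ[X], p ≠ 0 ∧
      ∑ i, aeval ((u : A) ^ 2) (p i) * a i = 0) :
    ∃ (δ : SmoothCompletion A → SmoothCompletion (fixedSubalgebra mu))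
        (P₀ Pinf : SmoothCompletion A) (μ : SmoothCompletion A → SmoothCompletion A),
      IsDoubleCover δ (inclFrac (fixedSubalgebra mu)) ∧
      P₀ ≠ Pinf ∧
      (∀ P, P.IsZero (algebraMap A _ (u : A)) ↔ P = P₀) ∧
      (∀ P, P.IsPole (algebraMap A _ (u : A)) ↔ P = Pinf) ∧
      (∀ P, P = P₀ ∨ P = Pinf → HasRamificationIndex δ (inclFrac (fixedSubalgebra mu)) P 2) ∧
      (∀ P, P ≠ P₀ → P ≠ Pinf → HasRamificationIndex δ (inclFrac (fixedSubalgebra mu)) P 1) ∧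
      IsDualTo μ (autFrac mu) ∧
      (∀ P, μ (μ P) = P) ∧
      (∀ P Q, δ P = δ Q ↔ Q = P ∨ Q = μ P) ∧
      (∀ P, μ P = P ↔ P = P₀ ∨ P = Pinf) ∧
      ∃ p : ℕ, HasGenus (FractionRing (fixedSubalgebra mu)) p ∧
        HasGenus (FractionRing A) (2 * p) := by
  set B := fixedSubalgebra mu
  set F := FractionRing A
  set E := FractionRing B
  have hinj : Function.Injective (algebraMap A F) := IsFractionRing.injective A F
  have hq : mu ((u : A) ^ 2) = (u : A) ^ 2 := by rw [map_pow, hmu, neg_sq]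
  let q : B := ⟨(u : A) ^ 2, hq⟩
  have htq : Transcendental ℂ ((u : A) ^ 2) := by
    intro h
    exact ht (h.of_pow two_pos)
  have htqB : Transcendental ℂ q := by
    intro h
    exact htq ((isAlgebraic_algHom_iff B.val Subtype.val_injective).2 h)
  have hF : IsFunctionField F := isFunctionField_fractionRing htq hN
  -- The relations have coefficients in `ℂ[u ^ 2]`, which lies in the fixed subalgebra; so the same
  -- relations serve `E` and `F`.
  have hE : IsFunctionField E := isFunctionField_fractionRing htqB (N := N) fun a => by
    obtain ⟨p, hp0, hp⟩ := hN fun i => a i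
    refine ⟨p, hp0, Subtype.ext ?_⟩
    change B.val _ = 0
    rw [map_sum, ← hp]
    refine Finset.sum_congr rfl fun i _ => ?_
    rw [map_mul, ← aeval_algHom_apply]
    rfl
  let alg : Algebra E F := (inclFrac B).toAlgebra
  have halg : ∀ b : B, algebraMap E F (algebraMap B E b) = algebraMap A F b := fun b =>
    fracMap_algebraMap B.val.toRingHom Subtype.val_injective b
  have htower : IsScalarTower ℂ E F := IsScalarTower.of_algebraMap_eq fun c => by
    rw [IsScalarTower.algebraMap_apply ℂ B E, halg, IsScalarTower.algebraMap_apply ℂ A F]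
    rfl
  set l : F := algebraMap A F u
  have hl0 : l ≠ 0 := by simp [l]
  have hlinv : l⁻¹ = algebraMap A F ((u⁻¹ : Aˣ) : A) := by
    apply inv_eq_of_mul_eq_one_right
    rw [← map_mul, Units.mul_inv, map_one]
  have haut : ∀ a : A, autFrac mu (algebraMap A F a) = algebraMap A F (mu a) := fun a =>
    fracMap_algebraMap mu.toRingEquiv.toRingHom mu.injective a
  have htl : Transcendental ℂ l := fun h => ht ((isAlgebraic_algebraMap_iff hinj).1 h)
  have hK : IsKummer l (algebraMap B E q) (autFrac mu) := by
    refine ⟨hl0, ?_, fun y => ?_, ?_, fun x => ?_⟩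
    · rw [halg, ← map_pow]
    · obtain ⟨a, b, hb, rfl⟩ := IsFractionRing.div_surjective (A := B) y
      rw [map_div₀, map_div₀, halg, halg, haut, haut, a.2, b.2]
    · rw [haut, hmu, map_neg]
    · obtain ⟨a, b, hb, rfl⟩ := IsFractionRing.div_surjective (A := A) x
      have hb0 : b ≠ 0 := nonZeroDivisors.ne_zero hb
      -- Multiplying numerator and denominator by `mu b` makes the denominator invariant.
      let n : B := ⟨b * mu b, by rw [mem_fixedSubalgebra, map_mul, hinv, mul_comm]⟩
      obtain ⟨a₀, a₁, h1⟩ := exists_eq_add_mul hmu hinv (a * mu b)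
      refine ⟨algebraMap B E a₀ / algebraMap B E n, algebraMap B E a₁ / algebraMap B E n, ?_⟩
      rw [map_div₀, map_div₀, halg, halg, halg]
      have hb1 : algebraMap A F b ≠ 0 := by rwa [ne_eq, map_eq_zero_iff _ hinj]
      have hb2 : algebraMap A F (mu b) ≠ 0 := by
        rw [ne_eq, map_eq_zero_iff _ hinj]; simpa using hb0
      have hn : algebraMap A F n = algebraMap A F b * algebraMap A F (mu b) := map_mul _ _ _
      have h2 := congrArg (algebraMap A F) h1
      rw [map_mul, map_add, map_mul] at h2
      rw [hn]
      rw [div_mul_eq_mul_div, ← add_div, div_eq_div_iff hb1 (mul_ne_zero hb1 hb2)]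
      linear_combination (algebraMap A F b) * h2
  obtain ⟨P₁, hP₁⟩ := exists_pole htl
  obtain ⟨P₀, hP₀⟩ := exists_pole (transcendental_inv htl)
  have hzero : ∀ P : CurvePoint F, P.IsZero l ↔ l⁻¹ ∉ P.ring := fun P => by
    rw [CurvePoint.IsZero, ValuationSubring.mem_nonunits_iff_or]
    simp [hl0]
  have h : IsTwoPointKummer l (algebraMap B E q) (autFrac mu) P₀ P₁ := by
    refine ⟨hK, fun P => ?_, fun P => ?_⟩
    · rw [hzero]
      refine ⟨fun hP => unique_pole hu' ?_ ?_, ?_⟩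
      · rw [← hlinv]; exact hP
      · rw [← hlinv]; exact hP₀
      · rintro rfl; exact hP₀
    · refine ⟨fun hP => unique_pole hu hP hP₁, ?_⟩
      rintro rfl; exact hP₁
  obtain ⟨δ, μ, h1, h2, h3, h4, h5, h6, h7, h8⟩ := h.exists_cover
  exact ⟨δ, P₀, P₁, μ, h1, h.ne, h.zero_iff, h.pole_iff, h2, h3, h4, h5, h6, h7, h8⟩

end Involution

/-! ### Calculus of Wirtinger derivatives -/

section Wirtinger

lemma fderiv_fderiv_apply {G : Type*} [NormedAddCommGroup G] [NormedSpace ℝ G] {f : ℂ → G} (hf : ContDiff ℝ ∞ f) (z v w : ℂ) :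
    fderiv ℝ (fun x => fderiv ℝ f x v) z w = fderiv ℝ (fderiv ℝ f) z w v := by
  have h : DifferentiableAt ℝ (fderiv ℝ f) z :=
    (hf.fderiv_right (m := ∞) (by simp)).differentiable (by simp) z
  rw [fderiv_clm_apply h (differentiableAt_const v)]
  simp

lemma fderiv_fderiv_comm {G : Type*} [NormedAddCommGroup G] [NormedSpace ℝ G] {f : ℂ → G} (hf : ContDiff ℝ ∞ f) (z v w : ℂ) :
    fderiv ℝ (fderiv ℝ f) z w v = fderiv ℝ (fderiv ℝ f) z v w :=
  (hf.contDiffAt.isSymmSndFDerivAt (by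
    simp only [minSmoothness_of_isRCLikeNormedField]; exact WithTop.coe_le_coe.2 le_top)).eq w v

variable {E : Type*} [NormedAddCommGroup E] [InnerProductSpace ℂ E] [NormedSpace ℝ E]

/-- The inner product is conjugate linear in the first variable, which turns `dz` into `dzbar`
there. -/
lemma dz_inner {a b : ℂ → E} {z : ℂ} (ha : DifferentiableAt ℝ a z)
    (hb : DifferentiableAt ℝ b z) :
    dz (fun w => inner ℂ (a w) (b w)) z =
      inner ℂ (dzbar a z) (b z) + inner ℂ (a z) (dz b z) := by
  simp only [dz, dzbar, fderiv_inner_apply ℂ ha hb, inner_smul_left, inner_smul_right,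
    inner_add_left, inner_sub_right, smul_eq_mul, map_div₀, map_one, map_ofNat, Complex.conj_I]
  ring

lemma dzbar_inner {a b : ℂ → E} {z : ℂ} (ha : DifferentiableAt ℝ a z)
    (hb : DifferentiableAt ℝ b z) :
    dzbar (fun w => inner ℂ (a w) (b w)) z =
      inner ℂ (dz a z) (b z) + inner ℂ (a z) (dzbar b z) := by
  simp only [dz, dzbar, fderiv_inner_apply ℂ ha hb, inner_smul_left, inner_smul_right,
    inner_add_right, inner_sub_left, smul_eq_mul, map_div₀, map_one, map_ofNat, Complex.conj_I]
  ring

lemma dz_neg (b : ℂ → E) (z : ℂ) : dz (fun w => -b w) z = -dz b z := by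
  simp only [dz, fderiv_fun_neg, neg_apply]
  module

lemma dzbar_neg (b : ℂ → E) (z : ℂ) : dzbar (fun w => -b w) z = -dzbar b z := by
  simp only [dzbar, fderiv_fun_neg, neg_apply]
  module

variable [IsScalarTower ℝ ℂ E]

lemma dz_smul {c : ℂ → ℂ} {b : ℂ → E} {z : ℂ} (hc : DifferentiableAt ℝ c z)
    (hb : DifferentiableAt ℝ b z) :
    dz (fun w => c w • b w) z = dz c z • b z + c z • dz b z := by
  simp only [dz, fderiv_fun_smul hc hb, add_apply, smul_apply, ContinuousLinearMap.smulRight_apply,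
    smul_eq_mul]
  module

lemma dzbar_smul {c : ℂ → ℂ} {b : ℂ → E} {z : ℂ} (hc : DifferentiableAt ℝ c z)
    (hb : DifferentiableAt ℝ b z) :
    dzbar (fun w => c w • b w) z = dzbar c z • b z + c z • dzbar b z := by
  simp only [dzbar, fderiv_fun_smul hc hb, add_apply, smul_apply,
    ContinuousLinearMap.smulRight_apply, smul_eq_mul]
  module

lemma contDiff_dz {f : ℂ → E} (hf : ContDiff ℝ ∞ f) : ContDiff ℝ ∞ (dz f) := by
  have h := fun v => (hf.fderiv_right (m := ∞) (by simp)).clm_apply (contDiff_const (c := v))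
  exact ((h 1).sub ((h Complex.I).const_smul Complex.I)).const_smul (1 / 2 : ℂ)

lemma contDiff_dzbar {f : ℂ → E} (hf : ContDiff ℝ ∞ f) : ContDiff ℝ ∞ (dzbar f) := by
  have h := fun v => (hf.fderiv_right (m := ∞) (by simp)).clm_apply (contDiff_const (c := v))
  exact ((h 1).add ((h Complex.I).const_smul Complex.I)).const_smul (1 / 2 : ℂ)

lemma dzbar_dz {f : ℂ → E} (hf : ContDiff ℝ ∞ f) (z : ℂ) : dzbar (dz f) z = dz (dzbar f) z := by
  have h := fun v => ((hf.fderiv_right (m := ∞) (by simp)).clm_apply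
    (contDiff_const (c := v))).differentiable (by simp) z
  have h1 : ∀ w, fderiv ℝ (dz f) z w = (1 / 2 : ℂ) • (fderiv ℝ (fderiv ℝ f) z w 1 -
      Complex.I • fderiv ℝ (fderiv ℝ f) z w Complex.I) := fun w => by
    unfold dz
    rw [fderiv_fun_const_smul ((h 1).fun_sub ((h Complex.I).fun_const_smul _)),
      fderiv_fun_sub (h 1) ((h Complex.I).fun_const_smul _), fderiv_fun_const_smul (h _)]
    simp [fderiv_fderiv_apply hf]
  have h2 : ∀ w, fderiv ℝ (dzbar f) z w = (1 / 2 : ℂ) • (fderiv ℝ (fderiv ℝ f) z w 1 +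
      Complex.I • fderiv ℝ (fderiv ℝ f) z w Complex.I) := fun w => by
    unfold dzbar
    rw [fderiv_fun_const_smul ((h 1).fun_add ((h Complex.I).fun_const_smul _)),
      fderiv_fun_add (h 1) ((h Complex.I).fun_const_smul _), fderiv_fun_const_smul (h _)]
    simp [fderiv_fderiv_apply hf]
  unfold dz dzbar at *
  rw [h1, h1, h2, h2, fderiv_fderiv_comm hf z 1 Complex.I]
  module

end Wirtinger

lemma dz_apply {b : ℂ → EuclideanSpace ℂ (Fin 3)} {z : ℂ} (hb : DifferentiableAt ℝ b z)
    (k : Fin 3) : dz (fun w => b w k) z = dz b z k := by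
  have h : ∀ v, fderiv ℝ (fun w => b w k) z v = fderiv ℝ b z v k := fun v => by
    have := ((EuclideanSpace.proj (𝕜 := ℂ) k).restrictScalars ℝ).hasFDerivAt.comp z hb.hasFDerivAt
    exact congrArg (fun L => L v) this.fderiv
  simp [dz, h]

lemma dzbar_apply {b : ℂ → EuclideanSpace ℂ (Fin 3)} {z : ℂ} (hb : DifferentiableAt ℝ b z)
    (k : Fin 3) : dzbar (fun w => b w k) z = dzbar b z k := by
  have h : ∀ v, fderiv ℝ (fun w => b w k) z v = fderiv ℝ b z v k := fun v => by
    have := ((EuclideanSpace.proj (𝕜 := ℂ) k).restrictScalars ℝ).hasFDerivAt.comp z hb.hasFDerivAt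
    exact congrArg (fun L => L v) this.fderiv
  simp [dzbar, h, mul_add]

/-! ### Inner products of the derivatives of the horizontal lift -/

namespace MinimalLagrangianTorus

variable (t : MinimalLagrangianTorus)

/-- `|f_z|`, as a complex valued function. -/
def speed (z : ℂ) : ℂ := ((‖dz t.f z‖ : ℝ) : ℂ)

lemma contDiff_dz_f : ContDiff ℝ ∞ (dz t.f) := contDiff_dz t.smooth

lemma contDiff_dzbar_f : ContDiff ℝ ∞ (dzbar t.f) := contDiff_dzbar t.smooth

lemma differentiableAt_f (z : ℂ) : DifferentiableAt ℝ t.f z := t.smooth.differentiable (by simp) z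

lemma differentiableAt_dz (z : ℂ) : DifferentiableAt ℝ (dz t.f) z :=
  t.contDiff_dz_f.differentiable (by simp) z

lemma differentiableAt_dzbar (z : ℂ) : DifferentiableAt ℝ (dzbar t.f) z :=
  t.contDiff_dzbar_f.differentiable (by simp) z

lemma inner_f_dz (z : ℂ) : inner ℂ (t.f z) (dz t.f z) = 0 := by
  simp [dz, t.horizontal]

lemma inner_f_dzbar (z : ℂ) : inner ℂ (t.f z) (dzbar t.f z) = 0 := by
  simp [dzbar, t.horizontal]

lemma inner_f_f (z : ℂ) : inner ℂ (t.f z) (t.f z) = 1 := by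
  rw [inner_self_eq_norm_sq_to_K, t.norm_eq_one]; simp

/-- The derivative of the horizontality condition. -/
lemma inner_fderiv_fderiv (z v w : ℂ) :
    inner ℂ (t.f z) (fderiv ℝ (fderiv ℝ t.f) z w v) +
      inner ℂ (fderiv ℝ t.f z w) (fderiv ℝ t.f z v) = 0 := by
  have hd : DifferentiableAt ℝ (fun x => fderiv ℝ t.f x v) z :=
    ((t.smooth.fderiv_right (m := ∞) (by simp)).clm_apply
      (contDiff_const (c := v))).differentiable (by simp) z
  have h := fderiv_inner_apply ℂ (t.differentiableAt_f z) hd w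
  rw [show (fun x => inner ℂ (t.f x) (fderiv ℝ t.f x v)) = fun _ => (0 : ℂ) from
    funext fun x => t.horizontal x v, fderiv_fderiv_apply t.smooth] at h
  simpa using h.symm

/-- This is where the Lagrangian condition enters: horizontality and the symmetry of second
derivatives make the product real, and conformality kills its real part. -/
lemma inner_fderiv_one_I (z : ℂ) :
    inner ℂ (fderiv ℝ t.f z 1) (fderiv ℝ t.f z Complex.I) = 0 := by
  have h1 := t.inner_fderiv_fderiv z Complex.I 1
  have h2 := t.inner_fderiv_fderiv z 1 Complex.I
  rw [fderiv_fderiv_comm t.smooth] at h1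
  have h3 : inner ℂ (fderiv ℝ t.f z 1) (fderiv ℝ t.f z Complex.I) =
      inner ℂ (fderiv ℝ t.f z Complex.I) (fderiv ℝ t.f z 1) := by linear_combination h1 - h2
  rw [← inner_conj_symm (fderiv ℝ t.f z Complex.I)] at h3
  apply Complex.ext
  · exact t.conformal_orth z
  · exact Complex.conj_eq_iff_im.1 h3.symm

lemma inner_fderiv_I_one (z : ℂ) :
    inner ℂ (fderiv ℝ t.f z Complex.I) (fderiv ℝ t.f z 1) = 0 := by
  rw [← inner_conj_symm, inner_fderiv_one_I, map_zero]

lemma inner_dz_dzbar (z : ℂ) : inner ℂ (dz t.f z) (dzbar t.f z) = 0 := by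
  simp only [dz, dzbar, inner_smul_left, inner_smul_right, inner_add_right, inner_sub_left,
    inner_fderiv_I_one, inner_fderiv_one_I, Complex.conj_I, map_div₀, map_one, map_ofNat]
  simp only [inner_self_eq_norm_sq_to_K, t.conformal_norm, Complex.coe_algebraMap]
  linear_combination (1 / 4 : ℂ) * (‖fderiv ℝ t.f z Complex.I‖ : ℂ) ^ 2 * Complex.I_sq

lemma inner_dz_dz (z : ℂ) :
    inner ℂ (dz t.f z) (dz t.f z) = 1 / 2 * ((‖fderiv ℝ t.f z 1‖ : ℝ) : ℂ) ^ 2 := by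
  simp only [dz, inner_smul_left, inner_smul_right, inner_sub_right, inner_sub_left,
    inner_fderiv_I_one, inner_fderiv_one_I, Complex.conj_I, map_div₀, map_one, map_ofNat]
  simp only [inner_self_eq_norm_sq_to_K, t.conformal_norm, Complex.coe_algebraMap]
  linear_combination (-1 / 4 : ℂ) * (‖fderiv ℝ t.f z Complex.I‖ : ℂ) ^ 2 * Complex.I_sq

lemma inner_dzbar_dzbar (z : ℂ) :
    inner ℂ (dzbar t.f z) (dzbar t.f z) = 1 / 2 * ((‖fderiv ℝ t.f z 1‖ : ℝ) : ℂ) ^ 2 := by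
  simp only [dzbar, inner_smul_left, inner_smul_right, inner_add_right, inner_add_left,
    inner_fderiv_I_one, inner_fderiv_one_I, Complex.conj_I, map_div₀, map_one, map_ofNat]
  simp only [inner_self_eq_norm_sq_to_K, t.conformal_norm, Complex.coe_algebraMap]
  linear_combination (-1 / 4 : ℂ) * (‖fderiv ℝ t.f z Complex.I‖ : ℂ) ^ 2 * Complex.I_sq

lemma norm_dzbar (z : ℂ) : ‖dzbar t.f z‖ = ‖dz t.f z‖ := by
  have h := (t.inner_dzbar_dzbar z).trans (t.inner_dz_dz z).symm
  rw [inner_self_eq_norm_sq_to_K, inner_self_eq_norm_sq_to_K] at h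
  have h' : ‖dzbar t.f z‖ ^ 2 = ‖dz t.f z‖ ^ 2 := by exact_mod_cast h
  exact (pow_left_inj₀ (norm_nonneg _) (norm_nonneg _) two_ne_zero).1 h'

lemma dz_ne_zero (z : ℂ) : dz t.f z ≠ 0 := by
  intro h
  have h1 := t.inner_dz_dz z
  rw [h, inner_zero_left] at h1
  have h2 : fderiv ℝ t.f z 1 = 0 := by simpa using h1.symm
  exact one_ne_zero (t.immersion z (h2.trans (map_zero _).symm))

lemma speed_ne_zero (z : ℂ) : t.speed z ≠ 0 := by
  simpa [speed] using t.dz_ne_zero z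

lemma conj_speed (z : ℂ) : (starRingEnd ℂ) (t.speed z) = t.speed z := Complex.conj_ofReal _

lemma inner_dz_self (z : ℂ) : inner ℂ (dz t.f z) (dz t.f z) = t.speed z ^ 2 :=
  inner_self_eq_norm_sq_to_K _

lemma inner_dzbar_self (z : ℂ) : inner ℂ (dzbar t.f z) (dzbar t.f z) = t.speed z ^ 2 := by
  rw [inner_self_eq_norm_sq_to_K, t.norm_dzbar]; rfl

lemma differentiableAt_speed (z : ℂ) : DifferentiableAt ℝ t.speed z :=
  Complex.ofRealCLM.differentiableAt.comp z ((t.differentiableAt_dz z).norm ℂ (t.dz_ne_zero z))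

lemma dzbar_dz_f (z : ℂ) : dzbar (dz t.f) z = -(t.speed z ^ 2) • t.f z := by
  rw [t.harmonic, t.norm_dzbar]
  congr 1
  simp only [speed]
  push_cast
  ring

lemma dz_dzbar_f (z : ℂ) : dz (dzbar t.f) z = -(t.speed z ^ 2) • t.f z := by
  rw [← dzbar_dz t.smooth, dzbar_dz_f]

lemma dz_fun_zero (z : ℂ) : dz (fun _ : ℂ => (0 : ℂ)) z = 0 := by simp [dz]

lemma dzbar_fun_zero (z : ℂ) : dzbar (fun _ : ℂ => (0 : ℂ)) z = 0 := by simp [dzbar]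

lemma inner_f_dz_dz (z : ℂ) : inner ℂ (t.f z) (dz (dz t.f) z) = 0 := by
  have h := dz_inner (t.differentiableAt_f z) (t.differentiableAt_dz z)
  rw [show (fun x => inner ℂ (t.f x) (dz t.f x)) = fun _ => (0 : ℂ) from funext t.inner_f_dz,
    dz_fun_zero, ← inner_conj_symm, t.inner_dz_dzbar] at h
  simpa using h.symm

lemma inner_f_dzbar_dzbar (z : ℂ) : inner ℂ (t.f z) (dzbar (dzbar t.f) z) = 0 := by
  have h := dzbar_inner (t.differentiableAt_f z) (t.differentiableAt_dzbar z)
  rw [show (fun x => inner ℂ (t.f x) (dzbar t.f x)) = fun _ => (0 : ℂ) from funext t.inner_f_dzbar,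
    dzbar_fun_zero, t.inner_dz_dzbar] at h
  simpa using h.symm

/-- Differentiate `⟨f, f_zz⟩ = 0`; the other term is the normalised Hopf differential. -/
lemma inner_dzbar_dz_dz (z : ℂ) : inner ℂ (dzbar t.f z) (dz (dz t.f) z) = -1 := by
  have h := dz_inner (t.differentiableAt_f z)
    ((contDiff_dz t.contDiff_dz_f).differentiable (by simp) z)
  rw [show (fun x => inner ℂ (t.f x) (dz (dz t.f) x)) = fun _ => (0 : ℂ) from
    funext t.inner_f_dz_dz, dz_fun_zero, t.hopf_eq_one] at h
  linear_combination -h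

lemma inner_dz_dzbar_dzbar (z : ℂ) : inner ℂ (dz t.f z) (dzbar (dzbar t.f) z) = 1 := by
  have h := dzbar_inner (t.differentiableAt_dz z) (t.differentiableAt_dzbar z)
  rw [show (fun x => inner ℂ (dz t.f x) (dzbar t.f x)) = fun _ => (0 : ℂ) from
    funext t.inner_dz_dzbar, dzbar_fun_zero, ← inner_conj_symm, t.inner_dzbar_dz_dz] at h
  simp at h
  linear_combination -h

lemma dz_speed_sq (z : ℂ) : dz (fun w => t.speed w ^ 2) z = 2 * t.speed z * dz t.speed z := by
  simp only [pow_two]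
  have h := dz_smul (t.differentiableAt_speed z) (t.differentiableAt_speed z)
  simp only [smul_eq_mul] at h
  rw [h]; ring

lemma dzbar_speed_sq (z : ℂ) :
    dzbar (fun w => t.speed w ^ 2) z = 2 * t.speed z * dzbar t.speed z := by
  simp only [pow_two]
  have h := dzbar_smul (t.differentiableAt_speed z) (t.differentiableAt_speed z)
  simp only [smul_eq_mul] at h
  rw [h]; ring

/-- Differentiate `|f_z|²`; the other term vanishes because `f_z̄z` is a multiple of `f`. -/
lemma inner_dz_dz_dz (z : ℂ) :
    inner ℂ (dz t.f z) (dz (dz t.f) z) = 2 * t.speed z * dz t.speed z := by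
  have h := dz_inner (t.differentiableAt_dz z) (t.differentiableAt_dz z)
  rw [show (fun x => inner ℂ (dz t.f x) (dz t.f x)) = fun w => t.speed w ^ 2 from
    funext t.inner_dz_self, t.dz_speed_sq, t.dzbar_dz_f, inner_smul_left, t.inner_f_dz] at h
  linear_combination -h

lemma inner_dzbar_dzbar_dzbar (z : ℂ) :
    inner ℂ (dzbar t.f z) (dzbar (dzbar t.f) z) = 2 * t.speed z * dzbar t.speed z := by
  have h := dzbar_inner (t.differentiableAt_dzbar z) (t.differentiableAt_dzbar z)
  rw [show (fun x => inner ℂ (dzbar t.f x) (dzbar t.f x)) = fun w => t.speed w ^ 2 from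
    funext t.inner_dzbar_self, t.dzbar_speed_sq, t.dz_dzbar_f, inner_smul_left, t.inner_f_dzbar] at h
  linear_combination -h

end MinimalLagrangianTorus

/-! ### The moving frame and the explicit connection form -/

/-- The `𝔭` component of the connection form in the direction `∂/∂z`, where `s = |f_z|`. -/
def cyc (s : ℂ) : Mat := !![0, 0, s; s, 0, 0; 0, (s⁻¹) ^ 2, 0]

/-- The matrix `diag(0, a, -a)`. -/
def torusK (a : ℂ) : Mat := Matrix.diagonal ![0, a, -a]

namespace MinimalLagrangianTorus

variable (t : MinimalLagrangianTorus)

/-- The columns of the frame. -/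
def col (j : Fin 3) : ℂ → EuclideanSpace ℂ (Fin 3) :=
  ![t.f, fun z => (t.speed z)⁻¹ • dz t.f z, fun z => -((t.speed z)⁻¹ • dzbar t.f z)] j

lemma frame_apply (z : ℂ) (i j : Fin 3) : frame t.f z i j = t.col j z i := by
  fin_cases j <;> simp [frame, col, speed, t.norm_dzbar]

lemma differentiableAt_inv_speed (z : ℂ) : DifferentiableAt ℝ (fun w => (t.speed w)⁻¹) z :=
  (t.differentiableAt_speed z).inv (t.speed_ne_zero z)

lemma differentiableAt_col (j : Fin 3) (z : ℂ) : DifferentiableAt ℝ (t.col j) z := by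
  fin_cases j
  · exact t.differentiableAt_f z
  · exact (t.differentiableAt_inv_speed z).smul (t.differentiableAt_dz z)
  · exact ((t.differentiableAt_inv_speed z).smul (t.differentiableAt_dzbar z)).neg

lemma dz_inv_speed (z : ℂ) :
    dz (fun w => (t.speed w)⁻¹) z = -dz t.speed z * (t.speed z)⁻¹ ^ 2 := by
  have h := dz_smul (t.differentiableAt_inv_speed z) (t.differentiableAt_speed z)
  have h0 := t.speed_ne_zero z
  rw [show (fun w => (t.speed w)⁻¹ • t.speed w) = fun _ => (1 : ℂ) from
    funext fun w => inv_mul_cancel₀ (t.speed_ne_zero w), show dz (fun _ : ℂ => (1 : ℂ)) z = 0 by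
    simp [dz]] at h
  simp only [smul_eq_mul] at h
  field_simp
  field_simp at h
  linear_combination -h

lemma dzbar_inv_speed (z : ℂ) :
    dzbar (fun w => (t.speed w)⁻¹) z = -dzbar t.speed z * (t.speed z)⁻¹ ^ 2 := by
  have h := dzbar_smul (t.differentiableAt_inv_speed z) (t.differentiableAt_speed z)
  have h0 := t.speed_ne_zero z
  rw [show (fun w => (t.speed w)⁻¹ • t.speed w) = fun _ => (1 : ℂ) from
    funext fun w => inv_mul_cancel₀ (t.speed_ne_zero w), show dzbar (fun _ : ℂ => (1 : ℂ)) z = 0 by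
    simp [dzbar]] at h
  simp only [smul_eq_mul] at h
  field_simp
  field_simp at h
  linear_combination -h

lemma inner_eq_sum (x y : EuclideanSpace ℂ (Fin 3)) :
    inner ℂ x y = ∑ k, star (x k) * y k := by
  rw [PiLp.inner_apply]
  exact Finset.sum_congr rfl fun k _ => mul_comm _ _

lemma inner_dz_f (z : ℂ) : inner ℂ (dz t.f z) (t.f z) = 0 := by
  rw [← inner_conj_symm, t.inner_f_dz, map_zero]

lemma inner_dzbar_f (z : ℂ) : inner ℂ (dzbar t.f z) (t.f z) = 0 := by
  rw [← inner_conj_symm, t.inner_f_dzbar, map_zero]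

lemma inner_dzbar_dz (z : ℂ) : inner ℂ (dzbar t.f z) (dz t.f z) = 0 := by
  rw [← inner_conj_symm, t.inner_dz_dzbar, map_zero]

lemma inner_col (i j : Fin 3) (z : ℂ) :
    inner ℂ (t.col i z) (t.col j z) = if i = j then 1 else 0 := by
  have h0 := t.speed_ne_zero z
  fin_cases i <;> fin_cases j <;>
    simp [-inner_self_eq_norm_sq_to_K, col, inner_smul_left, inner_smul_right, inner_f_f,
      inner_f_dz, inner_f_dzbar, inner_dz_f, inner_dzbar_f, inner_dz_dzbar, inner_dzbar_dz, inner_dz_self, inner_dzbar_self, conj_speed] <;>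
    field_simp

/-- The columns are orthonormal, so the entries of the connection form become inner products of
columns with derivatives of columns. -/
lemma inv_frame (z : ℂ) : (frame t.f z)⁻¹ = (frame t.f z).conjTranspose := by
  refine Matrix.inv_eq_left_inv (Matrix.ext fun i j => ?_)
  rw [Matrix.mul_apply, Matrix.one_apply, ← t.inner_col i j z, inner_eq_sum]
  simp [frame_apply]

lemma alphaZ_apply (z : ℂ) (i j : Fin 3) :
    alphaZ t z i j = inner ℂ (t.col i z) (dz (t.col j) z) := by
  rw [alphaZ, inv_frame, Matrix.mul_apply, inner_eq_sum]
  simp [frame_apply, dzMat, dz_apply (t.differentiableAt_col j z)]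

lemma alphaZbar_apply (z : ℂ) (i j : Fin 3) :
    alphaZbar t z i j = inner ℂ (t.col i z) (dzbar (t.col j) z) := by
  rw [alphaZbar, inv_frame, Matrix.mul_apply, inner_eq_sum]
  simp [frame_apply, dzbarMat, dzbar_apply (t.differentiableAt_col j z)]

lemma dz_col_one (z : ℂ) : dz (t.col 1) z =
    (-dz t.speed z * (t.speed z)⁻¹ ^ 2) • dz t.f z + (t.speed z)⁻¹ • dz (dz t.f) z := by
  rw [← dz_inv_speed]
  exact dz_smul (t.differentiableAt_inv_speed z) (t.differentiableAt_dz z)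

lemma dz_col_two (z : ℂ) : dz (t.col 2) z =
    -((-dz t.speed z * (t.speed z)⁻¹ ^ 2) • dzbar t.f z + (t.speed z)⁻¹ • dz (dzbar t.f) z) := by
  rw [← dz_inv_speed, ← dz_smul (t.differentiableAt_inv_speed z) (t.differentiableAt_dzbar z)]
  exact dz_neg _ z

lemma dzbar_col_one (z : ℂ) : dzbar (t.col 1) z =
    (-dzbar t.speed z * (t.speed z)⁻¹ ^ 2) • dz t.f z + (t.speed z)⁻¹ • dzbar (dz t.f) z := by
  rw [← dzbar_inv_speed]
  exact dzbar_smul (t.differentiableAt_inv_speed z) (t.differentiableAt_dz z)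

lemma dzbar_col_two (z : ℂ) : dzbar (t.col 2) z =
    -((-dzbar t.speed z * (t.speed z)⁻¹ ^ 2) • dzbar t.f z +
      (t.speed z)⁻¹ • dzbar (dzbar t.f) z) := by
  rw [← dzbar_inv_speed, ← dzbar_smul (t.differentiableAt_inv_speed z) (t.differentiableAt_dzbar z)]
  exact dzbar_neg _ z

/-- The logarithmic derivative of `|f_z|` in the direction `∂/∂z`. -/
def logDz (z : ℂ) : ℂ := dz t.speed z / t.speed z

/-- The logarithmic derivative of `|f_z|` in the direction `∂/∂z̄`. -/
def logDzbar (z : ℂ) : ℂ := dzbar t.speed z / t.speed z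

/-- The diagonal comes from the derivative of `|f_z|`, the entries `s` from harmonicity and
normalisation, and the entry `s⁻²` from the Hopf differential. -/
lemma alphaZ_eq (z : ℂ) : alphaZ t z = cyc (t.speed z) + torusK (t.logDz z) := by
  have h0 := t.speed_ne_zero z
  have e0 : t.col 0 = t.f := rfl
  have e1 : t.col 1 z = (t.speed z)⁻¹ • dz t.f z := rfl
  have e2 : t.col 2 z = -((t.speed z)⁻¹ • dzbar t.f z) := rfl
  ext i j
  rw [alphaZ_apply]
  fin_cases i <;> fin_cases j <;>
    simp [-inner_self_eq_norm_sq_to_K, e0, e1, e2,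
      dz_col_one, dz_col_two, dz_dzbar_f, inner_smul_left,
      inner_smul_right, inner_f_f, inner_f_dz, inner_f_dzbar, inner_dz_f, inner_dzbar_f,
      inner_dz_dzbar, inner_dzbar_dz, inner_dz_self, inner_dzbar_self, inner_f_dz_dz,
      inner_dzbar_dz_dz, inner_dz_dz_dz, conj_speed, cyc, torusK, logDz] <;>
    field_simp <;> ring

lemma alphaZbar_eq (z : ℂ) :
    alphaZbar t z = -(cyc (t.speed z)).transpose - torusK (t.logDzbar z) := by
  have h0 := t.speed_ne_zero z
  have e0 : t.col 0 = t.f := rfl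
  have e1 : t.col 1 z = (t.speed z)⁻¹ • dz t.f z := rfl
  have e2 : t.col 2 z = -((t.speed z)⁻¹ • dzbar t.f z) := rfl
  ext i j
  rw [alphaZbar_apply]
  fin_cases i <;> fin_cases j <;>
    simp [-inner_self_eq_norm_sq_to_K, e0, e1, e2,
      dzbar_col_one, dzbar_col_two, dzbar_dz_f,
      inner_smul_left, inner_smul_right, inner_f_f,
      inner_f_dz, inner_f_dzbar, inner_dz_f, inner_dzbar_f, inner_dz_dzbar, inner_dzbar_dz, inner_dz_self, inner_dzbar_self,
      inner_f_dzbar_dzbar, inner_dz_dzbar_dzbar, inner_dzbar_dzbar_dzbar, conj_speed, cyc, torusK,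
      logDzbar] <;>
    field_simp <;> ring

lemma alphaLoopZ_eq (ζ : Circle) (z : ℂ) :
    alphaLoopZ t ζ z = (ζ : ℂ) • cyc (t.speed z) + torusK (t.logDz z) := by
  have h : projK (alphaZ t z) = torusK (t.logDz z) := by
    rw [alphaZ_eq, projK, torusK]
    congr 1
    ext i
    fin_cases i <;> simp [cyc] <;> ring
  rw [alphaLoopZ, projP, h, alphaZ_eq, add_sub_cancel_right]

lemma alphaLoopZbar_eq (ζ : Circle) (z : ℂ) : alphaLoopZbar t ζ z =
    -torusK (t.logDzbar z) - (ζ : ℂ)⁻¹ • (cyc (t.speed z)).transpose := by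
  have h : projK (alphaZbar t z) = -torusK (t.logDzbar z) := by
    rw [alphaZbar_eq, projK, torusK, Matrix.diagonal_neg]
    congr 1
    ext i
    fin_cases i <;> simp [cyc] <;> ring
  rw [alphaLoopZbar, projP, h, alphaZbar_eq]
  simp [sub_eq_add_neg]

lemma conj_logDz (z : ℂ) : (starRingEnd ℂ) (t.logDz z) = t.logDzbar z := by
  have h : ∀ v, (starRingEnd ℂ) (fderiv ℝ t.speed z v) = fderiv ℝ t.speed z v := fun v => by
    have h1 := (Complex.ofRealCLM.hasFDerivAt.comp z
      ((t.differentiableAt_dz z).norm ℂ (t.dz_ne_zero z)).hasFDerivAt).fderiv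
    have h2 : fderiv ℝ t.speed z v = _ := congrArg (fun L => L v) h1
    rw [h2]
    exact Complex.conj_ofReal _
  have h2 : (starRingEnd ℂ) 2 = 2 := map_ofNat _ 2
  simp [logDz, logDzbar, dz, dzbar, conj_speed, h, h2]

end MinimalLagrangianTorus

/-! ### Laurent loops and their leading coefficients -/

/-- The loop `ζ^d I`. -/
def zetaPow (d : ℤ) : Loop := fun ζ _ => (ζ : ℂ) ^ d • (1 : Mat)

lemma zetaPow_mul_apply (d : ℤ) (ξ : Loop) (ζ : Circle) :
    (zetaPow d * ξ) ζ = (ζ : ℂ) ^ d • ξ ζ := by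
  funext z
  simp [zetaPow]

lemma zetaPow_add (d e : ℤ) : zetaPow (d + e) = zetaPow d * zetaPow e := by
  funext ζ z
  simp [zetaPow, zpow_add₀ (Circle.coe_ne_zero ζ), smul_smul, mul_comm]

lemma zetaPow_zero : zetaPow 0 = 1 := by
  funext ζ z
  simp [zetaPow]

lemma zetaPow_pow (d : ℤ) (n : ℕ) : zetaPow d ^ n = zetaPow (n * d) := by
  induction n with
  | zero => simp [zetaPow_zero]
  | succ n ih => rw [pow_succ, ih, ← zetaPow_add]; push_cast; ring_nf

lemma zetaPow_comm (d : ℤ) (ξ : Loop) : zetaPow d * ξ = ξ * zetaPow d := by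
  funext ζ z
  simp [zetaPow]

/-- The loop `Σ p_k ζ⁻ᵏ` of a polynomial `p`. -/
def evLoop : (ℂ → Mat)[X] →+* Loop :=
  eval₂RingHom' (Pi.constRingHom Circle (ℂ → Mat)) (zetaPow (-1)) fun _ =>
    (zetaPow_comm (-1) _).symm

lemma evLoop_C (X : ℂ → Mat) : evLoop (C X) = fun _ => X :=
  eval₂_C _ _

lemma evLoop_X : evLoop X = zetaPow (-1) :=
  eval₂_X _ _

lemma evLoop_apply (p : (ℂ → Mat)[X]) (ζ : Circle) {n : ℕ} (hn : p.natDegree < n) :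
    evLoop p ζ = ∑ k ∈ Finset.range n, (ζ : ℂ)⁻¹ ^ k • p.coeff k := by
  change eval₂ (Pi.constRingHom Circle (ℂ → Mat)) (zetaPow (-1)) p ζ = _
  rw [eval₂_eq_sum_range' _ hn, Finset.sum_apply]
  refine Finset.sum_congr rfl fun k _ => ?_
  funext z
  simp [zetaPow, _root_.smul_pow]

lemma infinite_circle : Infinite Circle := by
  have := (Set.Ioo_infinite (zero_lt_one' ℝ)).to_subtype
  refine Infinite.of_injective (fun x : Set.Ioo (0 : ℝ) 1 => Circle.exp x) fun x y h => ?_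
  have h2 : ∀ x : Set.Ioo (0 : ℝ) 1, (Circle.exp x : ℂ).arg = x := fun x =>
    Circle.arg_exp (by linarith [x.2.1, Real.pi_gt_three]) (by linarith [x.2.2, Real.pi_gt_three])
  exact Subtype.ext (by rw [← h2 x, ← h2 y]; exact congrArg (fun z : Circle => (z : ℂ).arg) h)

lemma exists_finset_circle (n : ℕ) : ∃ Z : Finset Circle, Z.card = n :=
  have := infinite_circle
  Infinite.exists_subset_card_eq Circle n

/-- If a polynomial takes values in a subspace at more points than its degree, then its
coefficients lie in the subspace. -/
lemma coeff_mem {V : Submodule ℂ (ℂ → Mat)} {p : (ℂ → Mat)[X]} {Z : Finset Circle}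
    (hZ : p.natDegree < Z.card) (h : ∀ ζ ∈ Z, evLoop p ζ ∈ V) (k : ℕ) : p.coeff k ∈ V := by
  rw [← Submodule.Quotient.mk_eq_zero, ← Module.forall_dual_apply_eq_zero_iff ℂ]
  intro φ
  -- A linear functional on the quotient by `V` reduces the claim to a scalar polynomial with more
  -- roots than its degree.
  let q : ℂ[X] := ∑ k ∈ Finset.range (p.natDegree + 1), monomial k (φ (V.mkQ (p.coeff k)))
  have hq : q = 0 := by
    refine eq_zero_of_natDegree_lt_card_of_eval_eq_zero' q
      (Z.image fun ζ : Circle => (ζ : ℂ)⁻¹) (fun x hx => ?_) ?_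
    · obtain ⟨ζ, hζ, rfl⟩ := Finset.mem_image.1 hx
      have h1 := h ζ hζ
      rw [evLoop_apply p ζ (Nat.lt_succ_self _), ← Submodule.ker_mkQ V, LinearMap.mem_ker] at h1
      have h2 := congrArg φ h1
      simp only [map_sum, map_smul, map_zero, smul_eq_mul] at h2
      simp only [q, eval_finsetSum, eval_monomial]
      rw [← h2]
      exact Finset.sum_congr rfl fun k _ => mul_comm _ _
    · rw [Finset.card_image_of_injective _ fun x y hxy => Circle.ext (inv_injective hxy)]
      refine lt_of_le_of_lt (natDegree_sum_le_of_forall_le _ _ fun k hk => ?_) hZ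
      exact (natDegree_monomial_le _).trans (by simpa [Nat.lt_succ_iff] using hk)
  have hc : q.coeff k = φ (V.mkQ (p.coeff k)) := by
    simp only [q, finsetSum_coeff, coeff_monomial, Finset.sum_ite_eq', Finset.mem_range]
    split_ifs with hk
    · rfl
    · rw [coeff_eq_zero_of_natDegree_lt (by omega), map_zero, map_zero]
  rw [hq, coeff_zero] at hc
  exact hc.symm

lemma evLoop_injective : Function.Injective evLoop := by
  rw [injective_iff_map_eq_zero]
  intro p hp
  obtain ⟨Z, hZ⟩ := exists_finset_circle (p.natDegree + 1)
  ext1 k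
  rw [coeff_zero]
  refine (Submodule.mem_bot ℂ).1 (coeff_mem (Z := Z) (by omega) (fun ζ _ => ?_) k)
  rw [hp]
  exact zero_mem _

/-- The loop `ξ` has degree at most `d`, and `X` is its coefficient at `ζ^d`. -/
def HasLead (ξ : Loop) (d : ℤ) (X : ℂ → Mat) : Prop :=
  ∃ p : (ℂ → Mat)[X], p.coeff 0 = X ∧ ξ = zetaPow d * evLoop p

variable {ξ η : Loop} {d e : ℤ} {X Y : ℂ → Mat}

lemma zetaPow_mul_left_cancel (h : zetaPow d * ξ = zetaPow d * η) : ξ = η := by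
  have := congrArg (zetaPow (-d) * ·) h
  simpa [← mul_assoc, ← zetaPow_add, zetaPow_zero] using this

lemma HasLead.unique (hX : HasLead ξ d X) (hY : HasLead ξ d Y) : X = Y := by
  obtain ⟨p, rfl, rfl⟩ := hX
  obtain ⟨q, rfl, h⟩ := hY
  rw [evLoop_injective (zetaPow_mul_left_cancel h)]

lemma HasLead.mul (hX : HasLead ξ d X) (hY : HasLead η e Y) : HasLead (ξ * η) (d + e) (X * Y) := by
  obtain ⟨p, rfl, rfl⟩ := hX
  obtain ⟨q, rfl, rfl⟩ := hY
  refine ⟨p * q, mul_coeff_zero _ _, ?_⟩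
  rw [zetaPow_add, map_mul, mul_assoc, mul_assoc, ← mul_assoc (evLoop p), ← zetaPow_comm,
    mul_assoc]

lemma HasLead.sub (hX : HasLead ξ d X) (hY : HasLead η d Y) : HasLead (ξ - η) d (X - Y) := by
  obtain ⟨p, rfl, rfl⟩ := hX
  obtain ⟨q, rfl, rfl⟩ := hY
  exact ⟨p - q, coeff_sub _ _ _, by rw [map_sub, mul_sub]⟩

lemma hasLead_zero (d : ℤ) : HasLead 0 d 0 := ⟨0, by simp, by simp⟩

lemma hasLead_zetaPow (d : ℤ) : HasLead (zetaPow d) d 1 := ⟨1, by simp, by simp⟩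

lemma HasLead.pow (hX : HasLead ξ d X) (n : ℕ) : HasLead (ξ ^ n) (n * d) (X ^ n) := by
  induction n with
  | zero => simpa [zetaPow_zero] using hasLead_zetaPow 0
  | succ n ih => simpa [pow_succ, add_mul] using ih.mul hX

lemma HasLead.sub_one (hX : HasLead ξ d 0) : ∃ Y, HasLead ξ (d - 1) Y := by
  obtain ⟨p, hp, rfl⟩ := hX
  refine ⟨_, p.divX, rfl, ?_⟩
  conv_lhs => rw [← divX_mul_X_add p, hp, C_0, add_zero, map_mul, evLoop_X, ← zetaPow_comm]
  rw [← mul_assoc, ← zetaPow_add, sub_eq_add_neg]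

lemma exists_eq_X_pow_mul {R : Type*} [Ring R] {p : R[X]} (hp : p ≠ 0) :
    ∃ (n : ℕ) (q : R[X]), p = Polynomial.X ^ n * q ∧ q.coeff 0 ≠ 0 := by
  induction h : p.natDegree using Nat.strong_induction_on generalizing p with
  | _ n ih =>
    by_cases h0 : p.coeff 0 = 0
    · have h1 : p = Polynomial.X * p.divX := by
        conv_lhs => rw [← X_mul_divX_add p, h0, C_0, add_zero]
      have h2 : p.divX ≠ 0 := by
        intro h2
        rw [h2, mul_zero] at h1
        exact hp h1
      have h3 : p.natDegree ≠ 0 := by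
        intro h3
        rw [eq_C_of_natDegree_eq_zero h3, h0, C_0] at hp
        exact hp rfl
      obtain ⟨m, q, h4, h5⟩ := ih p.divX.natDegree (by rw [natDegree_divX_eq_natDegree_tsub_one]; omega)
        h2 rfl
      exact ⟨m + 1, q, by rw [pow_succ', mul_assoc, ← h4, ← h1], h5⟩
    · exact ⟨0, p, by simp, h0⟩

lemma exists_hasLead_of_laurent {c : ℤ →₀ (ℂ → Mat)}
    (hc : ∀ ζ z, ξ ζ z = c.sum fun k X => (ζ : ℂ) ^ k • X z) : ∃ d X, HasLead ξ d X := by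
  have h : ξ = c.sum fun k X => zetaPow k * fun _ => X := by
    funext ζ z
    rw [hc, Finsupp.sum, Finsupp.sum, Finset.sum_apply, Finset.sum_apply]
    simp [zetaPow]
  rw [h]
  clear h hc
  induction c using Finsupp.induction_linear with
  | zero => exact ⟨0, 0, by simpa using hasLead_zero 0⟩
  | add c c' h h' =>
    rw [Finsupp.sum_add_index' (by intro a; funext ζ z; simp) (by
      intro a b b'; funext ζ z; simp [zetaPow])]
    obtain ⟨d, X, p, -, hp⟩ := h
    obtain ⟨d', X', p', -, hp'⟩ := h'
    -- Evaluation sends the variable to `ζ⁻¹`, so a power of it absorbs a larger leading exponent.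
    have key : ∀ (d d' : ℤ) (p : (ℂ → Mat)[X]), d ≤ d' →
        zetaPow d * evLoop p = zetaPow d' * evLoop (Polynomial.X ^ (d' - d).toNat * p) := by
      intro d d' p h
      rw [map_mul, map_pow, evLoop_X, ← mul_assoc]
      rw [zetaPow_pow, ← zetaPow_add]
      congr 2
      omega
    rw [hp, hp', key d (max d d') p (le_max_left _ _), key d' (max d d') p' (le_max_right _ _),
      ← mul_add, ← map_add]
    exact ⟨_, _, _, rfl, rfl⟩
  | single k X =>
    rw [Finsupp.sum_single_index (by funext ζ z; simp)]
    exact ⟨k, X, C X, by simp, by rw [evLoop_C]⟩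

lemma HasLead.exists_ne_zero (hX : HasLead ξ d X) (h0 : ξ ≠ 0) : ∃ d Y, Y ≠ 0 ∧ HasLead ξ d Y := by
  obtain ⟨p, -, rfl⟩ := hX
  have hp : p ≠ 0 := by rintro rfl; simp at h0
  obtain ⟨n, q, rfl, hq⟩ := exists_eq_X_pow_mul hp
  refine ⟨d - n, _, hq, q, rfl, ?_⟩
  rw [map_mul, map_pow, evLoop_X, zetaPow_pow, mul_neg_one, ← mul_assoc, ← zetaPow_add, sub_eq_add_neg]

/-! ### The Killing equations coefficient by coefficient -/

/-- The matrix valued functions with differentiable entries. -/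
def differentiableMat : Submodule ℂ (ℂ → Mat) where
  carrier := {g | ∀ i j, Differentiable ℝ fun z => g z i j}
  add_mem' := fun hg hh i j => (hg i j).add (hh i j)
  zero_mem' := fun _ _ => differentiable_const _
  smul_mem' := fun c _ hg _ _ => (hg _ _).const_smul c

lemma mul_mem_differentiableMat {g h : ℂ → Mat} (hg : g ∈ differentiableMat)
    (hh : h ∈ differentiableMat) : g * h ∈ differentiableMat := fun i j => by
  simp only [Pi.mul_apply, Matrix.mul_apply]
  exact Differentiable.fun_sum fun k _ => (hg i k).mul (hh k j)

lemma const_mem_differentiableMat (M : Mat) : (fun _ => M) ∈ differentiableMat :=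
  fun _ _ => differentiable_const _

lemma pow_mem_differentiableMat {g : ℂ → Mat} (hg : g ∈ differentiableMat) (n : ℕ) :
    g ^ n ∈ differentiableMat := by
  induction n with
  | zero => exact const_mem_differentiableMat 1
  | succ n ih => rw [pow_succ]; exact mul_mem_differentiableMat ih hg

/-- An operator which satisfies the rules of a derivation on the matrix valued functions with
differentiable entries. -/
structure IsDerivation (D : (ℂ → Mat) → ℂ → Mat) : Prop where
  map_add : ∀ g ∈ differentiableMat, ∀ h ∈ differentiableMat, D (g + h) = D g + D h
  map_mul : ∀ g ∈ differentiableMat, ∀ h ∈ differentiableMat, D (g * h) = g * D h + D g * h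
  map_const : ∀ M : Mat, D (fun _ => M) = 0

lemma isDerivation_dzMat : IsDerivation dzMat where
  map_add := fun _ hg _ hh => funext fun z => dzMat_add hg hh z
  map_mul := fun _ hg _ hh => funext fun z => dzMat_mul hg hh z
  map_const := fun M => funext fun z => dzMat_const M z

lemma isDerivation_dzbarMat : IsDerivation dzbarMat where
  map_add := fun _ hg _ hh => funext fun z => dzbarMat_add hg hh z
  map_mul := fun _ hg _ hh => funext fun z => dzbarMat_mul hg hh z
  map_const := fun M => funext fun z => dzbarMat_const M z

namespace IsDerivation

variable {D : (ℂ → Mat) → ℂ → Mat} (hD : IsDerivation D)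

include hD

lemma map_smul (c : ℂ) {g : ℂ → Mat} (hg : g ∈ differentiableMat) : D (c • g) = c • D g := by
  have h := hD.map_mul (fun _ => c • 1) (const_mem_differentiableMat _) g hg
  rw [hD.map_const, zero_mul, add_zero] at h
  have h1 : ∀ g : ℂ → Mat, ((fun _ => c • 1) * g : ℂ → Mat) = c • g := fun g => by
    funext z; simp
  rwa [h1, h1] at h

lemma map_zero : D 0 = 0 := hD.map_const 0

lemma map_sum {g : ℕ → ℂ → Mat} (hg : ∀ k, g k ∈ differentiableMat) (s : Finset ℕ) :
    D (∑ k ∈ s, g k) = ∑ k ∈ s, D (g k) := by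
  induction s using Finset.induction_on with
  | empty => simpa using hD.map_zero
  | insert a s ha ih =>
    rw [Finset.sum_insert ha, Finset.sum_insert ha,
      hD.map_add _ (hg a) _ (Submodule.sum_mem _ fun k _ => hg k), ih]

lemma map_pow_of_commutator {P K : ℂ → Mat} (hP : P ∈ differentiableMat) (h : D P = K * P - P * K)
    (n : ℕ) : D (P ^ n) = K * P ^ n - P ^ n * K := by
  induction n with
  | zero =>
    rw [pow_zero, mul_one, one_mul, sub_self]
    exact hD.map_const 1
  | succ n ih =>
    rw [pow_succ, hD.map_mul _ (pow_mem_differentiableMat hP n) _ hP, ih, h]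
    noncomm_ring

end IsDerivation

/-- The polynomial with coefficients `D p_k`. -/
def mapCoeff (D : (ℂ → Mat) → ℂ → Mat) (p : (ℂ → Mat)[X]) : (ℂ → Mat)[X] :=
  ∑ k ∈ Finset.range (p.natDegree + 1), monomial k (D (p.coeff k))

lemma coeff_mapCoeff {D : (ℂ → Mat) → ℂ → Mat} (hD : D 0 = 0) (p : (ℂ → Mat)[X]) (k : ℕ) :
    (mapCoeff D p).coeff k = D (p.coeff k) := by
  simp only [mapCoeff, finsetSum_coeff, coeff_monomial, Finset.sum_ite_eq', Finset.mem_range]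
  split_ifs with hk
  · rfl
  · rw [coeff_eq_zero_of_natDegree_lt (by omega), hD]

lemma natDegree_mapCoeff_lt (D : (ℂ → Mat) → ℂ → Mat) (p : (ℂ → Mat)[X]) :
    (mapCoeff D p).natDegree < p.natDegree + 1 := by
  refine Nat.lt_succ_of_le (natDegree_sum_le_of_forall_le _ _ fun k hk => ?_)
  exact (natDegree_monomial_le _).trans (by simpa [Nat.lt_succ_iff] using hk)

lemma IsDerivation.evLoop_mapCoeff {D : (ℂ → Mat) → ℂ → Mat} (hD : IsDerivation D)
    {p : (ℂ → Mat)[X]} (hp : ∀ k, p.coeff k ∈ differentiableMat) (d : ℤ) (ζ : Circle) :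
    (zetaPow d * evLoop (mapCoeff D p)) ζ = D ((zetaPow d * evLoop p) ζ) := by
  have h : ∀ k, (ζ : ℂ)⁻¹ ^ k • p.coeff k ∈ differentiableMat := fun k =>
    Submodule.smul_mem _ _ (hp k)
  rw [zetaPow_mul_apply, zetaPow_mul_apply, evLoop_apply _ ζ (natDegree_mapCoeff_lt D p),
    evLoop_apply p ζ (Nat.lt_succ_self _), hD.map_smul _ (Submodule.sum_mem _ fun k _ => h k),
    hD.map_sum h]
  congr 1
  refine Finset.sum_congr rfl fun k _ => ?_
  rw [coeff_mapCoeff hD.map_zero, hD.map_smul _ (hp k)]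

/-- The function `z ↦ α_𝔭(∂/∂z)`. -/
def torusP (t : MinimalLagrangianTorus) (z : ℂ) : Mat := cyc (t.speed z)

variable {t : MinimalLagrangianTorus} {ξ : Loop} {d : ℤ}

/-- Differentiability is given for each fixed `ζ`; interpolation at several values of `ζ` passes it
on to the coefficients. -/
lemma IsKilling.coeff_mem (h : IsKilling t ξ) {p : (ℂ → Mat)[X]} (hp : ξ = zetaPow d * evLoop p)
    (k : ℕ) : p.coeff k ∈ differentiableMat := by
  obtain ⟨Z, hZ⟩ := exists_finset_circle (p.natDegree + 1)
  refine MinLag.coeff_mem (Z := Z) (by omega) (fun ζ _ => ?_) k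
  have h1 : ξ ζ ∈ differentiableMat := h.differentiable ζ
  rw [hp, zetaPow_mul_apply] at h1
  have h2 := Submodule.smul_mem _ ((ζ : ℂ) ^ d)⁻¹ h1
  rwa [smul_smul, inv_mul_cancel₀ (zpow_ne_zero _ (Circle.coe_ne_zero ζ)), one_smul] at h2

lemma zetaPow_mul_commutator (d : ℤ) (ξ η : Loop) :
    zetaPow d * (ξ * η - η * ξ) = zetaPow d * ξ * η - η * (zetaPow d * ξ) := by
  rw [mul_sub, mul_assoc, ← mul_assoc _ η, zetaPow_comm d η, mul_assoc η]

/-- The factor `X`, standing for `ζ⁻¹`, clears the positive power of `ζ` in the connection, so that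
both sides are polynomials in `ζ⁻¹`. -/
lemma IsKilling.mapCoeff_dz (h : IsKilling t ξ) {p : (ℂ → Mat)[X]}
    (hp : ξ = zetaPow d * evLoop p) :
    Polynomial.X * mapCoeff dzMat p =
      p * (C (torusP t) + Polynomial.X * C fun z => torusK (t.logDz z)) -
        (C (torusP t) + Polynomial.X * C fun z => torusK (t.logDz z)) * p := by
  apply evLoop_injective
  apply zetaPow_mul_left_cancel (d := d)
  simp only [map_mul, map_sub, map_add, evLoop_X, evLoop_C]
  rw [zetaPow_mul_commutator, ← hp, ← mul_assoc, zetaPow_comm d, mul_assoc]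
  funext ζ z
  have h1 := h.eq_dz ζ z
  rw [t.alphaLoopZ_eq] at h1
  have h2 := congrFun (isDerivation_dzMat.evLoop_mapCoeff (h.coeff_mem hp) d ζ) z
  rw [← hp, h1] at h2
  have hζ := Circle.coe_ne_zero ζ
  rw [Pi.mul_apply, Pi.mul_apply, h2]
  simp [zetaPow, torusP, mul_add, add_mul, smul_smul, hζ, smul_sub]

lemma IsKilling.mapCoeff_dzbar (h : IsKilling t ξ) {p : (ℂ → Mat)[X]}
    (hp : ξ = zetaPow d * evLoop p) :
    mapCoeff dzbarMat p =
      p * (C (fun z => -torusK (t.logDzbar z)) +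
          Polynomial.X * C fun z => -(torusP t z).transpose) -
        (C (fun z => -torusK (t.logDzbar z)) +
          Polynomial.X * C fun z => -(torusP t z).transpose) * p := by
  apply evLoop_injective
  apply zetaPow_mul_left_cancel (d := d)
  simp only [map_mul, map_sub, map_add, evLoop_X, evLoop_C]
  rw [zetaPow_mul_commutator, ← hp]
  funext ζ z
  have h1 := h.eq_dzbar ζ z
  rw [t.alphaLoopZbar_eq] at h1
  have h2 := congrFun (isDerivation_dzbarMat.evLoop_mapCoeff (h.coeff_mem hp) d ζ) z
  rw [← hp, h1] at h2
  rw [h2]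
  simp [zetaPow, torusP, mul_add, add_mul, mul_sub, sub_mul]
  abel

lemma IsKilling.twisted_coeff_zero (h : IsKilling t ξ) {p : (ℂ → Mat)[X]}
    (hp : ξ = zetaPow d * evLoop p) (z : ℂ) :
    matS * p.coeff 0 z * matS⁻¹ = (eps : ℂ) ^ d • p.coeff 0 z := by
  let q : (ℂ → Mat)[X] := C (fun _ => matS) * p * C (fun _ => matS⁻¹)
  -- `r` is the polynomial of `ξ` evaluated at `εζ`, with the factor `ε ^ d` moved into the
  -- coefficients.
  let r : (ℂ → Mat)[X] := ∑ k ∈ Finset.range (p.natDegree + 1),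
    monomial k (((eps : ℂ) ^ d * (eps : ℂ)⁻¹ ^ k) • p.coeff k)
  have hr : ∀ ζ, evLoop r ζ = ∑ k ∈ Finset.range (p.natDegree + 1),
      (ζ : ℂ)⁻¹ ^ k • (((eps : ℂ) ^ d * (eps : ℂ)⁻¹ ^ k) • p.coeff k) := fun ζ => by
    have h1 : r.natDegree < p.natDegree + 1 := by
      refine Nat.lt_succ_of_le (natDegree_sum_le_of_forall_le _ _ fun k hk => ?_)
      exact (natDegree_monomial_le _).trans (by simpa [Nat.lt_succ_iff] using hk)
    rw [evLoop_apply _ ζ h1]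
    refine Finset.sum_congr rfl fun k hk => ?_
    simp only [r, finsetSum_coeff, coeff_monomial, Finset.sum_ite_eq', hk, if_true]
  have hqr : q = r := by
    apply evLoop_injective
    apply zetaPow_mul_left_cancel (d := d)
    funext ζ z
    have h1 := h.twisted ζ z
    rw [hp, zetaPow_mul_apply, zetaPow_mul_apply, evLoop_apply p (eps * ζ) (Nat.lt_succ_self _)] at h1
    rw [zetaPow_mul_apply, zetaPow_mul_apply, hr]
    simp only [q, map_mul, evLoop_C, Pi.mul_apply, Pi.smul_apply] at h1 ⊢
    rw [mul_smul_comm, smul_mul_assoc] at h1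
    rw [h1]
    simp only [Finset.sum_apply, Finset.smul_sum, Pi.smul_apply, smul_smul, Circle.coe_mul]
    refine Finset.sum_congr rfl fun k _ => ?_
    congr 1
    rw [mul_inv, mul_pow, mul_zpow]
    ring
  have h0 := congrFun (congrArg (fun p => Polynomial.coeff p 0) hqr) z
  have hr0 : r.coeff 0 = ((eps : ℂ) ^ d) • p.coeff 0 := by
    simp only [r, finsetSum_coeff, coeff_monomial, Finset.sum_ite_eq', Finset.mem_range]
    rw [if_pos (Nat.succ_pos _)]
    simp
  simp only [hr0] at h0
  rw [← Pi.smul_apply, ← h0]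
  simp [q]

/-- The differential equations for the leading coefficient of a Killing field. -/
lemma IsKilling.lead_eqs (h : IsKilling t ξ) {X : ℂ → Mat} (hX : HasLead ξ d X) :
    X ∈ differentiableMat ∧ X * torusP t = torusP t * X ∧
      (∃ Y, dzMat X = (Y * torusP t - torusP t * Y) +
        (X * (fun z => torusK (t.logDz z)) - (fun z => torusK (t.logDz z)) * X)) ∧
      dzbarMat X = (fun z => torusK (t.logDzbar z)) * X - X * (fun z => torusK (t.logDzbar z)) ∧
      ∀ z, matS * X z * matS⁻¹ = (eps : ℂ) ^ d • X z := by
  obtain ⟨p, rfl, hp⟩ := hX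
  have h1 := h.mapCoeff_dz hp
  have h2 := h.mapCoeff_dzbar hp
  refine ⟨h.coeff_mem hp 0, ?_, ⟨p.coeff 1, ?_⟩, ?_, h.twisted_coeff_zero hp⟩
  -- The coefficient at `ζ^(d+1)`: only the commutator of `X` with the cyclic matrix reaches it.
  · have h3 := congrArg (fun p => Polynomial.coeff p 0) h1
    simp only [coeff_sub, mul_coeff_zero, coeff_add, coeff_X_zero, zero_mul, coeff_C_zero,
      add_zero] at h3
    exact sub_eq_zero.1 h3.symm
  -- The coefficient at `ζ^d`, in which the next coefficient `p.coeff 1` of the field appears as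
  -- `Y`.
  · have h3 := congrArg (fun p => Polynomial.coeff p 1) h1
    simp only [coeff_sub, mul_add, add_mul, coeff_add, coeff_X_mul, coeff_mul_C, coeff_C_mul,
      mul_assoc, coeff_mapCoeff isDerivation_dzMat.map_zero] at h3
    have h4 : (p * (Polynomial.X * C fun z => torusK (t.logDz z))).coeff 1 =
        p.coeff 0 * fun z => torusK (t.logDz z) := by
      rw [← mul_assoc, ← X_mul, mul_assoc, coeff_X_mul, coeff_mul_C]
    rw [h3, h4]
    abel
  · have h3 := congrArg (fun p => Polynomial.coeff p 0) h2
    simp only [coeff_sub, mul_coeff_zero, coeff_add, coeff_X_zero, zero_mul, coeff_C_zero,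
      add_zero, coeff_mapCoeff isDerivation_dzbarMat.map_zero] at h3
    rw [h3]
    funext z
    simp [neg_add_eq_sub]

/-! ### The cyclic matrix and the form of the leading coefficient -/

lemma dz_trace {g : ℂ → Mat} (hg : g ∈ differentiableMat) (z : ℂ) :
    dz (fun w => (g w).trace) z = (dzMat g z).trace := by
  have h : ∀ v, fderiv ℝ (fun w => (g w).trace) z v = ∑ i, fderiv ℝ (fun w => g w i i) z v :=
    fun v => by
    simp only [Matrix.trace, Matrix.diag_apply]
    rw [fderiv_fun_sum fun i _ => hg i i z, sum_apply]
  rw [dz, h, h]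
  simp only [dz, dzMat, Matrix.trace, Matrix.diag_apply, Matrix.of_apply, Fin.sum_univ_three,
    smul_eq_mul]
  ring

lemma dzbar_trace {g : ℂ → Mat} (hg : g ∈ differentiableMat) (z : ℂ) :
    dzbar (fun w => (g w).trace) z = (dzbarMat g z).trace := by
  have h : ∀ v, fderiv ℝ (fun w => (g w).trace) z v = ∑ i, fderiv ℝ (fun w => g w i i) z v :=
    fun v => by
    simp only [Matrix.trace, Matrix.diag_apply]
    rw [fderiv_fun_sum fun i _ => hg i i z, sum_apply]
  rw [dzbar, h, h]
  simp only [dzbar, dzbarMat, Matrix.trace, Matrix.diag_apply, Matrix.of_apply,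
    Fin.sum_univ_three, smul_eq_mul]
  ring

lemma differentiable_trace {g : ℂ → Mat} (hg : g ∈ differentiableMat) :
    Differentiable ℝ fun z => (g z).trace := by
  simp only [Matrix.trace, Matrix.diag_apply]
  exact Differentiable.fun_sum fun i _ => hg i i

/-- A function whose two Wirtinger derivatives vanish is constant. -/
lemma eq_of_dz_eq_zero {g : ℂ → ℂ} (hg : Differentiable ℝ g) (h1 : ∀ z, dz g z = 0)
    (h2 : ∀ z, dzbar g z = 0) (z w : ℂ) : g z = g w := by
  refine is_const_of_fderiv_eq_zero (𝕜 := ℝ) hg (fun x => ?_) z w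
  have h3 := h1 x
  have h4 := h2 x
  simp only [dz, dzbar, smul_eq_mul] at h3 h4
  have h5 : fderiv ℝ g x 1 = 0 := by linear_combination h3 + h4
  have h6 : fderiv ℝ g x Complex.I = 0 := by
    linear_combination Complex.I * (h3 - h4) + fderiv ℝ g x Complex.I * Complex.I_sq
  ext v
  have h7 : v = v.re • (1 : ℂ) + v.im • Complex.I := by
    conv_lhs => rw [← Complex.re_add_im v]
    simp
  rw [h7, map_add, map_smul, map_smul, h5, h6]
  simp

/-- A weighted cyclic permutation whose weights `s`, `s`, `s⁻²` have product `1`. -/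
lemma cyc_pow_three {s : ℂ} (hs : s ≠ 0) : cyc s ^ 3 = 1 := by
  rw [pow_succ, pow_two]
  ext i j
  fin_cases i <;> fin_cases j <;>
    simp [cyc, Matrix.mul_apply, Fin.sum_univ_three]
  all_goals field_simp

lemma eps_pow_three_coe : (eps : ℂ) ^ 3 = 1 := by
  rw [← Circle.coe_pow, eps_pow_three, Circle.coe_one]

lemma eps_ne_one : (eps : ℂ) ≠ 1 := by
  intro h
  have h1 : (eps : ℂ).arg = 2 * Real.pi / 3 := by
    rw [eps]
    exact Circle.arg_exp (by linarith [Real.pi_pos]) (by linarith [Real.pi_pos])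
  rw [h, Complex.arg_one] at h1
  linarith [Real.pi_pos]

lemma eps_sq_ne_one : (eps : ℂ) ^ 2 ≠ 1 := by
  intro h
  have h1 := eps_pow_three_coe
  rw [pow_succ, h, one_mul] at h1
  exact eps_ne_one h1

lemma matS_mul_cyc (s : ℂ) : matS * cyc s = (eps : ℂ) • (cyc s * matS) := by
  have h := eps_pow_three_coe
  ext i j
  rw [matS, Matrix.smul_apply, Matrix.diagonal_mul, Matrix.mul_diagonal]
  fin_cases i <;> fin_cases j <;> simp [cyc]
  · linear_combination -s * h
  · ring

lemma matS_mul_cyc_pow (s : ℂ) (n : ℕ) :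
    matS * cyc s ^ n = (eps : ℂ) ^ n • (cyc s ^ n * matS) := by
  induction n with
  | zero => simp
  | succ n ih =>
    rw [pow_succ, ← mul_assoc, ih, smul_mul_assoc, mul_assoc, matS_mul_cyc, mul_smul_comm,
      smul_smul, mul_assoc, ← pow_succ]

/-- A matrix which commutes with `S` and with the cyclic matrix is scalar. -/
lemma eq_smul_one_of_commute {s : ℂ} (hs : s ≠ 0) {Y : Mat} (h1 : matS * Y = Y * matS)
    (h2 : cyc s * Y = Y * cyc s) : Y = Y 0 0 • (1 : Mat) := by
  have e1 := eps_ne_one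
  have e2 := eps_sq_ne_one
  have e0 := Circle.coe_ne_zero eps
  have hd : ∀ i j, i ≠ j → Y i j = 0 := by
    intro i j hij
    have h3 := congrFun (congrFun h1 i) j
    rw [matS, Matrix.diagonal_mul, Matrix.mul_diagonal, mul_comm, ← sub_eq_zero, ← mul_sub] at h3
    refine (mul_eq_zero.1 h3).resolve_right (sub_ne_zero.2 ?_)
    fin_cases i <;> fin_cases j <;> simp_all [pow_two, eq_comm]
  have h01 := congrFun (congrFun h2 1) 0
  have h21 := congrFun (congrFun h2 2) 1
  simp [cyc, Matrix.mul_apply, Fin.sum_univ_three, hd, hs, mul_comm] at h01 h21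
  ext i j
  fin_cases i <;> fin_cases j <;> simp [hd]
  · exact h01.symm
  · exact (h01.trans h21).symm

/-- A matrix which commutes with the cyclic matrix and is an eigenvector of `Ad S` is a multiple of a
power of the cyclic matrix. -/
lemma eq_smul_cyc_pow {s : ℂ} (hs : s ≠ 0) {X : Mat} (h1 : X * cyc s = cyc s * X) {n : ℕ}
    (h2 : matS * X * matS⁻¹ = (eps : ℂ) ^ n • X) :
    X = (1 / 3 * (X * cyc s ^ (2 * n)).trace) • cyc s ^ n := by
  have h3 : matS * X = (eps : ℂ) ^ n • (X * matS) := by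
    rw [← smul_mul_assoc, ← h2, mul_assoc _ matS⁻¹, matS_inv_mul, mul_one]
  have hc : ∀ m, X * cyc s ^ m = cyc s ^ m * X := fun m => (Commute.pow_right h1 m).eq
  -- The exponent `2 n` complements `n` to a multiple of `3`, so the eigenvalues under `Ad S` cancel
  -- and the product is scalar.
  have h4 := eq_smul_one_of_commute hs (Y := X * cyc s ^ (2 * n)) (by
    rw [← mul_assoc, h3, smul_mul_assoc, mul_assoc, matS_mul_cyc_pow, mul_smul_comm, smul_smul,
      ← pow_add, ← mul_assoc, show n + 2 * n = 3 * n by ring, pow_mul, eps_pow_three_coe, one_pow,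
      one_smul]) (by rw [← mul_assoc, ← h1, mul_assoc, mul_assoc, ← pow_succ', ← pow_succ])
  have h5 : (X * cyc s ^ (2 * n)).trace = 3 * (X * cyc s ^ (2 * n)) 0 0 := by
    conv_lhs => rw [h4]
    simp [mul_comm]
  have h6 : X = X * cyc s ^ (2 * n) * cyc s ^ n := by
    rw [mul_assoc, ← pow_add, show 2 * n + n = 3 * n by ring, pow_mul, cyc_pow_three hs, one_pow,
      mul_one]
  conv_lhs => rw [h6, h4, smul_mul_assoc, one_mul]
  rw [h5]
  congr 1
  ring

lemma trace_cyc_pow {s : ℂ} (hs : s ≠ 0) {n : ℕ} (hn : 3 ∣ n) : (cyc s ^ n).trace = 3 := by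
  obtain ⟨m, rfl⟩ := hn
  rw [pow_mul, cyc_pow_three hs, one_pow]
  simp

lemma cyc_pow_ne_zero {s : ℂ} (hs : s ≠ 0) (n : ℕ) : cyc s ^ n ≠ 0 := by
  intro h
  have h1 : cyc s ^ (3 * n) = 0 := by rw [mul_comm, pow_mul, h]; simp
  rw [pow_mul, cyc_pow_three hs, one_pow] at h1
  exact one_ne_zero h1

variable (t : MinimalLagrangianTorus)

lemma torusP_mem : torusP t ∈ differentiableMat := fun i j z => by
  have h1 := t.differentiableAt_speed z
  have h2 := t.differentiableAt_inv_speed z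
  have h3 : DifferentiableAt ℝ (fun w => (t.speed w)⁻¹ ^ 2) z := by
    simp only [pow_two]; exact h2.mul h2
  have h4 : DifferentiableAt ℝ (fun _ : ℂ => (0 : ℂ)) z := differentiableAt_const _
  fin_cases i <;> fin_cases j <;> assumption

lemma dz_inv_speed_sq (z : ℂ) :
    dz (fun w => (t.speed w)⁻¹ ^ 2) z = -2 * t.logDz z * (t.speed z)⁻¹ ^ 2 := by
  have h := dz_smul (t.differentiableAt_inv_speed z) (t.differentiableAt_inv_speed z)
  have h0 := t.speed_ne_zero z
  simp only [smul_eq_mul, ← pow_two] at h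
  rw [h, t.dz_inv_speed, MinimalLagrangianTorus.logDz]
  field_simp
  ring

lemma dzbar_inv_speed_sq (z : ℂ) :
    dzbar (fun w => (t.speed w)⁻¹ ^ 2) z = -2 * t.logDzbar z * (t.speed z)⁻¹ ^ 2 := by
  have h := dzbar_smul (t.differentiableAt_inv_speed z) (t.differentiableAt_inv_speed z)
  have h0 := t.speed_ne_zero z
  simp only [smul_eq_mul, ← pow_two] at h
  rw [h, t.dzbar_inv_speed, MinimalLagrangianTorus.logDzbar]
  field_simp
  ring

/-- The diagonal part of the connection scales the entries `s` and `s⁻²` exactly as differentiation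
does. With this, diagonal terms cancel when the leading factor is differentiated. -/
lemma dzMat_torusP : dzMat (torusP t) =
    (fun z => torusK (t.logDz z)) * torusP t - torusP t * fun z => torusK (t.logDz z) := by
  funext z
  have h0 := t.speed_ne_zero z
  have h1 : dz t.speed z = t.logDz z * t.speed z := (div_mul_cancel₀ _ h0).symm
  have h2 := dz_inv_speed_sq t z
  have h3 := MinimalLagrangianTorus.dz_fun_zero z
  ext i j
  simp only [dzMat, torusP, Matrix.of_apply, Pi.sub_apply, Pi.mul_apply, Matrix.sub_apply, torusK,
    Matrix.diagonal_mul, Matrix.mul_diagonal]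
  fin_cases i <;> fin_cases j <;> simp [cyc] <;> simp only [inv_pow] at h2
  all_goals first | assumption | (rw [h1]; ring) | (rw [h2]; ring)

lemma dzbarMat_torusP : dzbarMat (torusP t) =
    (fun z => torusK (t.logDzbar z)) * torusP t - torusP t * fun z => torusK (t.logDzbar z) := by
  funext z
  have h0 := t.speed_ne_zero z
  have h1 : dzbar t.speed z = t.logDzbar z * t.speed z := (div_mul_cancel₀ _ h0).symm
  have h2 := dzbar_inv_speed_sq t z
  have h3 := MinimalLagrangianTorus.dzbar_fun_zero z
  ext i j
  simp only [dzbarMat, torusP, Matrix.of_apply, Pi.sub_apply, Pi.mul_apply, Matrix.sub_apply,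
    torusK, Matrix.diagonal_mul, Matrix.mul_diagonal]
  fin_cases i <;> fin_cases j <;> simp [cyc] <;> simp only [inv_pow] at h2
  all_goals first | assumption | (rw [h1]; ring) | (rw [h2]; ring)

variable {t} {ξ : Loop} {d : ℤ} {X : ℂ → Mat}

/-- The leading coefficient of a Killing field of degree `d` is a constant multiple of a power of
`α_𝔭(∂/∂z)`. -/
theorem IsKilling.exists_lead_eq (h : IsKilling t ξ) (hX : HasLead ξ d X) :
    ∃ (n : ℕ) (c : ℂ), (n : ℤ) ≡ d [ZMOD 3] ∧ X = c • torusP t ^ n := by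
  obtain ⟨hd, h1, ⟨Y, h2⟩, h3, h4⟩ := h.lead_eqs hX
  obtain ⟨n, hn⟩ : ∃ n : ℕ, (n : ℤ) = d % 3 :=
    ⟨(d % 3).toNat, Int.toNat_of_nonneg (Int.emod_nonneg _ (by norm_num))⟩
  have heps : (eps : ℂ) ^ d = (eps : ℂ) ^ n := by
    rw [← Int.emod_add_mul_ediv d 3, ← hn, zpow_add₀ (Circle.coe_ne_zero _), zpow_mul]
    norm_cast
    rw [eps_pow_three]
    simp
  -- The factor of `torusP t ^ n` in `X`, written as a trace so that its derivatives can be computed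
  -- without dividing matrices.
  let τ : ℂ → ℂ := fun z => 1 / 3 * ((X * torusP t ^ (2 * n)) z).trace
  have hP := torusP_mem t
  have hPn := pow_mem_differentiableMat hP (2 * n)
  have hXP := mul_mem_differentiableMat hd hPn
  have e1 : ∀ z, X z = τ z • torusP t z ^ n := fun z => by
    have := h4 z
    rw [heps] at this
    exact eq_smul_cyc_pow (t.speed_ne_zero z) (congrFun h1 z) this
  have hP3 : ∀ z, torusP t z ^ n * torusP t z ^ (2 * n) = 1 := fun z => by
    rw [← pow_add, show n + 2 * n = 3 * n by ring, pow_mul, torusP, cyc_pow_three (t.speed_ne_zero z),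
      one_pow]
  have hP3' : ∀ z, torusP t z ^ (2 * n) * torusP t z ^ n = 1 := fun z => by
    rw [← pow_add, show 2 * n + n = 3 * n by ring, pow_mul, torusP, cyc_pow_three (t.speed_ne_zero z),
      one_pow]
  have hτ : Differentiable ℝ τ := (differentiable_trace hXP).const_mul _
  have hdz : ∀ z, dz τ z = 0 := fun z => by
    have e2 : dz τ z = 1 / 3 * dz (fun w => ((X * torusP t ^ (2 * n)) w).trace) z := by
      have := dz_smul (differentiableAt_const (1 / 3 : ℂ)) (differentiable_trace hXP z)
      simpa [τ, dz] using this
    rw [e2, dz_trace hXP, isDerivation_dzMat.map_mul _ hd _ hPn,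
      isDerivation_dzMat.map_pow_of_commutator hP (dzMat_torusP t), h2]
    simp only [Pi.add_apply, Pi.sub_apply, Pi.mul_apply, Pi.pow_apply, Matrix.trace_add,
      mul_sub, add_mul, sub_mul, Matrix.trace_sub]
    have e3 : ∀ K : Mat, (X z * (K * torusP t z ^ (2 * n))).trace = τ z * K.trace := fun K => by
      rw [e1, smul_mul_assoc, Matrix.trace_smul, ← mul_assoc, Matrix.trace_mul_comm, ← mul_assoc,
        hP3', one_mul, smul_eq_mul]
    have e4 : ∀ K : Mat, (X z * (torusP t z ^ (2 * n) * K)).trace = τ z * K.trace := fun K => by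
      rw [e1, smul_mul_assoc, Matrix.trace_smul, ← mul_assoc, hP3, one_mul, smul_eq_mul]
    have e5 : ∀ K : Mat, (K * X z * torusP t z ^ (2 * n)).trace = τ z * K.trace := fun K => by
      rw [e1, mul_smul_comm, smul_mul_assoc, Matrix.trace_smul, mul_assoc, hP3, mul_one,
        smul_eq_mul]
    -- The unknown next coefficient `Y` drops out: a commutator with `torusP t` times one of its
    -- powers has trace zero.
    have e6 : (Y z * torusP t z * torusP t z ^ (2 * n)).trace =
        (torusP t z * Y z * torusP t z ^ (2 * n)).trace := by
      rw [mul_assoc, mul_assoc, Matrix.trace_mul_comm (torusP t z), mul_assoc, ← pow_succ,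
        ← pow_succ']
    rw [e3, e4, e5, e6, mul_assoc (X z), e3]
    ring
  have hdzbar : ∀ z, dzbar τ z = 0 := fun z => by
    have e2 : dzbar τ z = 1 / 3 * dzbar (fun w => ((X * torusP t ^ (2 * n)) w).trace) z := by
      have := dzbar_smul (differentiableAt_const (1 / 3 : ℂ)) (differentiable_trace hXP z)
      simpa [τ, dzbar] using this
    rw [e2, dzbar_trace hXP, isDerivation_dzbarMat.map_mul _ hd _ hPn,
      isDerivation_dzbarMat.map_pow_of_commutator hP (dzbarMat_torusP t), h3]
    simp only [Pi.add_apply, Pi.sub_apply, Pi.mul_apply, Pi.pow_apply, Matrix.trace_add,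
      mul_sub, sub_mul, Matrix.trace_sub]
    rw [← mul_assoc (X z) (torusP t z ^ (2 * n)), Matrix.trace_mul_comm (X z * _), ← mul_assoc,
      ← mul_assoc]
    ring
  refine ⟨n, τ 0, ?_, ?_⟩
  · rw [hn]; exact Int.mod_modEq d 3
  · funext z
    rw [e1, eq_of_dz_eq_zero hτ hdz hdzbar z 0]
    rfl

/-! ### Products of leading coefficients; no zero divisors -/

variable {t : MinimalLagrangianTorus} {ξ η : Loop} {d e : ℤ} {X Y : ℂ → Mat}

lemma IsKilling.exists_lead (h : IsKilling t ξ) (h0 : ξ ≠ 0) :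
    ∃ (d : ℤ) (n : ℕ) (c : ℂ), c ≠ 0 ∧ (n : ℤ) ≡ d [ZMOD 3] ∧ HasLead ξ d (c • torusP t ^ n) := by
  obtain ⟨c, hc⟩ := h.laurent
  obtain ⟨d, X, hX⟩ := exists_hasLead_of_laurent hc
  obtain ⟨d, X, hX0, hX⟩ := hX.exists_ne_zero h0
  obtain ⟨n, c, hn, rfl⟩ := h.exists_lead_eq hX
  refine ⟨d, n, c, ?_, hn, hX⟩
  rintro rfl
  exact hX0 (zero_smul _ _)

lemma smul_torusP_pow_mul (c c' : ℂ) (n m : ℕ) :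
    (c • torusP t ^ n) * (c' • torusP t ^ m) = (c * c') • torusP t ^ (n + m) := by
  rw [smul_mul_smul_comm, pow_add]

lemma smul_torusP_pow_pow (c : ℂ) (n j : ℕ) :
    (c • torusP t ^ n) ^ j = c ^ j • torusP t ^ (n * j) := by
  rw [_root_.smul_pow, pow_mul]

lemma smul_torusP_pow_ne_zero {c : ℂ} (hc : c ≠ 0) (n : ℕ) : c • torusP t ^ n ≠ 0 := by
  intro h
  have h1 := congrFun h 0
  exact cyc_pow_ne_zero (t.speed_ne_zero 0) n ((smul_eq_zero.1 h1).resolve_left hc)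

lemma torusP_pow_three_mul (n : ℕ) : torusP t ^ (3 * n) = 1 := by
  funext z
  rw [pow_mul, Pi.pow_apply, Pi.pow_apply, torusP, cyc_pow_three (t.speed_ne_zero z), one_pow]
  rfl

/-- Leading coefficients multiply, and non-zero multiples of powers of an invertible matrix have
non-zero products. -/
lemma IsKilling.mul_ne_zero (hξ : IsKilling t ξ) (hη : IsKilling t η) (h1 : ξ ≠ 0) (h2 : η ≠ 0) :
    ξ * η ≠ 0 := by
  intro h
  obtain ⟨d, n, c, hc, -, hl⟩ := hξ.exists_lead h1
  obtain ⟨d', n', c', hc', -, hl'⟩ := hη.exists_lead h2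
  have h3 := hl.mul hl'
  rw [h, smul_torusP_pow_mul] at h3
  exact smul_torusP_pow_ne_zero (_root_.mul_ne_zero hc hc') _ (h3.unique (hasLead_zero _))

lemma exists_laurent_of_sum {c : ℤ →₀ (ℂ → Mat)} (g : ℤ → (ℂ → Mat) → ℂ → Mat)
    (h : ∀ ζ z, ξ ζ z = c.sum fun k X => (ζ : ℂ) ^ k • g k X z) :
    ∃ c : ℤ →₀ (ℂ → Mat), ∀ ζ z, ξ ζ z = c.sum fun k X => (ζ : ℂ) ^ k • X z := by
  refine ⟨c.sum fun k X => Finsupp.single k (g k X), fun ζ z => ?_⟩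
  rw [h, Finsupp.sum_sum_index (by simp) (by intros; simp)]
  refine Finset.sum_congr rfl fun k _ => ?_
  beta_reduce
  rw [Finsupp.sum_single_index (by simp)]

lemma isKilling_zetaPow (t : MinimalLagrangianTorus) (e : ℤ) : IsKilling t (zetaPow (3 * e)) where
  laurent := ⟨Finsupp.single (3 * e) fun _ => 1, fun ζ z => by
    rw [Finsupp.sum_single_index (by simp)]; rfl⟩
  twisted := fun ζ z => by
    have h : ((eps * ζ : Circle) : ℂ) ^ (3 * e) = (ζ : ℂ) ^ (3 * e) := by
      rw [Circle.coe_mul, mul_zpow, zpow_mul]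
      norm_cast
      rw [eps_pow_three]
      simp
    simp only [zetaPow, h, mul_smul_comm, mul_one, smul_mul_assoc, matS_mul_inv]
  differentiable := fun ζ i j => differentiable_const _
  eq_dz := fun ζ z => by
    rw [show zetaPow (3 * e) ζ = fun _ => (ζ : ℂ) ^ (3 * e) • (1 : Mat) from rfl]
    simp [dzMat_const]
  eq_dzbar := fun ζ z => by
    rw [show zetaPow (3 * e) ζ = fun _ => (ζ : ℂ) ^ (3 * e) • (1 : Mat) from rfl]
    simp [dzbarMat_const]

/-! ### Traces -/

/-- The scalar matrix valued function `tr X`. -/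
def traceFun : (ℂ → Mat) →ₗ[ℂ] (ℂ → Mat) where
  toFun X z := (X z).trace • 1
  map_add' X Y := by funext z; simp [Matrix.trace_add, add_smul]
  map_smul' c X := by funext z; simp [Matrix.trace_smul, smul_smul]

lemma HasLead.map (D : (ℂ → Mat) →ₗ[ℂ] (ℂ → Mat)) (h : HasLead ξ d X) :
    HasLead (fun ζ => D (ξ ζ)) d (D X) := by
  obtain ⟨p, rfl, rfl⟩ := h
  refine ⟨mapCoeff D p, coeff_mapCoeff D.map_zero p 0, ?_⟩
  funext ζ
  rw [zetaPow_mul_apply, zetaPow_mul_apply, evLoop_apply _ ζ (natDegree_mapCoeff_lt D p),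
    evLoop_apply p ζ (Nat.lt_succ_self _), map_smul, map_sum]
  congr 1
  refine Finset.sum_congr rfl fun k _ => ?_
  rw [coeff_mapCoeff D.map_zero, map_smul]

/-- The loop of scalar matrices `tr ξ`. -/
def traceLoop (ξ : Loop) : Loop := fun ζ => traceFun (ξ ζ)

lemma traceLoop_apply (ξ : Loop) (ζ : Circle) (z : ℂ) :
    traceLoop ξ ζ z = (ξ ζ z).trace • (1 : Mat) := rfl

lemma traceLoop_eq_zero (h : ∀ ζ z, (ξ ζ z).trace = 0) : traceLoop ξ = 0 := by
  funext ζ z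
  rw [traceLoop_apply, h, zero_smul]
  rfl

lemma dzMat_smul_one (g : ℂ → ℂ) (z : ℂ) : dzMat (fun w => g w • (1 : Mat)) z = dz g z • 1 := by
  ext i j
  by_cases hij : i = j <;> simp [dzMat, dz, Matrix.one_apply, hij]

lemma dzbarMat_smul_one (g : ℂ → ℂ) (z : ℂ) :
    dzbarMat (fun w => g w • (1 : Mat)) z = dzbar g z • 1 := by
  ext i j
  by_cases hij : i = j <;> simp [dzbarMat, dzbar, Matrix.one_apply, hij]

lemma IsKilling.dz_trace (h : IsKilling t ξ) (ζ : Circle) (z : ℂ) :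
    dz (fun w => (ξ ζ w).trace) z = 0 := by
  rw [MinLag.dz_trace (h.differentiable ζ), h.eq_dz, Matrix.trace_sub, Matrix.trace_mul_comm,
    sub_self]

lemma IsKilling.dzbar_trace (h : IsKilling t ξ) (ζ : Circle) (z : ℂ) :
    dzbar (fun w => (ξ ζ w).trace) z = 0 := by
  rw [MinLag.dzbar_trace (h.differentiable ζ), h.eq_dzbar, Matrix.trace_sub, Matrix.trace_mul_comm,
    sub_self]

lemma IsKilling.trace_eq (h : IsKilling t ξ) (ζ : Circle) (z w : ℂ) :
    (ξ ζ z).trace = (ξ ζ w).trace :=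
  eq_of_dz_eq_zero (differentiable_trace (h.differentiable ζ)) (h.dz_trace ζ) (h.dzbar_trace ζ) z w

lemma IsKilling.trace_twisted (h : IsKilling t ξ) (ζ : Circle) (z : ℂ) :
    (ξ (eps * ζ) z).trace = (ξ ζ z).trace := by
  rw [← h.twisted, Matrix.trace_mul_comm, ← mul_assoc, matS_inv_mul, one_mul]

lemma IsKilling.traceLoop (h : IsKilling t ξ) : IsKilling t (traceLoop ξ) where
  laurent := by
    obtain ⟨c, hc⟩ := h.laurent
    refine exists_laurent_of_sum (c := c) (fun _ => traceFun) fun ζ z => ?_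
    rw [traceLoop_apply, hc, Finsupp.sum, Finsupp.sum, Matrix.trace_sum, Finset.sum_smul]
    refine Finset.sum_congr rfl fun k _ => ?_
    rw [Matrix.trace_smul, smul_assoc]
    rfl
  twisted := fun ζ z => by
    rw [traceLoop_apply, traceLoop_apply, h.trace_twisted, mul_smul_comm, smul_mul_assoc, mul_one,
      matS_mul_inv]
  differentiable := fun ζ i j => (differentiable_trace (h.differentiable ζ)).mul_const _
  eq_dz := fun ζ z => by
    rw [show MinLag.traceLoop ξ ζ = fun w => (ξ ζ w).trace • (1 : Mat) from rfl, dzMat_smul_one,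
      h.dz_trace]
    simp
  eq_dzbar := fun ζ z => by
    rw [show MinLag.traceLoop ξ ζ = fun w => (ξ ζ w).trace • (1 : Mat) from rfl, dzbarMat_smul_one,
      h.dzbar_trace]
    simp

lemma trace_commutator_mul_pow (A B : Mat) (j : ℕ) : ((A * B - B * A) * A ^ j).trace = 0 := by
  rw [sub_mul, Matrix.trace_sub, mul_assoc, mul_assoc, Matrix.trace_mul_comm, mul_assoc, ← pow_succ,
    ← pow_succ', sub_self]

lemma IsKilling.sub (hξ : IsKilling t ξ) (hη : IsKilling t η) : IsKilling t (ξ - η) :=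
  (killing t).sub_mem hξ hη

lemma IsKilling.smul (hξ : IsKilling t ξ) (c : ℂ) : IsKilling t (c • ξ) :=
  (killing t).smul_mem hξ c

lemma HasLead.trace_eq_zero (hl : HasLead ξ d X) (h : ∀ ζ z, (ξ ζ z).trace = 0) (z : ℂ) :
    (X z).trace = 0 := by
  have h1 := hl.map traceFun
  change HasLead (traceLoop ξ) _ _ at h1
  rw [traceLoop_eq_zero h] at h1
  have h2 := congrFun (congrFun (congrFun (h1.unique (hasLead_zero _)) z) 0) 0
  simpa [traceFun] using h2

/-- Suppose the commutator `θ` is non-zero. As `ξ` is traceless, its leading exponent `n` is prime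
to `3`, so for a suitable `j` the leading coefficient of `θ ξ ^ j` is a non-zero scalar matrix. But
`[ξ, η] ξ ^ j` has trace zero. -/
lemma IsKilling.mul_comm_of_trace (hξ : IsKilling t ξ) (hη : IsKilling t η)
    (hT : ∀ ζ z, (ξ ζ z).trace = 0) : ξ * η = η * ξ := by
  by_contra hne
  have hθ := (hξ.mul hη).sub (hη.mul hξ)
  have hξ0 : ξ ≠ 0 := by rintro rfl; simp at hne
  obtain ⟨d, n, c, hc, -, hl⟩ := hξ.exists_lead hξ0
  obtain ⟨e, m, c', hc', -, hl'⟩ := hθ.exists_lead (sub_ne_zero.2 hne)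
  have hs := t.speed_ne_zero 0
  have hn : ¬ 3 ∣ n := by
    intro hn
    have h1 := hl.trace_eq_zero hT 0
    rw [Pi.smul_apply, Pi.pow_apply, torusP, Matrix.trace_smul, trace_cyc_pow hs hn] at h1
    simp [hc] at h1
  -- `n` is invertible modulo `3`: take `j = 2 m` for `n ≡ 1` and `j = m` for `n ≡ 2`.
  obtain ⟨j, hj⟩ : ∃ j, 3 ∣ m + n * j := by
    have h1 : n % 3 = 1 ∨ n % 3 = 2 := by omega
    rcases h1 with h1 | h1
    · exact ⟨2 * m, by rw [Nat.dvd_iff_mod_eq_zero, Nat.add_mod, Nat.mul_mod, h1]; omega⟩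
    · exact ⟨m, by rw [Nat.dvd_iff_mod_eq_zero, Nat.add_mod, Nat.mul_mod, h1]; omega⟩
  have h2 := (hl'.mul (hl.pow j)).trace_eq_zero (fun ζ z => trace_commutator_mul_pow _ _ _) 0
  rw [smul_torusP_pow_pow, smul_torusP_pow_mul, Pi.smul_apply, Pi.pow_apply, torusP,
    Matrix.trace_smul, trace_cyc_pow hs hj] at h2
  simp [hc, hc'] at h2

/-- One third of the trace is a scalar Killing field; subtracting it reduces to the traceless case.
-/
theorem IsKilling.mul_comm (hξ : IsKilling t ξ) (hη : IsKilling t η) : ξ * η = η * ξ := by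
  have h1 := hξ.sub (hξ.traceLoop.smul (1 / 3))
  have h2 := h1.mul_comm_of_trace hη fun ζ z => by
    rw [Pi.sub_apply, Pi.sub_apply, Pi.smul_apply, Pi.smul_apply, traceLoop_apply]
    simp [Matrix.trace_sub, Matrix.trace_smul]
    ring
  have h3 : MinLag.traceLoop ξ * η = η * MinLag.traceLoop ξ := by
    funext ζ z
    simp [traceLoop_apply]
  rw [sub_mul, mul_sub, smul_mul_assoc, mul_smul_comm, h3] at h2
  exact sub_left_injective h2

/-! ### The involution `μ_*` -/

lemma matT_mul_matT : matT * matT = 1 := by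
  ext i j
  fin_cases i <;> fin_cases j <;> simp [matT, Matrix.mul_apply, Fin.sum_univ_three]

lemma matT_mul_transpose_mul_matT (M : Mat) : matT * M.transpose * matT =
    Matrix.of fun i j => M (Equiv.swap 1 2 j) (Equiv.swap 1 2 i) := by
  have h0 : Equiv.swap (1 : Fin 3) 2 0 = 0 := by decide
  ext i j
  fin_cases i <;> fin_cases j <;>
    simp [matT, Matrix.mul_apply, Matrix.vecMul, dotProduct, Fin.sum_univ_three, h0]

lemma matT_cyc (s : ℂ) : matT * (cyc s).transpose * matT = cyc s := by
  have h0 : Equiv.swap (1 : Fin 3) 2 0 = 0 := by decide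
  rw [matT_mul_transpose_mul_matT]
  ext i j
  fin_cases i <;> fin_cases j <;> simp [cyc, h0]

lemma matT_torusK (a : ℂ) : matT * (torusK a).transpose * matT = -torusK a := by
  have h0 : Equiv.swap (1 : Fin 3) 2 0 = 0 := by decide
  rw [matT_mul_transpose_mul_matT]
  ext i j
  fin_cases i <;> fin_cases j <;> simp [torusK, h0]

/-- Conjugation by `T` inverts `S`; transposition reverses the order, so together they respect the
twist. -/
lemma matS_mul_matT_mul_matS : matS * matT * matS = matT := by
  have h : (eps : ℂ) * (eps : ℂ) ^ 2 = 1 := by rw [← pow_succ', eps_pow_three_coe]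
  have h' : (eps : ℂ) ^ 2 * (eps : ℂ) = 1 := by rw [← pow_succ, eps_pow_three_coe]
  ext i j
  rw [matS, Matrix.mul_diagonal, Matrix.diagonal_mul]
  fin_cases i <;> fin_cases j <;> simp [matT, h, h']

lemma transpose_matS : matS.transpose = matS := Matrix.diagonal_transpose _

lemma matT_conj (A B : Mat) : matT * (A * B).transpose * matT =
    (matT * B.transpose * matT) * (matT * A.transpose * matT) := by
  rw [Matrix.transpose_mul, mul_assoc (matT * B.transpose) matT, ← mul_assoc matT (matT * _),
    ← mul_assoc matT matT, matT_mul_matT, one_mul]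
  simp only [mul_assoc]

/-- The anti-automorphism fixes the cyclic part and negates the diagonal part. Passing to `-ζ`
negates the cyclic part too. -/
lemma matT_alphaLoopZ (ζ : Circle) (z : ℂ) :
    matT * (alphaLoopZ t (-ζ) z).transpose * matT = -alphaLoopZ t ζ z := by
  rw [t.alphaLoopZ_eq, t.alphaLoopZ_eq, Matrix.transpose_add, Matrix.transpose_smul, mul_add,
    add_mul, matT_torusK, mul_smul_comm, smul_mul_assoc, matT_cyc]
  simp [add_comm]

lemma matT_alphaLoopZbar (ζ : Circle) (z : ℂ) :
    matT * (alphaLoopZbar t (-ζ) z).transpose * matT = -alphaLoopZbar t ζ z := by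
  have h : matT * cyc (t.speed z) * matT = (cyc (t.speed z)).transpose := by
    conv_lhs => rw [← matT_cyc]
    simp only [mul_assoc]
    rw [matT_mul_matT, mul_one, ← mul_assoc, matT_mul_matT, one_mul]
  rw [t.alphaLoopZbar_eq, t.alphaLoopZbar_eq, Matrix.transpose_sub, Matrix.transpose_smul, mul_sub,
    sub_mul, Matrix.transpose_neg, mul_neg, neg_mul, matT_torusK, mul_smul_comm, smul_mul_assoc,
    Matrix.transpose_transpose, h]
  simp [sub_eq_add_neg, inv_neg, add_comm]

lemma muLoop_mul (ξ η : Loop) : muLoop (ξ * η) = muLoop η * muLoop ξ := by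
  funext ζ z
  exact matT_conj _ _

lemma muLoop_muLoop (ξ : Loop) : muLoop (muLoop ξ) = ξ := by
  funext ζ z
  ext i j
  simp [muLoop, matT_mul_transpose_mul_matT]

/-- Reversing products changes the sign of the commutator, and the sign change of the connection
form compensates for it. -/
lemma IsKilling.muLoop (h : IsKilling t ξ) : IsKilling t (muLoop ξ) where
  laurent := by
    obtain ⟨c, hc⟩ := h.laurent
    refine exists_laurent_of_sum (c := c)
      (fun k X z => (-1 : ℂ) ^ k • (matT * (X z).transpose * matT)) fun ζ z => ?_
    rw [MinLag.muLoop, hc, Finsupp.sum, Finsupp.sum, Matrix.transpose_sum, Finset.mul_sum,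
      Finset.sum_mul]
    refine Finset.sum_congr rfl fun k _ => ?_
    rw [Matrix.transpose_smul, mul_smul_comm, smul_mul_assoc, smul_smul, ← mul_zpow]
    simp
  twisted := fun ζ z => by
    have h1 : -(eps * ζ) = eps * -ζ := by ext; simp
    have h2 : matS * matT = matT * matS⁻¹ := by
      rw [← matS_mul_matT_mul_matS, mul_assoc _ matS, matS_mul_inv, mul_one,
        matS_mul_matT_mul_matS]
    have h3 : matT * matS⁻¹ = matS * matT := h2.symm
    rw [MinLag.muLoop, MinLag.muLoop, h1, ← h.twisted, Matrix.transpose_mul, Matrix.transpose_mul,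
      Matrix.transpose_nonsing_inv, transpose_matS, ← mul_assoc, ← mul_assoc,
      mul_assoc _ matT matS⁻¹, h3]
    simp only [mul_assoc]
    rw [← mul_assoc matS, h2, mul_assoc]
  differentiable := fun ζ i j => by
    simp only [MinLag.muLoop, matT_mul_transpose_mul_matT]
    exact h.differentiable _ _ _
  eq_dz := fun ζ z => by
    have h1 : dzMat (MinLag.muLoop ξ ζ) z = matT * (dzMat (ξ (-ζ)) z).transpose * matT := by
      rw [matT_mul_transpose_mul_matT, show MinLag.muLoop ξ ζ = _ from
        funext fun z => matT_mul_transpose_mul_matT (ξ (-ζ) z)]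
      rfl
    rw [h1, h.eq_dz, Matrix.transpose_sub, mul_sub, sub_mul, matT_conj, matT_conj, matT_alphaLoopZ]
    simp only [MinLag.muLoop]
    noncomm_ring
  eq_dzbar := fun ζ z => by
    have h1 : dzbarMat (MinLag.muLoop ξ ζ) z = matT * (dzbarMat (ξ (-ζ)) z).transpose * matT := by
      rw [matT_mul_transpose_mul_matT, show MinLag.muLoop ξ ζ = _ from
        funext fun z => matT_mul_transpose_mul_matT (ξ (-ζ) z)]
      rfl
    rw [h1, h.eq_dzbar, Matrix.transpose_sub, mul_sub, sub_mul, matT_conj, matT_conj,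
      matT_alphaLoopZbar]
    simp only [MinLag.muLoop]
    noncomm_ring

/-! ### The real structure -/

/-- The loop of Hermitian transposes. -/
def starLoop (ξ : Loop) : Loop := fun ζ z => (ξ ζ z).conjTranspose

/-- On the unit circle the connection form is skew-Hermitian in real directions; `|ζ| = 1` is what
exchanges `ζ` and `ζ⁻¹`. -/
lemma conjTranspose_alphaLoopZ (ζ : Circle) (z : ℂ) :
    (alphaLoopZ t ζ z).conjTranspose = -alphaLoopZbar t ζ z := by
  have h1 := t.conj_speed z
  have h2 := t.conj_logDz z
  have h3 : (starRingEnd ℂ) (ζ : ℂ) = (ζ : ℂ)⁻¹ := by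
    rw [← Circle.coe_inv_eq_conj, Circle.coe_inv]
  rw [t.alphaLoopZ_eq, t.alphaLoopZbar_eq]
  ext i j
  fin_cases i <;> fin_cases j <;> simp [cyc, torusK, h1, h2, h3]

lemma conjTranspose_alphaLoopZbar (ζ : Circle) (z : ℂ) :
    (alphaLoopZbar t ζ z).conjTranspose = -alphaLoopZ t ζ z := by
  rw [← neg_neg (alphaLoopZbar t ζ z), ← conjTranspose_alphaLoopZ, Matrix.conjTranspose_neg,
    Matrix.conjTranspose_conjTranspose]

lemma fderiv_star {g : ℂ → ℂ} {z : ℂ} (hg : DifferentiableAt ℝ g z) (v : ℂ) :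
    fderiv ℝ (fun w => (starRingEnd ℂ) (g w)) z v = (starRingEnd ℂ) (fderiv ℝ g z v) := by
  have h := (Complex.conjCLE.toContinuousLinearMap.hasFDerivAt.comp z hg.hasFDerivAt).fderiv
  exact congrArg (fun L => L v) h

lemma dzMat_conjTranspose {g : ℂ → Mat} (hg : g ∈ differentiableMat) (z : ℂ) :
    dzMat (fun w => (g w).conjTranspose) z = (dzbarMat g z).conjTranspose := by
  ext i j
  simp [dzMat, dzbarMat, dz, dzbar, fderiv_star (hg j i z), sub_eq_add_neg]

lemma dzbarMat_conjTranspose {g : ℂ → Mat} (hg : g ∈ differentiableMat) (z : ℂ) :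
    dzbarMat (fun w => (g w).conjTranspose) z = (dzMat g z).conjTranspose := by
  ext i j
  simp [dzMat, dzbarMat, dz, dzbar, fderiv_star (hg j i z), sub_eq_add_neg]

lemma conjTranspose_matS : matS.conjTranspose = matS⁻¹ := by
  refine (Matrix.inv_eq_left_inv ?_).symm
  have h : (starRingEnd ℂ) (eps : ℂ) * (eps : ℂ) = 1 := by
    rw [← Circle.coe_inv_eq_conj, ← Circle.coe_mul, inv_mul_cancel, Circle.coe_one]
  rw [matS, Matrix.diagonal_conjTranspose, Matrix.diagonal_mul_diagonal, ← Matrix.diagonal_one]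
  congr 1
  funext i
  fin_cases i <;> simp [h, ← mul_pow]

lemma IsKilling.starLoop (h : IsKilling t ξ) : IsKilling t (starLoop ξ) where
  laurent := by
    obtain ⟨c, hc⟩ := h.laurent
    refine ⟨c.sum fun k X => Finsupp.single (-k) fun z => (X z).conjTranspose, fun ζ z => ?_⟩
    rw [Finsupp.sum_sum_index (by simp) (by intros; simp), MinLag.starLoop, hc, Finsupp.sum,
      Finsupp.sum, Matrix.conjTranspose_sum]
    refine Finset.sum_congr rfl fun k _ => ?_
    rw [Finsupp.sum_single_index (by simp), Matrix.conjTranspose_smul]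
    congr 1
    rw [star_zpow₀, zpow_neg, ← inv_zpow, ← Circle.coe_inv, Circle.coe_inv_eq_conj]
    rfl
  twisted := fun ζ z => by
    have h1 : (matS⁻¹).conjTranspose = matS := by
      rw [← conjTranspose_matS, Matrix.conjTranspose_conjTranspose]
    rw [MinLag.starLoop, MinLag.starLoop, ← h.twisted, Matrix.conjTranspose_mul,
      Matrix.conjTranspose_mul, h1, conjTranspose_matS, mul_assoc]
  differentiable := fun ζ i j =>
    Complex.conjCLE.toContinuousLinearMap.differentiable.comp (h.differentiable ζ j i)
  eq_dz := fun ζ z => by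
    rw [show MinLag.starLoop ξ ζ = fun w => (ξ ζ w).conjTranspose from rfl,
      dzMat_conjTranspose (h.differentiable ζ), h.eq_dzbar, Matrix.conjTranspose_sub,
      Matrix.conjTranspose_mul, Matrix.conjTranspose_mul, conjTranspose_alphaLoopZbar]
    noncomm_ring
  eq_dzbar := fun ζ z => by
    rw [show MinLag.starLoop ξ ζ = fun w => (ξ ζ w).conjTranspose from rfl,
      dzbarMat_conjTranspose (h.differentiable ζ), h.eq_dz, Matrix.conjTranspose_sub,
      Matrix.conjTranspose_mul, Matrix.conjTranspose_mul, conjTranspose_alphaLoopZ]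
    noncomm_ring

/-! ### The commutative domain of Killing fields, its unit and its two involutions -/

variable (t : MinimalLagrangianTorus)

instance isMulCommutative_killing : IsMulCommutative (killing t) :=
  ⟨⟨fun a b => Subtype.ext (a.2.mul_comm b.2)⟩⟩

instance isDomain_killing : IsDomain (killing t) :=
  have : NoZeroDivisors (killing t) := ⟨fun {a b} h => by
    by_contra! hab
    exact a.2.mul_ne_zero b.2 (fun h0 => hab.1 (Subtype.ext h0)) (fun h0 => hab.2 (Subtype.ext h0))
      (congrArg Subtype.val h)⟩
  NoZeroDivisors.to_isDomain _

lemma lam_eq_zetaPow : (lam t : Loop) = zetaPow 3 := by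
  funext ζ z
  simp only [lam, zetaPow]
  norm_cast

/-- The unit `λ = ζ³ I`. -/
def lamUnit : (killing t)ˣ where
  val := lam t
  inv := ⟨zetaPow (3 * (-1)), isKilling_zetaPow t (-1)⟩
  val_inv := Subtype.ext (by
    change (lam t : Loop) * zetaPow (3 * (-1)) = 1
    rw [lam_eq_zetaPow, ← zetaPow_add, ← zetaPow_zero]; norm_num)
  inv_val := Subtype.ext (by
    change zetaPow (3 * (-1)) * (lam t : Loop) = 1
    rw [lam_eq_zetaPow, ← zetaPow_add, ← zetaPow_zero]; norm_num)

lemma coe_lamUnit_inv : (((lamUnit t)⁻¹ : (killing t)ˣ) : Loop) = zetaPow (-3) := rfl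

lemma coe_lamUnit_zpow (d : ℤ) :
    (((lamUnit t ^ d : (killing t)ˣ) : killing t) : Loop) = zetaPow (3 * d) := by
  induction d using Int.induction_on with
  | zero => simp [zetaPow_zero]
  | succ n ih =>
    rw [zpow_add_one, Units.val_mul, MulMemClass.coe_mul, ih, mul_add, zetaPow_add, mul_one,
      ← lam_eq_zetaPow]
    rfl
  | pred n ih =>
    rw [zpow_sub_one, Units.val_mul, MulMemClass.coe_mul, ih, coe_lamUnit_inv, mul_sub,
      sub_eq_add_neg, zetaPow_add]
    norm_num

/-- The automorphism `μ_*` of the algebra of Killing fields. -/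
def muEquiv : killing t ≃ₐ[ℂ] killing t where
  toFun a := ⟨muLoop a, a.2.muLoop⟩
  invFun a := ⟨muLoop a, a.2.muLoop⟩
  left_inv a := Subtype.ext (muLoop_muLoop a)
  right_inv a := Subtype.ext (muLoop_muLoop a)
  -- `muLoop` reverses products, so multiplicativity rests on commutativity.
  map_mul' a b := Subtype.ext (by
    change muLoop (a * b) = muLoop a * muLoop b
    rw [muLoop_mul, (a.2.muLoop).mul_comm b.2.muLoop])
  map_add' a b := Subtype.ext (by
    funext ζ z
    simp [muLoop, Matrix.transpose_add, mul_add, add_mul])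
  commutes' c := Subtype.ext (by
    funext ζ z
    simp [muLoop, Algebra.algebraMap_eq_smul_one, matT_mul_matT])

lemma muEquiv_muEquiv (a : killing t) : muEquiv t (muEquiv t a) = a :=
  Subtype.ext (muLoop_muLoop a)

lemma muEquiv_lamUnit : muEquiv t (lamUnit t) = -(lamUnit t : killing t) := by
  refine Subtype.ext ?_
  funext ζ z
  change matT * ((((-ζ : Circle) : ℂ) ^ 3 • (1 : Mat))).transpose * matT = -((ζ : ℂ) ^ 3 • (1 : Mat))
  have h : ((-ζ : Circle) : ℂ) ^ 3 = -(ζ : ℂ) ^ 3 := by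
    rw [Circle.coe_neg, neg_pow]
    norm_num
  rw [h, Matrix.transpose_smul, Matrix.transpose_one, mul_smul_comm, smul_mul_assoc, mul_one,
    matT_mul_matT, neg_smul]

lemma starLoop_mul (ξ η : Loop) : starLoop (ξ * η) = starLoop η * starLoop ξ := by
  funext ζ z
  exact Matrix.conjTranspose_mul _ _

lemma starLoop_starLoop (ξ : Loop) : starLoop (starLoop ξ) = ξ := by
  funext ζ z
  exact Matrix.conjTranspose_conjTranspose _

/-- The real structure of the algebra of Killing fields. -/
def starHom : killing t →+* killing t where
  toFun a := ⟨starLoop a, a.2.starLoop⟩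
  map_mul' a b := Subtype.ext (by
    change starLoop (a * b) = starLoop a * starLoop b
    rw [starLoop_mul, (a.2.starLoop).mul_comm b.2.starLoop])
  map_add' a b := Subtype.ext (by
    funext ζ z
    simp [starLoop])
  map_one' := Subtype.ext (by
    funext ζ z
    simp [starLoop])
  map_zero' := Subtype.ext (by
    funext ζ z
    simp [starLoop])

lemma starHom_starHom (a : killing t) : starHom t (starHom t a) = a :=
  Subtype.ext (starLoop_starLoop a)

lemma starHom_algebraMap (c : ℂ) :
    starHom t (algebraMap ℂ _ c) = algebraMap ℂ _ ((starRingEnd ℂ) c) := by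
  refine Subtype.ext ?_
  funext ζ z
  change (algebraMap ℂ Loop c ζ z).conjTranspose = algebraMap ℂ Loop _ ζ z
  simp [Pi.algebraMap_apply, Algebra.algebraMap_eq_smul_one]

lemma starHom_lamUnit : starHom t (lamUnit t) = ((lamUnit t)⁻¹ : (killing t)ˣ) := by
  refine Subtype.ext ?_
  funext ζ z
  change ((ζ : ℂ) ^ 3 • (1 : Mat)).conjTranspose = zetaPow (-3) ζ z
  rw [Matrix.conjTranspose_smul, Matrix.conjTranspose_one, zetaPow, star_pow, zpow_neg, ← inv_zpow,
    ← Circle.coe_inv, Circle.coe_inv_eq_conj]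
  norm_cast

/-! ### Scalar Killing fields -/

/-- The trace of a Killing field, as a Killing field. -/
def traceEl (a : killing t) : killing t := ⟨traceLoop a, a.2.traceLoop⟩

/-- Evaluation of Killing fields. -/
def evalAt (ζ : Circle) (z : ℂ) : killing t →ₐ[ℂ] Mat :=
  (Pi.evalAlgHom ℂ (fun _ : ℂ => Mat) z).comp
    ((Pi.evalAlgHom ℂ (fun _ : Circle => ℂ → Mat) ζ).comp (killing t).val)

lemma evalAt_apply (ζ : Circle) (z : ℂ) (a : killing t) : evalAt t ζ z a = (a : Loop) ζ z := rfl

lemma eq_zero_of_eval_circle {p : ℂ[X]} (h : ∀ ζ : Circle, p.eval (ζ : ℂ)⁻¹ = 0) : p = 0 := by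
  obtain ⟨Z, hZ⟩ := exists_finset_circle (p.natDegree + 1)
  refine eq_zero_of_natDegree_lt_card_of_eval_eq_zero' p
    (Z.image fun ζ : Circle => (ζ : ℂ)⁻¹) (fun x hx => ?_) ?_
  · obtain ⟨ζ, -, rfl⟩ := Finset.mem_image.1 hx
    exact h ζ
  · rw [Finset.card_image_of_injective _ fun x y hxy => Circle.ext (inv_injective hxy)]
    omega

lemma evalAt_aeval_lamUnit_inv (ζ : Circle) (z : ℂ) (p : ℂ[X]) :
    evalAt t ζ z (aeval (((lamUnit t)⁻¹ : (killing t)ˣ) : killing t) p) =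
      algebraMap ℂ Mat (p.eval ((ζ : ℂ)⁻¹ ^ 3)) := by
  rw [← aeval_algHom_apply, show evalAt t ζ z (((lamUnit t)⁻¹ : (killing t)ˣ) : killing t) =
    algebraMap ℂ Mat ((ζ : ℂ)⁻¹ ^ 3) from ?_, aeval_algebraMap_apply]
  · rfl
  · change zetaPow (-3) ζ z = _
    rw [Algebra.algebraMap_eq_smul_one, zetaPow, zpow_neg, ← inv_zpow]
    norm_cast

lemma expand_of_coeff {p : ℂ[X]} (h : ∀ k, p.coeff k ≠ 0 → 3 ∣ k) : ∃ q, p = expand ℂ 3 q := by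
  refine ⟨contract 3 p, ?_⟩
  ext k
  rw [coeff_expand (by norm_num), coeff_contract (by norm_num)]
  split_ifs with hk
  · rw [Nat.div_mul_cancel hk]
  · by_contra h0
    exact hk (h k h0)

variable {t}

/-- The trace does not depend on `z`, is a polynomial in `ζ⁻¹`, and is unchanged when `ζ` is
multiplied by a cube root of unity. So it is a polynomial in `ζ⁻³`. -/
lemma traceEl_mem_adjoin {a : killing t} {Y : ℂ → Mat} (ha : HasLead a 0 Y) :
    traceEl t a ∈ Algebra.adjoin ℂ {(((lamUnit t)⁻¹ : (killing t)ˣ) : killing t)} := by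
  obtain ⟨p, -, hp⟩ := ha
  rw [zetaPow_zero, one_mul] at hp
  let P : ℂ[X] := ∑ k ∈ Finset.range (p.natDegree + 1), monomial k (p.coeff k 0).trace
  have hP : ∀ ζ z, ((a : Loop) ζ z).trace = P.eval (ζ : ℂ)⁻¹ := fun ζ z => by
    rw [a.2.trace_eq ζ z 0, hp, evLoop_apply p ζ (Nat.lt_succ_self _), Finset.sum_apply,
      Matrix.trace_sum]
    simp only [P, eval_finsetSum, eval_monomial]
    refine Finset.sum_congr rfl fun k _ => ?_
    rw [Pi.smul_apply, Matrix.trace_smul, smul_eq_mul, mul_comm]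
  have h1 : P.comp (C (eps : ℂ)⁻¹ * X) - P = 0 := eq_zero_of_eval_circle fun ζ => by
    rw [eval_sub, eval_comp, eval_mul, eval_C, eval_X, ← mul_inv, ← Circle.coe_mul, ← hP _ 0,
      ← hP _ 0, a.2.trace_twisted, sub_self]
  obtain ⟨Q, hQ⟩ := expand_of_coeff (p := P) fun k hk => by
    have h2 := congrArg (fun p => coeff p k) h1
    simp only [coeff_sub, comp_C_mul_X_coeff, coeff_zero] at h2
    have h3 : (eps : ℂ)⁻¹ ^ k = 1 := by
      rw [← sub_eq_zero]
      refine (mul_eq_zero.1 (?_ : P.coeff k * _ = 0)).resolve_left hk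
      linear_combination h2
    rw [inv_pow, inv_eq_one] at h3
    have h4 := eps_pow_three_coe
    rw [← Nat.div_add_mod k 3, pow_add, pow_mul, h4, one_pow, one_mul] at h3
    have h5 := Nat.mod_lt k (show 0 < 3 by norm_num)
    interval_cases h6 : k % 3
    · omega
    · exact absurd (by simpa using h3) eps_ne_one
    · exact absurd h3 eps_sq_ne_one
  rw [show traceEl t a = aeval (((lamUnit t)⁻¹ : (killing t)ˣ) : killing t) Q from ?_]
  · exact aeval_mem_adjoin_singleton _ _
  · refine Subtype.ext ?_
    funext ζ z
    have h2 := evalAt_aeval_lamUnit_inv t ζ z Q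
    rw [evalAt_apply, ← expand_eval, ← hQ, ← hP ζ z, Algebra.algebraMap_eq_smul_one] at h2
    exact h2.symm

/-- The coefficients are written through traces of powers, by Newton's identities, because traces of
Killing fields are Killing fields. -/
lemma cayley_hamilton (M : Mat) :
    M ^ 3 + (-(M.trace • M ^ 2) + ((1 / 2 : ℂ) * (M.trace ^ 2 - (M ^ 2).trace)) • M +
      -(((1 / 6 : ℂ) * (M.trace ^ 3 - 3 * M.trace * (M ^ 2).trace + 2 * (M ^ 3).trace)) • 1)) = 0 := by
  ext i j
  fin_cases i <;> fin_cases j <;>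
    simp [pow_succ, Matrix.trace, Matrix.mul_apply, Fin.sum_univ_three] <;> ring

lemma isIntegral_of_cubic {R A : Type*} [CommRing R] [CommRing A] [Algebra R A] {b : A} (p q r : R)
    (h : b ^ 3 + (algebraMap R A p * b ^ 2 + algebraMap R A q * b + algebraMap R A r) = 0) :
    IsIntegral R b := by
  refine ⟨Polynomial.X ^ 3 + (C p * Polynomial.X ^ 2 + C q * Polynomial.X + C r), ?_, ?_⟩
  · nontriviality R
    refine monic_X_pow_add (lt_of_le_of_lt (b := (2 : WithBot ℕ)) ?_ (by norm_cast))
    compute_degree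
  · simpa only [eval₂_add, eval₂_mul, eval₂_pow, eval₂_X, eval₂_C] using h

/-- The characteristic polynomial is an integral equation: its coefficients are polynomials in
traces of powers, which lie in `ℂ[λ⁻¹]`. -/
lemma isIntegral_of_hasLead {a : killing t} {X : ℂ → Mat} (ha : HasLead a 0 X) :
    IsIntegral (Algebra.adjoin ℂ {(((lamUnit t)⁻¹ : (killing t)ˣ) : killing t)}) a := by
  set S := Algebra.adjoin ℂ {(((lamUnit t)⁻¹ : (killing t)ˣ) : killing t)}
  have hpow : ∀ n : ℕ, HasLead (a ^ n : killing t) 0 (X ^ n) := fun n => by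
    simpa using ha.pow n
  let p₁ : S := ⟨traceEl t a, traceEl_mem_adjoin ha⟩
  let p₂ : S := ⟨traceEl t (a ^ 2), traceEl_mem_adjoin (hpow 2)⟩
  let p₃ : S := ⟨traceEl t (a ^ 3), traceEl_mem_adjoin (hpow 3)⟩
  let c₁ : S := (1 / 2 : ℂ) • (p₁ ^ 2 - p₂)
  let c₀ : S := (1 / 6 : ℂ) • (p₁ ^ 3 - 3 * p₁ * p₂ + 2 * p₃)
  refine isIntegral_of_cubic (-p₁) c₁ (-c₀) ?_
  refine Subtype.ext ?_
  funext ζ z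
  have h := cayley_hamilton ((a : Loop) ζ z)
  change (a : Loop) ζ z ^ 3 + (-(((a : Loop) ζ z).trace • (1 : Mat)) * (a : Loop) ζ z ^ 2 +
    ((1 / 2 : ℂ) • ((((a : Loop) ζ z).trace • (1 : Mat)) ^ 2 -
      (((a : Loop) ζ z) ^ 2).trace • (1 : Mat))) * (a : Loop) ζ z +
    -((1 / 6 : ℂ) • ((((a : Loop) ζ z).trace • (1 : Mat)) ^ 3 -
      3 * (((a : Loop) ζ z).trace • (1 : Mat)) * ((((a : Loop) ζ z) ^ 2).trace • (1 : Mat)) +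
      2 * ((((a : Loop) ζ z) ^ 3).trace • (1 : Mat))))) = 0
  rw [← h]
  congr 2
  · congr 1
    · rw [neg_mul, smul_mul_assoc, one_mul]
    · rw [_root_.smul_pow, one_pow, ← sub_smul, smul_smul, smul_mul_assoc, one_mul]
  · have e3 : (3 : Mat) = (3 : ℂ) • 1 := by rw [← Algebra.algebraMap_eq_smul_one, map_ofNat]
    have e2 : (2 : Mat) = (2 : ℂ) • 1 := by rw [← Algebra.algebraMap_eq_smul_one, map_ofNat]
    rw [e3, e2, _root_.smul_pow, one_pow]
    simp only [smul_mul_smul_comm, one_mul, ← sub_smul, ← add_smul, smul_smul]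

/-- The third power removes the cyclic matrix: the leading term of `a ^ 3` is `c ^ 3 ζ ^ (3 d) I = c
^ 3 λ ^ d`. -/
theorem hasLeadingTerms_lamUnit : HasLeadingTerms (lamUnit t) := by
  intro a ha
  obtain ⟨d, n, c, hc, -, hl⟩ := a.2.exists_lead fun h => ha (Subtype.ext h)
  have h1 : HasLead ((a ^ 3 * ((lamUnit t ^ (-d) : (killing t)ˣ) : killing t) -
      algebraMap ℂ _ (c ^ 3) : killing t) : Loop) 0 0 := by
    have h2 := (hl.pow 3).mul (hasLead_zetaPow (3 * -d))
    have h3 := (hasLead_zetaPow 0).mul (hasLead_zetaPow 0)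
    have h4 : HasLead (algebraMap ℂ Loop (c ^ 3)) 0 (c ^ 3 • 1) :=
      ⟨C (c ^ 3 • 1), coeff_C_zero, by
        rw [evLoop_C, zetaPow_zero, one_mul]
        funext ζ z
        simp [Pi.algebraMap_apply, Algebra.algebraMap_eq_smul_one]⟩
    rw [← coe_lamUnit_zpow t, smul_torusP_pow_pow, mul_comm n, torusP_pow_three_mul, mul_one,
      show ((3 : ℕ) : ℤ) * d + 3 * -d = 0 by push_cast; ring] at h2
    have h5 := h2.sub h4
    rw [sub_self] at h5
    exact h5
  refine ⟨d, c ^ 3, a ^ 3 * ((lamUnit t ^ (-d) : (killing t)ˣ) : killing t) -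
    algebraMap ℂ _ (c ^ 3), pow_ne_zero 3 hc, ?_, ?_⟩
  · rw [add_sub_cancel, mul_left_comm, ← Units.val_mul, ← zpow_add, add_neg_cancel, zpow_zero,
      Units.val_one, mul_one]
  -- The remainder has degree at most `-1` in `ζ`, so its cube times `ζ ^ 3` has degree at most `0`.
  · obtain ⟨Y, hY⟩ := h1.sub_one
    have h2 := (hY.pow 3).mul (hasLead_zetaPow 3)
    rw [← lam_eq_zetaPow t, show ((3 : ℕ) : ℤ) * (0 - 1) + 3 = 0 by norm_num] at h2
    exact isIntegral_of_hasLead h2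

/-! ### The zero of λ, transcendence, and finite rank over ℂ[λ²] -/

variable {t : MinimalLagrangianTorus}

lemma isIntegral_map {A B : Type*} [CommRing A] [CommRing B] [Algebra ℂ A] [Algebra ℂ B]
    (σ : A →+* B) {S : Subalgebra ℂ A} {S' : Subalgebra ℂ B} (h : ∀ x ∈ S, σ x ∈ S') {b : A}
    (hb : IsIntegral S b) : IsIntegral S' (σ b) :=
  IsIntegral.map_of_comp_eq ((σ.comp S.val.toRingHom).codRestrict S' fun x => h x x.2) σ rfl hb

lemma starHom_lamUnit_inv :
    starHom t (((lamUnit t)⁻¹ : (killing t)ˣ) : killing t) = (lamUnit t : killing t) := by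
  rw [← starHom_lamUnit, starHom_starHom]

lemma starHom_lamUnit_zpow (d : ℤ) : starHom t ((lamUnit t ^ d : (killing t)ˣ) : killing t) =
    (((lamUnit t)⁻¹ ^ d : (killing t)ˣ) : killing t) := by
  have h : Units.map (starHom t).toMonoidHom (lamUnit t) = (lamUnit t)⁻¹ :=
    Units.ext (starHom_lamUnit t)
  rw [← h, ← map_zpow]
  rfl

lemma starHom_mem_adjoin {a : killing t}
    (ha : a ∈ Algebra.adjoin ℂ {(((lamUnit t)⁻¹ : (killing t)ˣ) : killing t)}) :
    starHom t a ∈ Algebra.adjoin ℂ {((((lamUnit t)⁻¹)⁻¹ : (killing t)ˣ) : killing t)} := by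
  induction ha using Algebra.adjoin_induction with
  | mem x hx =>
    rw [Set.mem_singleton_iff.1 hx, starHom_lamUnit_inv, inv_inv]
    exact Algebra.self_mem_adjoin_singleton _ _
  | algebraMap c => rw [starHom_algebraMap]; exact Subalgebra.algebraMap_mem _ _
  | add x y _ _ hx hy => rw [map_add]; exact add_mem hx hy
  | mul x y _ _ hx hy => rw [map_mul]; exact mul_mem hx hy

/-- The real structure exchanges `λ` and `λ⁻¹`, so no separate analysis of lowest coefficients is
needed. -/
lemma hasLeadingTerms_lamUnit_inv : HasLeadingTerms (lamUnit t)⁻¹ := by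
  intro a ha
  have ha' : starHom t a ≠ 0 := by
    intro h
    rw [← starHom_starHom t a, h, map_zero] at ha
    exact ha rfl
  obtain ⟨d, c, h, hc, h1, h2⟩ := hasLeadingTerms_lamUnit _ ha'
  refine ⟨d, (starRingEnd ℂ) c, starHom t h, by simpa using hc, ?_, ?_⟩
  · have h3 := congrArg (starHom t) h1
    rwa [map_pow, starHom_starHom, map_mul, map_add, starHom_lamUnit_zpow, starHom_algebraMap] at h3
  · have h3 := isIntegral_map (starHom t) (fun x => starHom_mem_adjoin) h2
    rwa [map_mul, map_pow, starHom_lamUnit] at h3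

lemma transcendental_lamUnit : Transcendental ℂ (lamUnit t : killing t) := by
  rintro ⟨p, hp0, hp⟩
  apply hp0
  rw [← expand_eq_zero (show 0 < 3 by norm_num)]
  refine eq_zero_of_eval_circle fun ζ => ?_
  have h1 := congrArg (evalAt t ζ⁻¹ 0) hp
  rw [← aeval_algHom_apply, show evalAt t ζ⁻¹ 0 (lamUnit t : killing t) =
    algebraMap ℂ Mat ((ζ : ℂ)⁻¹ ^ 3) from ?_, aeval_algebraMap_apply, map_zero] at h1
  · rw [expand_eval]
    exact (map_eq_zero_iff (algebraMap ℂ Mat) (algebraMap ℂ Mat).injective).1 h1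
  · rw [Algebra.algebraMap_eq_smul_one, ← Circle.coe_inv]
    rfl

/-- The leading coefficient of a non-zero field is a constant multiple of an invertible matrix, so
it does not vanish at `z = 0`. -/
lemma IsKilling.eq_zero_of_eval {ξ : Loop} (h : IsKilling t ξ) (h0 : ∀ ζ, ξ ζ 0 = 0) : ξ = 0 := by
  by_contra hne
  obtain ⟨d, n, c, hc, -, q, hq0, hq⟩ := h.exists_lead hne
  obtain ⟨Z, hZ⟩ := exists_finset_circle (q.natDegree + 1)
  have h1 := MinLag.coeff_mem (V := LinearMap.ker (LinearMap.proj (R := ℂ) (φ := fun _ : ℂ => Mat) 0))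
    (p := q) (Z := Z) (by omega) (fun ζ _ => by
      have h2 := h0 ζ
      rw [hq, zetaPow_mul_apply] at h2
      exact (smul_eq_zero.1 h2).resolve_left (zpow_ne_zero _ (Circle.coe_ne_zero ζ))) 0
  rw [hq0] at h1
  have h2 : c • cyc (t.speed 0) ^ n = 0 := h1
  exact cyc_pow_ne_zero (t.speed_ne_zero 0) n ((smul_eq_zero.1 h2).resolve_left hc)

/-- The loops with powers of `ζ` between `d - D` and `d`. -/
def laurentBetween (d : ℤ) (D : ℕ) : Submodule ℂ Loop where
  carrier := {ξ | ∃ p : (ℂ → Mat)[X], p.natDegree ≤ D ∧ ξ = zetaPow d * evLoop p}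
  add_mem' := by
    rintro _ _ ⟨p, hp, rfl⟩ ⟨q, hq, rfl⟩
    exact ⟨p + q, (natDegree_add_le _ _).trans (max_le hp hq), by rw [map_add, mul_add]⟩
  zero_mem' := ⟨0, by simp, by simp⟩
  smul_mem' := by
    rintro c _ ⟨p, hp, rfl⟩
    refine ⟨C (fun _ => c • 1) * p, (natDegree_C_mul_le _ _).trans hp, ?_⟩
    rw [map_mul, evLoop_C]
    funext ζ z
    simp

lemma zetaPow_mul_mem_laurentBetween {ξ : Loop} {d : ℤ} {D : ℕ} (h : ξ ∈ laurentBetween d D)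
    (e : ℤ) : zetaPow e * ξ ∈ laurentBetween (e + d) D := by
  obtain ⟨p, hp, rfl⟩ := h
  exact ⟨p, hp, by rw [← mul_assoc, zetaPow_add]⟩

lemma laurentBetween_mono {d d' : ℤ} {D D' : ℕ} (h : d ≤ d') (h' : d' - D' ≤ d - D) :
    laurentBetween d D ≤ laurentBetween d' D' := by
  rintro _ ⟨p, hp, rfl⟩
  refine ⟨Polynomial.X ^ (d' - d).toNat * p, ?_, ?_⟩
  · refine natDegree_mul_le.trans ?_
    have := natDegree_X_pow_le (R := ℂ → Mat) (d' - d).toNat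
    omega
  · rw [map_mul, map_pow, evLoop_X, zetaPow_pow, ← mul_assoc, ← zetaPow_add]
    congr 2
    omega

lemma exists_mem_laurentBetween {N : ℕ} (a : Fin N → killing t) :
    ∃ d D, ∀ i, (a i : Loop) ∈ laurentBetween d D := by
  have h : ∀ i, ∃ d D, (a i : Loop) ∈ laurentBetween d D := fun i => by
    obtain ⟨c, hc⟩ := (a i).2.laurent
    obtain ⟨d, X, p, -, hp⟩ := exists_hasLead_of_laurent hc
    exact ⟨d, p.natDegree, p, le_rfl, hp⟩
  choose d D hd using h
  obtain ⟨d', hd'⟩ := (Set.finite_range d).bddAbove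
  obtain ⟨D', hD'⟩ := (Set.finite_range fun i => D i + (d' - d i).toNat).bddAbove
  refine ⟨d', D', fun i => laurentBetween_mono (hd' ⟨i, rfl⟩) ?_ (hd i)⟩
  have h1 := hD' ⟨i, rfl⟩
  have h2 := hd' ⟨i, rfl⟩
  simp only at h1
  omega

/-- At `z = 0` the field is a Laurent polynomial with `D + 1` coefficients, which its values at `D +
1` points determine. This bounds the dimension of spaces of Killing fields. -/
lemma eq_zero_of_mem_laurentBetween {a : killing t} {d : ℤ} {D : ℕ}
    (ha : (a : Loop) ∈ laurentBetween d D) {Z : Finset Circle} (hZ : Z.card = D + 1)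
    (h : ∀ ζ ∈ Z, (a : Loop) ζ 0 = 0) : a = 0 := by
  obtain ⟨p, hp, h1⟩ := ha
  have h2 := MinLag.coeff_mem (V := LinearMap.ker (LinearMap.proj (R := ℂ) (φ := fun _ : ℂ => Mat) 0))
    (p := p) (Z := Z) (by omega) (fun ζ hζ => by
      have h2 := h ζ hζ
      rw [h1, zetaPow_mul_apply] at h2
      exact (smul_eq_zero.1 h2).resolve_left (zpow_ne_zero _ (Circle.coe_ne_zero ζ)))
  refine Subtype.ext (a.2.eq_zero_of_eval fun ζ => ?_)
  rw [h1, zetaPow_mul_apply, evLoop_apply p ζ (Nat.lt_succ_self _), Pi.smul_apply, Finset.sum_apply,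
    Finset.sum_eq_zero, smul_zero]
  intro k _
  have h3 : p.coeff k 0 = 0 := h2 k
  rw [Pi.smul_apply, h3, smul_zero]

lemma lamUnit_pow_mul_mem {a : killing t} {d : ℤ} {D J k : ℕ}
    (ha : (a : Loop) ∈ laurentBetween d D) (hk : k ≤ J) :
    ((((lamUnit t : killing t) ^ 2) ^ k * a : killing t) : Loop) ∈
      laurentBetween (d + 6 * J) (D + 6 * J) := by
  have h1 : ((((lamUnit t : killing t) ^ 2) ^ k * a : killing t) : Loop) =
      zetaPow (6 * k) * a := by
    change ((lam t : Loop) ^ 2) ^ k * (a : Loop) = _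
    rw [lam_eq_zetaPow, ← pow_mul, zetaPow_pow]
    congr 2
    push_cast
    ring
  rw [h1]
  refine laurentBetween_mono ?_ ?_ (zetaPow_mul_mem_laurentBetween ha _) <;> push_cast <;> omega

/-- The algebra of Killing fields has rank at most `54` over the polynomials in `λ²`. -/
theorem exists_relation {N : ℕ} (hN : 54 < N) (a : Fin N → killing t) :
    ∃ p : Fin N → ℂ[X], p ≠ 0 ∧ ∑ i, aeval ((lamUnit t : killing t) ^ 2) (p i) * a i = 0 := by
  obtain ⟨d, D, hd⟩ := exists_mem_laurentBetween a
  -- The `N (J + 1)` products of the `a i` with powers of `λ²` up to `J` are determined by `9 (D + 6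
  -- J + 1) = 54 J + 9 (D + 1)` numbers. This `J` makes that `55 J`, which is less than `55 (J +
  -- 1)`.
  obtain ⟨J, hJ⟩ : ∃ J, J = 9 * (D + 1) := ⟨_, rfl⟩
  obtain ⟨Z, hZ⟩ := exists_finset_circle (D + 6 * J + 1)
  let b : Fin N × Fin (J + 1) → killing t := fun x => ((lamUnit t : killing t) ^ 2) ^ (x.2 : ℕ) * a x.1
  let Φ : killing t →ₗ[ℂ] (Z → Mat) := LinearMap.pi fun ζ => (evalAt t ζ 0).toLinearMap
  have hb : ¬ LinearIndependent ℂ fun x => Φ (b x) := by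
    intro h
    have h1 := h.fintype_card_le_finrank
    rw [Module.finrank_pi_fintype] at h1
    simp [Module.finrank_matrix, hZ] at h1
    have h2 := Nat.mul_le_mul_right (J + 1) (Nat.succ_le_of_lt hN)
    omega
  obtain ⟨g, hg, x, hx⟩ := Fintype.not_linearIndependent_iff.1 hb
  have hs : ∑ x, g x • b x = 0 := by
    refine eq_zero_of_mem_laurentBetween (d := d + 6 * J) (D := D + 6 * J) (Z := Z) ?_ hZ
      fun ζ hζ => ?_
    · have h1 : ∑ x, g x • b x ∈ (laurentBetween (d + 6 * J) (D + 6 * J)).comap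
          (killing t).val.toLinearMap := Submodule.sum_mem _ fun x _ =>
        Submodule.smul_mem _ _ (lamUnit_pow_mul_mem (hd x.1) (Nat.lt_succ_iff.1 x.2.2))
      exact h1
    · simp only [← map_smul, ← map_sum] at hg
      exact congrFun hg ⟨ζ, hζ⟩
  refine ⟨fun i => ∑ k : Fin (J + 1), monomial (k : ℕ) (g (i, k)), ?_, ?_⟩
  · intro h
    apply hx
    have h1 := congrArg (fun p => coeff p x.2) (congrFun h x.1)
    simpa [finsetSum_coeff, coeff_monomial, Fin.val_inj] using h1
  · rw [← hs, Fintype.sum_prod_type]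
    refine Finset.sum_congr rfl fun i _ => ?_
    rw [map_sum, Finset.sum_mul]
    refine Finset.sum_congr rfl fun k _ => ?_
    rw [aeval_monomial, Algebra.smul_def, mul_assoc]

end MinLag

end

theorem mainTheorem7 (t : MinLag.MinimalLagrangianTorus) :
    -- `𝒜` is a commutative domain and `μ_*` is an automorphism of it
    ∃ (_ : IsMulCommutative (MinLag.killing t)) (_ : IsDomain (MinLag.killing t))
      (mu : MinLag.killing t ≃ₐ[ℂ] MinLag.killing t),
      (∀ ξ : MinLag.killing t, (mu ξ : MinLag.Loop) = MinLag.muLoop ξ) ∧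
      -- `𝒜 = 𝒜^μ[ζ³ I] ≅ 𝒜^μ[t] / (t² - ζ⁶ I)`
      MinLag.IsQuadraticExtension (MinLag.fixedSubalgebra mu) (MinLag.lam t) ∧
      ∃ (δ : MinLag.SmoothCompletion (MinLag.killing t) →
            MinLag.SmoothCompletion (MinLag.fixedSubalgebra mu))
        (P₀ Pinf : MinLag.SmoothCompletion (MinLag.killing t))
        (μ : MinLag.SmoothCompletion (MinLag.killing t) →
            MinLag.SmoothCompletion (MinLag.killing t)),
        -- the inclusion `𝒜^μ ⊂ 𝒜` is dual to a double cover `δ : X → Y`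
        MinLag.IsDoubleCover δ (MinLag.inclFrac (MinLag.fixedSubalgebra mu)) ∧
        -- `P₀` and `P_∞` are the only zero and the only pole of `λ = ζ³ I`
        P₀ ≠ Pinf ∧
        (∀ P, P.IsZero (algebraMap (MinLag.killing t) _ (MinLag.lam t)) ↔ P = P₀) ∧
        (∀ P, P.IsPole (algebraMap (MinLag.killing t) _ (MinLag.lam t)) ↔ P = Pinf) ∧
        -- `δ` is ramified at `P₀` and `P_∞` only
        (∀ P, P = P₀ ∨ P = Pinf → MinLag.HasRamificationIndex δ
          (MinLag.inclFrac (MinLag.fixedSubalgebra mu)) P 2) ∧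
        (∀ P, P ≠ P₀ → P ≠ Pinf → MinLag.HasRamificationIndex δ
          (MinLag.inclFrac (MinLag.fixedSubalgebra mu)) P 1) ∧
        -- the involution `μ` of `X` induced by `μ_*` swaps the sheets of `δ`
        MinLag.IsDualTo μ (MinLag.autFrac mu) ∧
        (∀ P, μ (μ P) = P) ∧
        (∀ P Q, δ P = δ Q ↔ Q = P ∨ Q = μ P) ∧
        (∀ P, μ P = P ↔ P = P₀ ∨ P = Pinf) ∧
        -- `genus X = 2 p` where `p = genus Y`
        ∃ p : ℕ, MinLag.HasGenus (FractionRing (MinLag.fixedSubalgebra mu)) p ∧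
          MinLag.HasGenus (FractionRing (MinLag.killing t)) (2 * p) := by
  exact ⟨inferInstance, inferInstance, MinLag.muEquiv t, fun _ => rfl,
    MinLag.isQuadraticExtension (u := MinLag.lamUnit t) (MinLag.muEquiv_lamUnit t)
      (MinLag.muEquiv_muEquiv t),
    MinLag.exists_double_cover (u := MinLag.lamUnit t) (MinLag.muEquiv_lamUnit t)
      (MinLag.muEquiv_muEquiv t) MinLag.hasLeadingTerms_lamUnit MinLag.hasLeadingTerms_lamUnit_inv
      MinLag.transcendental_lamUnit (MinLag.exists_relation (N := 55) (by norm_num))⟩
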